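/- Conventions. Manifolds are smooth, finite-dimensional, Hausdorff and second countable. A constant rank Pfaffian system on a manifold $M$ is a smooth subbundle $I\subset T^*M$; $\mathrm{ann}(I)\subset TM$ is its annihilator, and congruences "mod $I$" of 2-forms are modulo the algebraic ideal generated by $I$ (equivalently, after restriction to $\mathrm{ann}(I)$). $I^\infty_x$ is the space of the differentials $dF_x$ of the smooth functions $F$ defined near $x$ with $dF\in I$, and the derived system $I'\subset I$ is spanned at each point by the values of the local sections $\theta$ of $I$ with $d\theta\equiv 0 \bmod I$. An integral manifold of $I$ is a smooth immersion $s:N\to M$ with $s^*I=0$. The polar space of a subspace $E\subset T_xM$ is $H(E)=\{v\in \mathrm{ann}(I)_x : d\theta(v,e)=0 \text{ for all } e\in E \text{ and all local sections } \theta \text{ of } I \text{ near } x\}$. An integral manifold is non-characteristic if $\dim H(E)=\dim E+1$ for each of its tangent spaces $E$, that is, if each $E$ is contained in exactly one integral element of dimension $\dim E+1$. The system $I$ is decomposable, with integers $n_1,p_1,n_2,p_2\ge 1$ and singular systems $\hat V,\check V$, if about each point there is a coframe $\theta^1,\dots,\theta^r,\hat\omega^1,\dots,\hat\omega^{n_1},\hat\tau^1,\dots,\hat\tau^{p_1},\check\omega^1,\dots,\check\omega^{n_2},\check\tau^1,\dots,\check\tau^{p_2}$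 and $0\le r_1\le r_2\le r$ with $I=\mathrm{span}\{\theta^i\}$, $\hat V=\mathrm{span}\{\theta^i,\hat\tau^a,\hat\omega^b\}$, $\check V=\mathrm{span}\{\theta^i,\check\tau^\alpha,\check\omega^\beta\}$, $I'=\mathrm{span}\{\theta^i: i\le r_1\}$, and, modulo $I$, $d\theta^i\equiv 0$ for $i\le r_1$, $d\theta^i\equiv \sum_{a,b} A^i_{ab}\,\hat\tau^a\wedge\hat\omega^b$ for $r_1<i\le r_2$, $d\theta^i\equiv \sum_{\alpha,\beta} B^i_{\alpha\beta}\,\check\tau^\alpha\wedge\check\omega^\beta$ for $r_2<i\le r$. It is Darboux integrable if moreover $I^\infty=0$, $\hat V+\check V^\infty=T^*M$ and $\hat V^\infty+\check V=T^*M$, where $\hat V^\infty$ and $\check V^\infty$ have constant rank. A canonical quotient representation of $I$ consists of manifolds $M_1,M_2$ with constant rank Pfaffian systems $K_1,K_2$ such that $K_i^\infty=0$, and a Lie group $G$ acting smoothly (possibly only locally) on $M_1$ and $M_2$ such that: (a) $G$ acts freely on $M_i$, the quotient map $q_i:M_i\to M_i/G$ is a smooth submersion onto a manifold, $g^*K_i=K_i$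 for all $g\in G$, and $\ker (q_i)_*\cap \mathrm{ann}(K_i)=0$; (b) the quotient map $q:M_1\times M_2\to (M_1\times M_2)/G_{\mathrm{diag}}$ of the diagonal action is a smooth submersion onto a manifold, and $\ker q_*\cap \mathrm{ann}(K_1'+K_2')=0$; (c) $M=(M_1\times M_2)/G_{\mathrm{diag}}$ and $I=(K_1+K_2)/G_{\mathrm{diag}}$, that is, a covector on $M$ lies in $I$ if and only if its pullback by $q$ lies in $K_1+K_2$. Here $K_1+K_2=\pi_1^*K_1+\pi_2^*K_2$, with $\pi_i:M_1\times M_2\to M_i$ the projections (and likewise for $K_1'+K_2'$). **Lemma 5.5.** Let $I$ be a decomposable Darboux integrable Pfaffian system on $M$ with the canonical quotient representation $\big((K_1+K_2)/G_{\mathrm{diag}},(M_1\times M_2)/G_{\mathrm{diag}}\big)$. Let $S\subset M$ be an embedded non-characteristic integral manifold of $I$ of dimension $n_1+n_2-1$. Choose $x_0\in S$ and $(x_1,x_2)\in M_1\times M_2$ with $q(x_1,x_2)=x_0$. Then the restriction $(K_1+K_2)|_{q^{-1}(S)}$ has a maximal integral manifold $L$ through $(x_1,x_2)$, i.e. an injectively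 immersed connected integral manifold through $(x_1,x_2)$ which contains every connected integral manifold of the restriction (of any dimension) through that point; and $L\subset M_1\times M_2$ is an $(n_1+n_2-1)$-dimensional non-characteristic integral manifold of $K_1+K_2$. -/

import Mathlib

open Set Topology
open scoped Manifold ContDiff

universe u u₁ u₂

noncomputable section

namespace Pfaff

section General

variable {E : Type*} [NormedAddCommGroup E] [NormedSpace ℝ E]
  {H : Type*} [TopologicalSpace H] (J : ModelWithCorners ℝ E H)
  (M : Type*) [TopologicalSpace M] [ChartedSpace H M]
  {E' : Type*} [NormedAddCommGroup E'] [NormedSpace ℝ E']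
  {H' : Type*} [TopologicalSpace H'] (J' : ModelWithCorners ℝ E' H')
  {M' : Type*} [TopologicalSpace M'] [ChartedSpace H' M']

/-- A (not necessarily smooth) differential 1-form on `M`. -/
abbrev OneForm := ∀ x : M, TangentSpace J x →L[ℝ] ℝ

/-- A field of subspaces of the cotangent spaces of `M`. -/
abbrev CovectorField := ∀ x : M, Submodule ℝ (TangentSpace J x →L[ℝ] ℝ)

variable {M}

/-- The 1-form `θ` is a smooth section of the cotangent bundle over `U`. -/
def SmoothFormOn [IsManifold J ∞ M] (θ : OneForm J M) (U : Set M) : Prop :=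
  ContMDiffOn J (J.prod 𝓘(ℝ, E →L[ℝ] ℝ)) ∞
    (fun x => (Bundle.TotalSpace.mk' (E →L[ℝ] ℝ) x (θ x) :
      Bundle.TotalSpace (E →L[ℝ] ℝ)
        (fun x : M => TangentSpace J x →L[ℝ] Bundle.Trivial M ℝ x))) U

/-- The coordinate expression of the 1-form `θ` in the preferred chart `φ` at `x`: the pullback
of `θ` by `φ⁻¹`, a 1-form on the model vector space. -/
def chartForm (θ : OneForm J M) (x : M) (y : E) : E →L[ℝ] ℝ :=
  (θ ((extChartAt J x).symm y)).comp (mfderiv 𝓘(ℝ, E) J (extChartAt J x).symm y)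

/-- The exterior derivative `dθ(v, w)` at `x`, computed in the preferred chart at `x` (in which
Mathlib expresses the elements of `TangentSpace J x = E`):
`dθ(v, w) = D_v θ (w) - D_w θ (v)`. -/
def dForm (θ : OneForm J M) (x : M) (v w : TangentSpace J x) : ℝ :=
  let A : E →L[ℝ] E →L[ℝ] ℝ := fderiv ℝ (chartForm J θ x) (extChartAt J x x)
  let v' : E := v
  let w' : E := w
  A v' w' - A w' v'

/-- Pullback of covectors, `α ↦ α ∘ df_x`. -/
def pullCov (f : M → M') (x : M) :
    (TangentSpace J' (f x) →L[ℝ] ℝ) →ₗ[ℝ] (TangentSpace J x →L[ℝ] ℝ) where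
  toFun α := α.comp (mfderiv J J' f x)
  map_add' α β := by ext v; rfl
  map_smul' c α := by ext v; rfl

variable {J}

/-- The annihilator `ann(K) ⊂ TM`, at the point `x`. -/
def ann (K : CovectorField J M) (x : M) : Submodule ℝ (TangentSpace J x) where
  carrier := {v | ∀ α ∈ K x, α v = 0}
  add_mem' hv hw α hα := by rw [map_add, hv α hα, hw α hα, add_zero]
  zero_mem' α _ := map_zero α
  smul_mem' c v hv α hα := by rw [map_smul, hv α hα, smul_zero]

/-- `K` is a constant rank Pfaffian system: a smooth subbundle of `T^*M` of some rank `r`, that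
is, it is locally spanned by `r` smooth pointwise independent 1-forms. -/
def IsPfaffian [IsManifold J ∞ M] (K : CovectorField J M) : Prop :=
  ∃ r : ℕ, ∀ x : M, ∃ U : Set M, IsOpen U ∧ x ∈ U ∧ ∃ θ : Fin r → OneForm J M,
    (∀ i, SmoothFormOn J (θ i) U) ∧
    ∀ y ∈ U, LinearIndependent ℝ (fun i => θ i y) ∧
      K y = Submodule.span ℝ (range fun i => θ i y)

/-- `θ` is a smooth section of `K` over `U`. -/
def IsSectionOn [IsManifold J ∞ M] (K : CovectorField J M) (θ : OneForm J M) (U : Set M) : Prop :=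
  SmoothFormOn J θ U ∧ ∀ y ∈ U, θ y ∈ K y

/-- The space `K^∞_x` of the differentials at `x` of the local first integrals of `K` defined
about `x`. -/
def firstIntegrals (K : CovectorField J M) (x : M) :
    Submodule ℝ (TangentSpace J x →L[ℝ] ℝ) where
  carrier := {α | ∃ (U : Set M) (F : M → ℝ), IsOpen U ∧ x ∈ U ∧
    ContMDiffOn J 𝓘(ℝ, ℝ) ∞ F U ∧
    (∀ y ∈ U, (show TangentSpace J y →L[ℝ] ℝ from mfderiv J 𝓘(ℝ, ℝ) F y) ∈ K y) ∧
    α = mfderiv J 𝓘(ℝ, ℝ) F x}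
  zero_mem' := by
    refine ⟨univ, fun _ => 0, isOpen_univ, mem_univ _, contMDiffOn_const, fun y _ => ?_, ?_⟩
    · rw [mfderiv_const]; exact (K y).zero_mem
    · rw [mfderiv_const]; rfl
  add_mem' := by
    rintro α β ⟨U, F, hU, hxU, hF, hFK, rfl⟩ ⟨V, F', hV, hxV, hF', hFK', rfl⟩
    have key : ∀ y ∈ U ∩ V, (mfderiv J 𝓘(ℝ, ℝ) (F + F') y : TangentSpace J y →L[ℝ] ℝ) =
        (show TangentSpace J y →L[ℝ] ℝ from mfderiv J 𝓘(ℝ, ℝ) F y) +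
        (show TangentSpace J y →L[ℝ] ℝ from mfderiv J 𝓘(ℝ, ℝ) F' y) := fun y hy =>
      mfderiv_add ((hF.contMDiffAt (hU.mem_nhds hy.1)).mdifferentiableAt (by simp))
        ((hF'.contMDiffAt (hV.mem_nhds hy.2)).mdifferentiableAt (by simp))
    refine ⟨U ∩ V, F + F', hU.inter hV, ⟨hxU, hxV⟩,
      (hF.mono inter_subset_left).add (hF'.mono inter_subset_right), fun y hy => ?_, ?_⟩
    · exact (key y hy).symm ▸ (K y).add_mem (hFK y hy.1) (hFK' y hy.2)
    · exact (key x ⟨hxU, hxV⟩).symm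
  smul_mem' := by
    rintro c α ⟨U, F, hU, hxU, hF, hFK, rfl⟩
    have key : ∀ y ∈ U, (mfderiv J 𝓘(ℝ, ℝ) (c • F) y : TangentSpace J y →L[ℝ] ℝ) =
        c • (show TangentSpace J y →L[ℝ] ℝ from mfderiv J 𝓘(ℝ, ℝ) F y) := fun y hy =>
      const_smul_mfderiv ((hF.contMDiffAt (hU.mem_nhds hy)).mdifferentiableAt (by simp)) c
    refine ⟨U, c • F, hU, hxU, by
      have h := (contMDiffOn_const (c := c) (I := J) (I' := 𝓘(ℝ, ℝ)) (n := ∞) (s := U)).smul hF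
      exact h, fun y hy => ?_, ?_⟩
    · exact (key y hy).symm ▸ (K y).smul_mem c (hFK y hy)
    · exact (key x hxU).symm

/-- The derived system `K'`: at `x` it is spanned by the values of the local smooth sections `θ` of
`K` with `dθ ≡ 0 mod K`. A 2-form is `≡ 0 mod K` exactly if it vanishes on `ann K`. -/
def derived [IsManifold J ∞ M] (K : CovectorField J M) : CovectorField J M := fun x =>
  Submodule.span ℝ {α | ∃ (U : Set M) (θ : OneForm J M), IsOpen U ∧ x ∈ U ∧ IsSectionOn K θ U ∧
    (∀ y ∈ U, ∀ v ∈ ann K y, ∀ w ∈ ann K y, dForm J θ y v w = 0) ∧ α = θ x}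

/-- The value on `(v, w)` of the wedge product `α ∧ β` of two covectors. -/
def wedge {x : M} (α β : TangentSpace J x →L[ℝ] ℝ) (v w : TangentSpace J x) : ℝ :=
  α v * β w - α w * β v

/-- `K` is a decomposable Pfaffian system with the characteristic (singular) systems `V` and `W`
and with the numbers `n₁, p₁, n₂, p₂`: about each point there is a coframe
`θ^1, …, θ^r, π^1, …, π^{n₁}, τ^1, …, τ^{p₁}, η^1, …, η^{n₂}, σ^1, …, σ^{p₂}` such that `K` is
spanned by the `θ^i`, `V` by the `θ^i, π^b, τ^a`, `W` by the `θ^i, η^b, σ^a`, such that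
`dθ^i ≡ 0` for the first `r₁` indices, `dθ^i ≡ A^i_{ab} τ^a ∧ π^b` for `r₁ ≤ i < r₂`,
`dθ^i ≡ B^i_{ab} σ^a ∧ η^b` for the others (modulo `K`, that is, on `ann K`), and such that `K'`
is spanned by the first `r₁` of the `θ^i`. -/
def IsDecomposable [IsManifold J ∞ M] (K V W : CovectorField J M) (n₁ p₁ n₂ p₂ : ℕ) : Prop :=
  1 ≤ n₁ ∧ 1 ≤ p₁ ∧ 1 ≤ n₂ ∧ 1 ≤ p₂ ∧
  ∀ x : M, ∃ U : Set M, IsOpen U ∧ x ∈ U ∧ ∃ (r r₁ r₂ : ℕ) (_ : r₁ ≤ r₂) (_ : r₂ ≤ r)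
    (θ : Fin r → OneForm J M) (π : Fin n₁ → OneForm J M) (τ : Fin p₁ → OneForm J M)
    (η : Fin n₂ → OneForm J M) (σ : Fin p₂ → OneForm J M)
    (A : Fin r → Fin p₁ → Fin n₁ → M → ℝ) (B : Fin r → Fin p₂ → Fin n₂ → M → ℝ),
    (∀ i, SmoothFormOn J (θ i) U) ∧ (∀ i, SmoothFormOn J (π i) U) ∧
    (∀ i, SmoothFormOn J (τ i) U) ∧ (∀ i, SmoothFormOn J (η i) U) ∧
    (∀ i, SmoothFormOn J (σ i) U) ∧
    ∀ y ∈ U,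
      LinearIndependent ℝ (Sum.elim (fun i => θ i y) (Sum.elim
        (Sum.elim (fun i => π i y) fun i => τ i y) (Sum.elim (fun i => η i y) fun i => σ i y))) ∧
      Submodule.span ℝ (range (Sum.elim (fun i => θ i y) (Sum.elim
        (Sum.elim (fun i => π i y) fun i => τ i y)
        (Sum.elim (fun i => η i y) fun i => σ i y)))) = ⊤ ∧
      K y = Submodule.span ℝ (range fun i => θ i y) ∧
      V y = Submodule.span ℝ
        (range fun i => θ i y) ⊔ Submodule.span ℝ (range fun i => π i y) ⊔
        Submodule.span ℝ (range fun i => τ i y) ∧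
      W y = Submodule.span ℝ
        (range fun i => θ i y) ⊔ Submodule.span ℝ (range fun i => η i y) ⊔
        Submodule.span ℝ (range fun i => σ i y) ∧
      (∀ i : Fin r, ∀ v ∈ ann K y, ∀ w ∈ ann K y,
        (i.val < r₁ → dForm J (θ i) y v w = 0) ∧
        (r₁ ≤ i.val → i.val < r₂ → dForm J (θ i) y v w =
          ∑ a, ∑ b, A i a b y * wedge (τ a y) (π b y) v w) ∧
        (r₂ ≤ i.val → dForm J (θ i) y v w =
          ∑ a, ∑ b, B i a b y * wedge (σ a y) (η b y) v w)) ∧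
      derived K y = Submodule.span ℝ ((fun i : Fin r => θ i y) '' {i | i.val < r₁})

/-- Darboux integrability of a system `K` with singular systems `V` and `W`: `K^∞ = 0`,
`V + W^∞ = T^*M` and `V^∞ + W = T^*M`, where `V^∞` and `W^∞` have constant rank. -/
structure IsDarbouxIntegrable (K V W : CovectorField J M) : Prop where
  firstIntegrals_eq_bot : ∀ x, firstIntegrals K x = ⊥
  const_rank_left : ∃ c : ℕ, ∀ x, Module.finrank ℝ (firstIntegrals V x) = c
  const_rank_right : ∃ c : ℕ, ∀ x, Module.finrank ℝ (firstIntegrals W x) = c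
  sup_right : ∀ x, V x ⊔ firstIntegrals W x = ⊤
  sup_left : ∀ x, firstIntegrals V x ⊔ W x = ⊤

/-- `s : N → M` is an integral manifold of `K`: a smooth immersion with `s^*K = 0`. -/
structure IsIntegralManifold (J' : ModelWithCorners ℝ E' H') (K : CovectorField J M)
    (s : M' → M) : Prop where
  smooth : ContMDiff J' J ∞ s
  immersion : ∀ y, Function.Injective (mfderiv J' J s y)
  pull_eq_zero : ∀ y, ∀ α ∈ K (s y), pullCov J' J s y α = 0

/-- The polar space `H(F)` of a subspace `F ⊂ T_xM`: all `v ∈ ann(K)` with `dθ(v, e) = 0` for all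
`e ∈ F` and all smooth sections `θ` of `K` about `x`. If `F` is an integral element of `K`, then
`F + ℝ v` is again an integral element exactly if `v ∈ H(F)`. -/
def polarSpace [IsManifold J ∞ M] (K : CovectorField J M) (x : M) (F : Submodule ℝ (TangentSpace J x)) :
    Submodule ℝ (TangentSpace J x) where
  carrier := {v | v ∈ ann K x ∧ ∀ (U : Set M) (θ : OneForm J M), IsOpen U → x ∈ U →
    IsSectionOn K θ U → ∀ e ∈ F, dForm J θ x v e = 0}
  zero_mem' := ⟨(ann K x).zero_mem, fun U θ _ _ _ e _ => by
    let A := fderiv ℝ (chartForm J θ x) (extChartAt J x x)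
    have h4 : ∀ b : E, A 0 b - A b 0 = 0 := by
      intro b; rw [map_zero, map_zero, zero_apply, sub_zero]
    exact h4 e⟩
  add_mem' := by
    rintro v w ⟨hv, hv'⟩ ⟨hw, hw'⟩
    refine ⟨(ann K x).add_mem hv hw, fun U θ hU hx hθ e he => ?_⟩
    have h1 := hv' U θ hU hx hθ e he
    have h2 := hw' U θ hU hx hθ e he
    have h3 : dForm J θ x (v + w) e = dForm J θ x v e + dForm J θ x w e := by
      let A := fderiv ℝ (chartForm J θ x) (extChartAt J x x)
      have h4 : ∀ a b c : E, A (a + b) c - A c (a + b) = (A a c - A c a) + (A b c - A c b) := by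
        intro a b c; rw [map_add, map_add, add_apply]; ring
      exact h4 v w e
    rw [h3, h1, h2, add_zero]
  smul_mem' := by
    rintro c v ⟨hv, hv'⟩
    refine ⟨(ann K x).smul_mem c hv, fun U θ hU hx hθ e he => ?_⟩
    have h1 := hv' U θ hU hx hθ e he
    have h3 : dForm J θ x (c • v) e = c * dForm J θ x v e := by
      let A := fderiv ℝ (chartForm J θ x) (extChartAt J x x)
      have h4 : ∀ a b : E, A (c • a) b - A b (c • a) = c * (A a b - A b a) := by
        intro a b
        rw [map_smul, map_smul, smul_apply, smul_eq_mul, smul_eq_mul]; ring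
      exact h4 v e
    rw [h3, h1, mul_zero]

/-- The integral manifold `s` of `K` is non-characteristic: the polar space of each of its tangent
spaces exceeds the tangent space by exactly one dimension, so that the tangent space lies in
exactly one integral element of one dimension more. -/
def IsNonCharacteristic [IsManifold J ∞ M] (J' : ModelWithCorners ℝ E' H') (K : CovectorField J M)
    (s : M' → M) : Prop :=
  ∀ y : M', Module.finrank ℝ (polarSpace K (s y) (LinearMap.range (mfderiv J' J s y).toLinearMap))
    = Module.finrank ℝ (LinearMap.range (mfderiv J' J s y).toLinearMap) + 1

/-- The sum `K₁ + K₂ = π₁^* K₁ + π₂^* K₂` on the product of two manifolds. -/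
def sumSystem (K₁ : CovectorField J M) (K₂ : CovectorField J' M') :
    CovectorField (J.prod J') (M × M') := fun p =>
  (K₁ p.1).map (pullCov (J.prod J') J (Prod.fst : M × M' → M) p) ⊔
    (K₂ p.2).map (pullCov (J.prod J') J' (Prod.snd : M × M' → M') p)

/-- `L`, with `j : L → M` injective, is the maximal integral manifold through `p` of the
restriction of `K` to the (embedded) submanifold `P`: it is a connected integral manifold of `K`
inside `P` that goes through `p` and contains every connected integral manifold of `K`, of whatever
dimension, inside `P` and through `p`. -/
structure IsMaximalIntegralManifold (k : ℕ) (K : CovectorField J M) (P : Set M) (p : M)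
    {L : Type u} [TopologicalSpace L] [ChartedSpace (EuclideanSpace ℝ (Fin k)) L]
    (j : L → M) : Prop where
  isManifold : IsManifold (𝓡 k) ∞ L
  t2Space : T2Space L
  secondCountable : SecondCountableTopology L
  connected : ConnectedSpace L
  injective : Function.Injective j
  integral : IsIntegralManifold (𝓡 k) K j
  subset : range j ⊆ P
  mem : p ∈ range j
  maximal : ∀ (k' : ℕ) (N : Type u) [TopologicalSpace N]
    [ChartedSpace (EuclideanSpace ℝ (Fin k')) N] [IsManifold (𝓡 k') ∞ N] [T2Space N]
    [SecondCountableTopology N] [ConnectedSpace N] (i : N → M),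
    IsIntegralManifold (𝓡 k') K i → range i ⊆ P → p ∈ range i → range i ⊆ range j

end General

section Action

variable {EG : Type*} [NormedAddCommGroup EG] [NormedSpace ℝ EG]
  {HG : Type*} [TopologicalSpace HG] (JG : ModelWithCorners ℝ EG HG)
  (G : Type*) [TopologicalSpace G] [ChartedSpace HG G] [Group G]
  {E : Type*} [NormedAddCommGroup E] [NormedSpace ℝ E]
  {H : Type*} [TopologicalSpace H] (J : ModelWithCorners ℝ E H)
  (X : Type*) [TopologicalSpace X] [ChartedSpace H X]
  {E' : Type*} [NormedAddCommGroup E'] [NormedSpace ℝ E']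
  {H' : Type*} [TopologicalSpace H'] {J' : ModelWithCorners ℝ E' H'}
  {X' : Type*} [TopologicalSpace X'] [ChartedSpace H' X']

/-- A smooth local action of the Lie group `G` on `X`. Outside of `domain` the values of `act` are
irrelevant. The case `domain = univ` is that of a global smooth action. -/
structure LocalAction where
  domain : Set (G × X)
  act : G → X → X
  isOpen_domain : IsOpen domain
  smooth : ContMDiffOn (JG.prod J) J ∞ (fun z : G × X => act z.1 z.2) domain
  one_mem : ∀ x, ((1 : G), x) ∈ domain
  one_act : ∀ x, act 1 x = x
  mul_act : ∀ g h x, (h, x) ∈ domain → (g, act h x) ∈ domain → (g * h, x) ∈ domain →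
    act g (act h x) = act (g * h) x
  inv_mem : ∀ g x, (g, x) ∈ domain → (g⁻¹, act g x) ∈ domain

variable {JG G J X}

/-- The diagonal action `g (x, x') = (g x, g x')` on the product. -/
def LocalAction.diag (a : LocalAction JG G J X) (a' : LocalAction JG G J' X') :
    LocalAction JG G (J.prod J') (X × X') where
  domain := {z | (z.1, z.2.1) ∈ a.domain ∧ (z.1, z.2.2) ∈ a'.domain}
  act g x := (a.act g x.1, a'.act g x.2)
  isOpen_domain :=
    (a.isOpen_domain.preimage
      (continuous_fst.prodMk (continuous_fst.comp continuous_snd))).inter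
    (a'.isOpen_domain.preimage
      (continuous_fst.prodMk (continuous_snd.comp continuous_snd)))
  smooth := by
    refine ContMDiffOn.prodMk ?_ ?_
    · exact a.smooth.comp
        (contMDiff_fst.prodMk (contMDiff_fst.comp contMDiff_snd)).contMDiffOn fun z hz => hz.1
    · exact a'.smooth.comp
        (contMDiff_fst.prodMk (contMDiff_snd.comp contMDiff_snd)).contMDiffOn fun z hz => hz.2
  one_mem x := ⟨a.one_mem x.1, a'.one_mem x.2⟩
  one_act x := Prod.ext (a.one_act x.1) (a'.one_act x.2)
  mul_act g h x h1 h2 h3 :=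
    Prod.ext (a.mul_act g h x.1 h1.1 h2.1 h3.1) (a'.mul_act g h x.2 h1.2 h2.2 h3.2)
  inv_mem g x h := ⟨a.inv_mem g x.1 h.1, a'.inv_mem g x.2 h.2⟩

/-- The action is free. -/
def LocalAction.IsFree (a : LocalAction JG G J X) : Prop :=
  ∀ g x, (g, x) ∈ a.domain → a.act g x = x → g = 1

/-- `x` and `y` lie on the same orbit: they are joined by finitely many moves `z ↦ g z` and their
inverses. -/
def LocalAction.SameOrbit (a : LocalAction JG G J X) : X → X → Prop :=
  Relation.EqvGen fun x y => ∃ g, (g, x) ∈ a.domain ∧ a.act g x = y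

/-- `q : X → X'` is the quotient map of the regular action `a`: a smooth surjective submersion whose
fibres are the orbits. It identifies the manifold `X'` with the orbit space `X / G`. -/
structure LocalAction.IsQuotient (a : LocalAction JG G J X)
    (J' : ModelWithCorners ℝ E' H') (q : X → X') : Prop where
  smooth : ContMDiff J J' ∞ q
  surjective : Function.Surjective q
  submersion : ∀ x, Function.Surjective (mfderiv J J' q x)
  fibre : ∀ x y, q x = q y ↔ a.SameOrbit x y

/-- `G` is a symmetry group of `K`: `g^*K = K` for all `g`. -/
def LocalAction.IsSymmetry (a : LocalAction JG G J X) (K : CovectorField J X) : Prop :=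
  ∀ g x, (g, x) ∈ a.domain → (K (a.act g x)).map (pullCov J J (a.act g) x) = K x

/-- The action with quotient map `q` is transversal to `K`: `ker q_* ∩ ann K = 0`. -/
def IsTransversal (J' : ModelWithCorners ℝ E' H') (q : X → X') (K : CovectorField J X) : Prop :=
  ∀ x, LinearMap.ker (mfderiv J J' q x).toLinearMap ⊓ ann K x = ⊥

/-- `I` is the reduction `K / G` of `K` by the quotient map `q`: a covector of the quotient belongs
to `I` exactly if its pullback by `q` belongs to `K`. -/
def IsReduction (J' : ModelWithCorners ℝ E' H') (q : X → X') (K : CovectorField J X)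
    (I : CovectorField J' X') : Prop :=
  ∀ (x : X) (α : TangentSpace J' (q x) →L[ℝ] ℝ), α ∈ I (q x) ↔ pullCov J J' q x α ∈ K x

end Action

section Representation

variable {EG : Type*} [NormedAddCommGroup EG] [NormedSpace ℝ EG]
  {HG : Type*} [TopologicalSpace HG] {JG : ModelWithCorners ℝ EG HG}
  {G : Type*} [TopologicalSpace G] [ChartedSpace HG G] [Group G]
  {m₁ m₂ m l₁ l₂ : ℕ}
  {M₁ : Type*} [TopologicalSpace M₁] [ChartedSpace (EuclideanSpace ℝ (Fin m₁)) M₁]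
  [IsManifold (𝓡 m₁) ∞ M₁]
  {M₂ : Type*} [TopologicalSpace M₂] [ChartedSpace (EuclideanSpace ℝ (Fin m₂)) M₂]
  [IsManifold (𝓡 m₂) ∞ M₂]
  {M : Type*} [TopologicalSpace M] [ChartedSpace (EuclideanSpace ℝ (Fin m)) M]
  {Q₁ : Type*} [TopologicalSpace Q₁] [ChartedSpace (EuclideanSpace ℝ (Fin l₁)) Q₁]
  {Q₂ : Type*} [TopologicalSpace Q₂] [ChartedSpace (EuclideanSpace ℝ (Fin l₂)) Q₂]

/-- The data form a canonical quotient representation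
`(I, M) = ((K₁ + K₂) / G_diag, (M₁ × M₂) / G_diag)`: the `K_i` are constant rank Pfaffian systems
with `K_i^∞ = 0`; `G` acts freely and regularly (with quotients `q_i : M_i → Q_i = M_i / G`) on the
`M_i`, is a symmetry group of the `K_i` and transversal to them; the diagonal action is regular with
quotient `q : M₁ × M₂ → M` and transversal to `K₁' + K₂'`; and `I` is the reduction of
`K₁ + K₂`. -/
structure IsQuotientRepresentation
    (a₁ : LocalAction JG G (𝓡 m₁) M₁) (a₂ : LocalAction JG G (𝓡 m₂) M₂)
    (q₁ : M₁ → Q₁) (q₂ : M₂ → Q₂) (q : M₁ × M₂ → M)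
    (K₁ : CovectorField (𝓡 m₁) M₁) (K₂ : CovectorField (𝓡 m₂) M₂)
    (I : CovectorField (𝓡 m) M) : Prop where
  pfaffian₁ : IsPfaffian K₁
  pfaffian₂ : IsPfaffian K₂
  firstIntegrals₁ : ∀ x, firstIntegrals K₁ x = ⊥
  firstIntegrals₂ : ∀ x, firstIntegrals K₂ x = ⊥
  free₁ : a₁.IsFree
  free₂ : a₂.IsFree
  quotient₁ : a₁.IsQuotient (𝓡 l₁) q₁
  quotient₂ : a₂.IsQuotient (𝓡 l₂) q₂
  symmetry₁ : a₁.IsSymmetry K₁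
  symmetry₂ : a₂.IsSymmetry K₂
  transversal₁ : IsTransversal (𝓡 l₁) q₁ K₁
  transversal₂ : IsTransversal (𝓡 l₂) q₂ K₂
  quotient : (a₁.diag a₂).IsQuotient (𝓡 m) q
  transversal : IsTransversal (𝓡 m) q (sumSystem (𝓡 m₂) (derived K₁) (derived K₂))
  reduction : IsReduction (𝓡 m) q (sumSystem (𝓡 m₂) K₁ K₂) I

end Representation

end Pfaff

end

/-! Write `X = M₁ × M₂` and `K = K₁ + K₂`. The argument rests on `I` being the reduction of `K` by
the submersion `q`, with `ker q_* ∩ ann K' = 0` (`IsTransversalReduction`). Since `ann K ⊂ ann K'`,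
the differential of `q` is injective on `ann K`, and by duality it maps `ann K` onto `ann I`.
Transversality also makes every covector of `K` the sum of a covector of `K'` and the pullback of a
covector of `I`. The sections that generate `K'` have exterior derivatives vanishing on `ann K`, so
on `ann K` the derivatives of sections of `K` are controlled by those of sections of `I`
(`IsTransversalReduction.dForm_eq_zero`). Two consequences follow: `q_*` identifies the polar spaces
of `K` and of `I` (`map_polarSpace`), and the distribution `ann K ∩ T(q⁻¹(S))`, which projects
isomorphically onto `TS`, is involutive because derivatives of sections of `I` vanish on `TS`.

The leaves of this distribution are obtained as an étale space over `S`. A horizontal lift of `s`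
through each point exists locally by Frobenius' theorem (`exists_horizontal_lift`), and two lifts
that agree at a point agree near it by a Gronwall estimate (`IsTransversalReduction.eventuallyEq`).
The lifts define a leaf topology on `q⁻¹(S)` for which the projection to `S` is a local
homeomorphism. The component `L` of the chosen point takes its charts from `S`; it is Hausdorff
because it injects continuously into `X`, and second countable by the theorem of Poincaré and
Volterra. A connected integral manifold inside `q⁻¹(S)` projects smoothly to `S`, as `S` is
embedded, and locally it is a horizontal lift composed with this projection. It is therefore
continuous for the leaf topology and cannot leave `L`.

The remaining claims concern an arbitrary maximal integral manifold. It immerses into `S`, which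
bounds its dimension above. It contains the leaf just constructed, hence covers an open subset of
`S`, which bounds the dimension below by comparison of Hausdorff dimensions. Its tangent spaces then
map isomorphically onto those of `S`, and the correspondence of polar spaces transfers the
non-characteristic condition. -/

noncomputable section

/-! ### Frobenius' theorem, uniqueness and the inverse function theorem in vector spaces -/

section Analysis

open Filter Metric

variable {E : Type*} [NormedAddCommGroup E] [NormedSpace ℝ E]
  {W : Type*} [NormedAddCommGroup W] [NormedSpace ℝ W]

/-- Mean value inequality on the segment from `p` to `q`, where the derivative differs from its
value at `p` by at most `C * ‖q - p‖`. -/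
theorem Convex.norm_image_sub_sub_fderiv_le {F : E → W} {s : Set E} (hs : Convex ℝ s) {C : NNReal}
    (hF : ∀ p ∈ s, DifferentiableAt ℝ F p) (hL : LipschitzOnWith C (fderiv ℝ F) s)
    {p q : E} (hp : p ∈ s) (hq : q ∈ s) :
    ‖F q - F p - fderiv ℝ F p (q - p)‖ ≤ C * ‖q - p‖ * ‖q - p‖ := by
  have hseg : segment ℝ p q ⊆ s := hs.segment_subset hp hq
  refine (convex_segment p q).norm_image_sub_le_of_norm_hasFDerivWithin_le'
    (f' := fun z => fderiv ℝ F z) (fun z hz => (hF z (hseg hz)).hasFDerivAt.hasFDerivWithinAt)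
    (fun z hz => ?_) (left_mem_segment ℝ p q) (right_mem_segment ℝ p q)
  have h1 := hL.dist_le_mul z (hseg hz) p hp
  rw [dist_eq_norm, dist_eq_norm] at h1
  refine h1.trans ?_
  gcongr
  obtain ⟨a, b, ha, hb, hab, rfl⟩ := hz
  have : a • p + b • q - p = b • (q - p) := by
    rw [← eq_sub_iff_add_eq] at hab; subst hab; module
  rw [this, norm_smul, Real.norm_of_nonneg hb]
  have : b ≤ 1 := by linarith
  exact mul_le_of_le_one_left (norm_nonneg _) this

/-- A `C²` map has uniformly bounded and Lipschitz first derivatives on some ball. -/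
theorem ContDiffAt.exists_closedBall_bounds {F : E → W} {p₀ : E} (hF : ContDiffAt ℝ 2 F p₀)
    {P : E → Prop} (hP : ∀ᶠ p in 𝓝 p₀, P p) :
    ∃ ρ : ℝ, 0 < ρ ∧ ∃ C : NNReal, 1 ≤ C ∧ (∀ p ∈ closedBall p₀ ρ, DifferentiableAt ℝ F p ∧
      ‖F p‖ ≤ C ∧ ‖fderiv ℝ F p‖ ≤ C ∧ P p) ∧ LipschitzOnWith C F (closedBall p₀ ρ) ∧
      LipschitzOnWith C (fderiv ℝ F) (closedBall p₀ ρ) := by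
  have h1 : ContDiffAt ℝ 1 F p₀ := hF.of_le (by norm_num)
  have h2 : ContDiffAt ℝ 1 (fderiv ℝ F) p₀ := hF.fderiv_right (by norm_num)
  obtain ⟨C1, s1, hs1, hL1⟩ := h1.exists_lipschitzOnWith
  obtain ⟨C2, s2, hs2, hL2⟩ := h2.exists_lipschitzOnWith
  have h3 : ∀ᶠ p in 𝓝 p₀, ‖F p‖ < ‖F p₀‖ + 1 :=
    h1.continuousAt.norm.eventually_lt_const (by linarith)
  have h4 : ∀ᶠ p in 𝓝 p₀, ‖fderiv ℝ F p‖ < ‖fderiv ℝ F p₀‖ + 1 :=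
    h2.continuousAt.norm.eventually_lt_const (by linarith)
  have h5 : ∀ᶠ p in 𝓝 p₀, DifferentiableAt ℝ F p :=
    (h1.eventually (by simp)).mono fun p hp => hp.differentiableAt (by simp)
  obtain ⟨ρ, hρ, hb⟩ := nhds_basis_closedBall.eventually_iff.1
    (h3.and (h4.and (h5.and (hP.and (Filter.Eventually.and hs1 hs2)))))
  refine ⟨ρ, hρ, C1 + C2 + ‖F p₀‖₊ + ‖fderiv ℝ F p₀‖₊ + 1, le_add_self, fun p hp => ?_, ?_, ?_⟩
  · obtain ⟨a1, a2, a3, a4, -⟩ := hb hp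
    refine ⟨a3, ?_, ?_, a4⟩
    · refine a1.le.trans ?_
      push_cast
      have : 0 ≤ ‖fderiv ℝ F p₀‖ := norm_nonneg _
      linarith [C1.2, C2.2]
    · refine a2.le.trans ?_
      push_cast
      have : 0 ≤ ‖F p₀‖ := norm_nonneg _
      linarith [C1.2, C2.2]
  · refine (hL1.mono fun p hp => (hb hp).2.2.2.2.1).weaken ?_
    simp only [add_assoc]; exact le_self_add
  · refine (hL2.mono fun p hp => (hb hp).2.2.2.2.2).weaken ?_
    rw [add_comm C1]; simp only [add_assoc]; exact le_self_add

/-- **Frobenius' theorem** for a total differential equation `Du(x) = F(x, u(x))`, existence of a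
differentiable solution. -/
theorem exists_hasFDerivAt_of_integrable [CompleteSpace W] {F : E × W → E →L[ℝ] W} {x₀ : E} {w₀ : W}
    (hF : ContDiffAt ℝ 2 F (x₀, w₀))
    (hint : ∀ᶠ p in 𝓝 (x₀, w₀), ∀ v v',
      fderiv ℝ F p (v, F p v) v' = fderiv ℝ F p (v', F p v') v) :
    ∃ u : E → W, u x₀ = w₀ ∧ ∀ᶠ x in 𝓝 x₀, HasFDerivAt u (F (x, u x)) x := by
  obtain ⟨ρ, hρ, C, hC, hB, hLF, hLD⟩ := hF.exists_closedBall_bounds hint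
  have hC1 : (1 : ℝ) ≤ C := by exact_mod_cast hC
  have hC0 : (0 : ℝ) < C := by linarith
  -- Speeds along a ray are at most `C * δ ≤ ρ / 4`, so solutions stay within `ρ / 2` of `w₀` for
  -- unit time. The comparison curve below adds at most `C * ‖k‖ ≤ 2 * C * δ ≤ ρ / 2`, so it stays
  -- within `ρ`.
  set δ : ℝ := min 1 (ρ / (4 * C)) with hδ
  have hδ0 : 0 < δ := by positivity
  have hδ1 : δ ≤ 1 := min_le_left _ _
  have hδC : C * δ ≤ ρ / 4 := by
    calc C * δ ≤ C * (ρ / (4 * C)) := by gcongr; exact min_le_right _ _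
      _ = ρ / 4 := by field_simp
  have hδρ : δ ≤ ρ / 4 := by nlinarith
  have hmem : ∀ h : E, ‖h‖ < δ → ∀ t ∈ Icc (0 : ℝ) 1, ∀ z ∈ closedBall w₀ ρ,
      (x₀ + t • h, z) ∈ closedBall (x₀, w₀) ρ := by
    intro h hh t ht z hz
    rw [mem_closedBall, Prod.dist_eq]
    refine max_le ?_ hz
    rw [dist_eq_norm, add_sub_cancel_left, norm_smul, Real.norm_of_nonneg ht.1]
    nlinarith [norm_nonneg h, ht.2, ht.1]
  have hlip : ∀ h : E, ‖h‖ < δ → ∀ t ∈ Icc (0 : ℝ) 1,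
      LipschitzOnWith C (fun z => F (x₀ + t • h, z) h) (closedBall w₀ ρ) := by
    intro h hh t ht
    refine LipschitzOnWith.of_dist_le_mul fun a ha b hb => ?_
    rw [dist_eq_norm, ← sub_apply]
    refine (ContinuousLinearMap.le_opNorm _ _).trans ?_
    have := hLF.dist_le_mul _ (hmem h hh t ht a ha) _ (hmem h hh t ht b hb)
    rw [dist_eq_norm, Prod.dist_eq, dist_self, max_eq_right dist_nonneg] at this
    calc _ ≤ C * dist a b * 1 := by gcongr; linarith
      _ = _ := mul_one _
  -- solutions along the rays
  have hsol : ∀ h : E, ‖h‖ < δ → ∃ z : ℝ → W, z 0 = w₀ ∧ (∀ t, z t ∈ closedBall w₀ (ρ / 2)) ∧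
      ∀ t ∈ Icc (0 : ℝ) 1, HasDerivWithinAt z (F (x₀ + t • h, z t) h) (Icc 0 1) t := by
    intro h hh
    have hsub : closedBall w₀ (ρ / 2) ⊆ closedBall w₀ ρ := closedBall_subset_closedBall (by linarith)
    have hδ' : (δ.toNNReal : ℝ) = δ := Real.coe_toNNReal _ hδ0.le
    have hρ' : ((ρ / 2).toNNReal : ℝ) = ρ / 2 := Real.coe_toNNReal _ (by positivity)
    have hPL : IsPicardLindelof (fun t z => F (x₀ + t • h, z) h) (tmin := 0) (tmax := 1)
        ⟨0, by simp⟩ w₀ (ρ / 2).toNNReal 0 (C * δ.toNNReal) C := by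
      constructor
      · intro t ht
        exact (hlip h hh t ht).mono (by rwa [hρ'])
      · rw [hρ']
        intro z hz t ht
        have hd := (hB _ (hmem h hh t ht z (hsub hz))).1.continuousAt
        have hc : ContinuousAt (fun t : ℝ => (x₀ + t • h, z)) t := by fun_prop
        have h2 : ContinuousAt (fun t : ℝ => F (x₀ + t • h, z)) t :=
          ContinuousAt.comp (f := fun t : ℝ => (x₀ + t • h, z)) hd hc
        exact (h2.clm_apply continuousAt_const).continuousWithinAt
      · rw [hρ']
        intro t ht z hz
        refine (ContinuousLinearMap.le_opNorm _ _).trans ?_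
        have := (hB _ (hmem h hh t ht z (hsub hz))).2.1
        rw [NNReal.coe_mul, hδ']
        gcongr
      · rw [NNReal.coe_mul, hδ', hρ']
        simp only [sub_zero, sub_self, NNReal.coe_zero, max_eq_left zero_le_one]
        linarith
    obtain ⟨α, hα⟩ := ODE.FunSpace.exists_isFixedPt_next hPL (mem_closedBall_self le_rfl)
    refine ⟨α.compProj, ?_, fun t => hρ' ▸ α.compProj_mem_closedBall hPL.mul_max_le,
      fun t ht => ?_⟩
    · have := ODE.FunSpace.compProj_val (α := α) (t := ⟨0, by simp⟩)
      rw [this, ← hα, ODE.FunSpace.next_apply₀]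
    · refine (ODE.hasDerivWithinAt_picard_Icc (f := fun t z => F (x₀ + t • h, z) h)
        (t₀ := 0) (by simp) hPL.continuousOn_uncurry
        α.continuous_compProj.continuousOn (fun _ ht' => α.compProj_mem_closedBall hPL.mul_max_le)
        w₀ ht).congr_of_mem (fun t' ht' => ?_) ht
      nth_rw 1 [← hα]
      rw [ODE.FunSpace.compProj_of_mem ht', ODE.FunSpace.next_apply]
  choose! z hz0 hzb hzd using hsol
  have hzc : ∀ h, ‖h‖ < δ → ContinuousOn (z h) (Icc 0 1) := fun h hh t ht =>
    (hzd h hh t ht).continuousWithinAt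
  have hzd' : ∀ h, ‖h‖ < δ → ∀ t ∈ Ico (0 : ℝ) 1,
      HasDerivWithinAt (z h) (F (x₀ + t • h, z h t) h) (Ici t) t := fun h hh t ht =>
    (hzd h hh t ⟨ht.1, ht.2.le⟩).mono_of_mem_nhdsWithin (Icc_mem_nhdsGE_of_mem ht)
  have hρ2 : closedBall w₀ (ρ / 2) ⊆ closedBall w₀ ρ := closedBall_subset_closedBall (by linarith)
  -- comparison of neighbouring rays
  have hcomp : ∀ h k : E, ‖h‖ < δ → ‖h + k‖ < δ →
      ‖z (h + k) 1 - z h 1 - F (x₀ + h, z h 1) k‖ ≤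
        2 * C ^ 2 * (Real.exp C - 1) * ‖k‖ ^ 2 := by
    intro h k hh hhk
    have hk : ‖k‖ ≤ 2 * δ := by
      have : k = (h + k) - h := by abel
      rw [this]
      exact (norm_sub_le _ _).trans (by linarith)
    let p : ℝ → E × W := fun t => (x₀ + t • h, z h t)
    -- First-order guess for the solution along the ray towards `h + k`. Its velocity contains
    -- `DF(h, F h) k`, which integrability turns into `DF(k, F k) h`, the term that the Taylor
    -- expansion of the right-hand side asks for. Hence `y` solves the equation of that ray up to
    -- `O(‖k‖²)`.
    let y : ℝ → W := fun t => z h t + t • F (p t) k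
    have hp : ∀ t ∈ Icc (0 : ℝ) 1, p t ∈ closedBall (x₀, w₀) ρ := fun t ht =>
      hmem h hh t ht _ (hρ2 (hzb h hh t))
    have hy : ∀ t ∈ Icc (0 : ℝ) 1, y t ∈ closedBall w₀ ρ := by
      intro t ht
      have h1 := hzb h hh t
      rw [mem_closedBall, dist_eq_norm] at h1 ⊢
      have h2 : ‖t • F (p t) k‖ ≤ ρ / 2 := by
        rw [norm_smul, Real.norm_of_nonneg ht.1]
        have h3 : ‖F (p t) k‖ ≤ C * (2 * δ) := by
          refine (ContinuousLinearMap.le_opNorm _ _).trans ?_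
          have := (hB _ (hp t ht)).2.1
          gcongr
        nlinarith [ht.1, ht.2, norm_nonneg (F (p t) k)]
      have : y t - w₀ = (z h t - w₀) + t • F (p t) k := by simp only [y]; abel
      rw [this]
      exact (norm_add_le _ _).trans (by linarith)
    have hcy : ContinuousOn y (Icc 0 1) := by
      refine (hzc h hh).add (continuousOn_id.smul ?_)
      refine ContinuousOn.clm_apply ?_ continuousOn_const
      intro t ht
      have h1 := (hB _ (hp t ht)).1.continuousAt
      have h2 : ContinuousWithinAt p (Icc 0 1) t := by
        refine ContinuousWithinAt.prodMk ?_ (hzc h hh t ht)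
        fun_prop
      exact ContinuousAt.comp_continuousWithinAt (f := p) h1 h2
    have hdy : ∀ t ∈ Ico (0 : ℝ) 1, HasDerivWithinAt y (F (p t) h + (t • fderiv ℝ F (p t)
        (h, F (p t) h) k + F (p t) k)) (Ici t) t := by
      intro t ht
      have hz1 := hzd' h hh t ht
      have hx1 : HasDerivWithinAt (fun t : ℝ => x₀ + t • h) h (Ici t) t := by
        simpa using ((hasDerivAt_id t).smul_const h).const_add x₀ |>.hasDerivWithinAt
      have hp1 : HasDerivWithinAt p (h, F (p t) h) (Ici t) t := hx1.prodMk hz1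
      have hF1 : HasDerivWithinAt (fun t => F (p t)) (fderiv ℝ F (p t) (h, F (p t) h)) (Ici t) t :=
        (hB _ (hp t ⟨ht.1, ht.2.le⟩)).1.hasFDerivAt.comp_hasDerivWithinAt t hp1
      have hF2 : HasDerivWithinAt (fun t => F (p t) k) (fderiv ℝ F (p t) (h, F (p t) h) k)
          (Ici t) t := by
        simpa using hF1.clm_apply (hasDerivWithinAt_const t (Ici t) k)
      have := hz1.add ((hasDerivWithinAt_id t _).smul hF2)
      exact this.congr_deriv (by simp [p])
    -- The defect of `y` has two parts, the term quadratic in `k` and the Taylor remainder of `F`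
    -- applied to `h + k`. Each is at most `C ^ 3 * ‖k‖ ^ 2`.
    have key := dist_le_of_approx_trajectories_ODE_of_mem (K := C)
      (v := fun t w => F (x₀ + t • (h + k), w) (h + k)) (s := fun _ => closedBall w₀ ρ)
      (f := z (h + k)) (g := y) (a := 0) (b := 1) (δ := 0) (εf := 0)
      (εg := 2 * C ^ 3 * ‖k‖ ^ 2)
      (fun t ht => hlip (h + k) hhk t ⟨ht.1, ht.2.le⟩) (hzc _ hhk) (hzd' _ hhk)
      (fun t ht => by rw [dist_self]) (fun t ht => hρ2 (hzb _ hhk t)) hcy hdy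
      (fun t ht => ?_) (fun t ht => hy t ⟨ht.1, ht.2.le⟩)
      (by simp [y, hz0 h hh, hz0 _ hhk]) 1 (by simp)
    · rw [gronwallBound_of_K_ne_0 hC0.ne', dist_eq_norm] at key
      simp only [y, p, one_smul] at key
      rw [sub_sub]
      refine key.trans (le_of_eq ?_)
      field_simp
      simp
    · have ht' : t ∈ Icc (0 : ℝ) 1 := ⟨ht.1, ht.2.le⟩
      obtain ⟨-, b1, b2, b3⟩ := hB _ (hp t ht')
      set q : E × W := (x₀ + t • (h + k), y t) with hq
      have hqm : q ∈ closedBall (x₀, w₀) ρ := hmem _ hhk t ht' _ (hy t ht')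
      have hqp : q - p t = t • (k, F (p t) k) := by
        simp only [q, p, y, Prod.mk_sub_mk, Prod.smul_mk]
        congr 1
        · rw [smul_add]; abel
        · abel
      have hkF : ‖((k, F (p t) k) : E × W)‖ ≤ C * ‖k‖ := by
        rw [Prod.norm_def]
        refine max_le ?_ ?_
        · nlinarith [norm_nonneg k]
        · refine (ContinuousLinearMap.le_opNorm _ _).trans ?_
          gcongr
      have hqpn : ‖q - p t‖ ≤ C * ‖k‖ := by
        rw [hqp, norm_smul, Real.norm_of_nonneg ht.1]
        nlinarith [ht.2, norm_nonneg ((k, F (p t) k) : E × W), ht.1]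
      have hR := (convex_closedBall (x₀, w₀) ρ).norm_image_sub_sub_fderiv_le
        (fun p hp => (hB p hp).1) hLD (hp t ht') hqm
      set R := F q - F (p t) - fderiv ℝ F (p t) (q - p t) with hRdef
      have hFq : F q = F (p t) + t • fderiv ℝ F (p t) (k, F (p t) k) + R := by
        rw [hRdef, hqp, map_smul]; abel
      have hRn : ‖R‖ ≤ C ^ 3 * ‖k‖ ^ 2 := by
        refine hR.trans ?_
        calc C * ‖q - p t‖ * ‖q - p t‖ ≤ C * (C * ‖k‖) * (C * ‖k‖) := by gcongr
          _ = _ := by ring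
      rw [dist_eq_norm]
      change ‖_ - F q (h + k)‖ ≤ _
      have e1 : F (p t) h + (t • fderiv ℝ F (p t) (h, F (p t) h) k + F (p t) k) - F q (h + k)
          = - (t • fderiv ℝ F (p t) (k, F (p t) k) k + R (h + k)) := by
        rw [hFq, b3 h k]
        simp only [add_apply, smul_apply, map_add]
        abel
      rw [e1, norm_neg]
      refine (norm_add_le _ _).trans ?_
      have e2 : ‖t • fderiv ℝ F (p t) (k, F (p t) k) k‖ ≤ C ^ 3 * ‖k‖ ^ 2 := by
        rw [norm_smul, Real.norm_of_nonneg ht.1]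
        have e3 : ‖fderiv ℝ F (p t) (k, F (p t) k) k‖ ≤ C * (C * ‖k‖) * ‖k‖ := by
          refine (ContinuousLinearMap.le_opNorm _ _).trans ?_
          gcongr
          refine (ContinuousLinearMap.le_opNorm _ _).trans ?_
          gcongr
        have e4 : C * (C * ‖k‖) * ‖k‖ ≤ C ^ 3 * ‖k‖ ^ 2 := by
          have : (C : ℝ) ^ 2 ≤ C ^ 3 := pow_le_pow_right₀ hC1 (by norm_num)
          nlinarith [sq_nonneg ‖k‖]
        nlinarith [ht.1, ht.2, norm_nonneg (fderiv ℝ F (p t) (k, F (p t) k) k)]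
      have e5 : ‖R (h + k)‖ ≤ C ^ 3 * ‖k‖ ^ 2 := by
        refine (ContinuousLinearMap.le_opNorm _ _).trans ?_
        nlinarith [norm_nonneg R, norm_nonneg (h + k)]
      linarith
  -- The solution at `x` is the endpoint of the curve over the ray from `x₀` to `x`. The comparison
  -- of rays says that its derivative is `F (x, u x)` with a quadratic error.
  refine ⟨fun x => z (x - x₀) 1, ?_, ?_⟩
  · have h0 : ‖(0 : E)‖ < δ := by simpa using hδ0
    have hc : ∀ t ∈ Icc (0 : ℝ) 1, z 0 t = z 0 0 := by
      refine constant_of_has_deriv_right_zero (hzc 0 h0) fun t ht => ?_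
      simpa using hzd' 0 h0 t ht
    simp only [sub_self]
    rw [hc 1 (by simp), hz0 0 h0]
  · filter_upwards [Metric.ball_mem_nhds x₀ hδ0] with x hx
    rw [mem_ball, dist_eq_norm] at hx
    rw [hasFDerivAt_iff_isLittleO_nhds_zero]
    refine Asymptotics.IsBigO.trans_isLittleO (g := fun k : E => ‖k‖ ^ 2) ?_
      (Asymptotics.isLittleO_norm_pow_id one_lt_two)
    refine Asymptotics.IsBigO.of_bound (2 * C ^ 2 * (Real.exp C - 1)) ?_
    have : ∀ᶠ k in 𝓝 (0 : E), ‖x - x₀ + k‖ < δ := by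
      have hc : ContinuousAt (fun k : E => ‖x - x₀ + k‖) 0 := by fun_prop
      exact hc.eventually_lt_const (by simpa using hx)
    filter_upwards [this] with k hk
    have := hcomp (x - x₀) k hx hk
    rw [add_sub_cancel] at this
    rw [show x + k - x₀ = x - x₀ + k by abel]
    simpa using this

/-- Bootstrap: if `u` is `C^n`, then so is its derivative `F (x, u x)`, and `u` is `C^(n+1)`. -/
theorem contDiffAt_of_hasFDerivAt {F : E × W → E →L[ℝ] W} {u : E → W} {x₀ : E}
    (hF : ∀ᶠ p in 𝓝 (x₀, u x₀), ContDiffAt ℝ ∞ F p)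
    (hu : ∀ᶠ x in 𝓝 x₀, HasFDerivAt u (F (x, u x)) x) :
    ∀ᶠ x in 𝓝 x₀, ContDiffAt ℝ ∞ u x := by
  have hc : ContinuousAt (fun x => (x, u x)) x₀ :=
    continuousAt_id.prodMk hu.self_of_nhds.continuousAt
  obtain ⟨V, hV, hVo, hxV⟩ := _root_.eventually_nhds_iff.1 (hu.and (hc.eventually hF))
  have key : ∀ n : ℕ, ContDiffOn ℝ n u V := by
    intro n
    induction n with
    | zero => exact contDiffOn_zero.2 fun x hx => (hV x hx).1.continuousAt.continuousWithinAt
    | succ n ih =>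
      push_cast
      rw [contDiffOn_succ_iff_fderiv_of_isOpen hVo]
      refine ⟨fun x hx => (hV x hx).1.differentiableAt.differentiableWithinAt, by simp, ?_⟩
      have h1 : ContDiffOn ℝ n (fun x => F (x, u x)) V := by
        intro x hx
        have h2 : ContDiffAt ℝ n F (x, u x) := (hV x hx).2.of_le (by exact_mod_cast le_top)
        exact h2.comp_contDiffWithinAt (f := fun x => (x, u x)) x
          (contDiffWithinAt_id.prodMk (ih x hx))
      exact h1.congr fun x hx => (hV x hx).1.fderiv
  filter_upwards [hVo.mem_nhds hxV] with x hx
  exact (contDiffOn_infty.2 key).contDiffAt (hVo.mem_nhds hx)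

/-- **Frobenius' theorem**, existence: if the kernels of `Ω` are graphs over `E` and
`Ω` is involutive, then there is a local graph tangent to the kernels of `Ω`. -/
theorem exists_graph_tangent [FiniteDimensional ℝ W] {R : Type*} [NormedAddCommGroup R]
    [NormedSpace ℝ R] [FiniteDimensional ℝ R] {Ω : E × W → E × W →L[ℝ] R} {x₀ : E} {w₀ : W}
    (hΩ : ∀ᶠ p in 𝓝 (x₀, w₀), ContDiffAt ℝ ∞ Ω p)
    (hex : ∀ᶠ p in 𝓝 (x₀, w₀), ∀ v, ∃ w, Ω p (v, w) = 0)
    (hinj : ∀ᶠ p in 𝓝 (x₀, w₀), ∀ w, Ω p (0, w) = 0 → w = 0)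
    (hd : ∀ᶠ p in 𝓝 (x₀, w₀), ∀ X Y, Ω p X = 0 → Ω p Y = 0 →
      fderiv ℝ Ω p X Y = fderiv ℝ Ω p Y X) :
    ∃ u : E → W, u x₀ = w₀ ∧ ∀ᶠ x in 𝓝 x₀, ContDiffAt ℝ ∞ u x ∧
      ∀ v, Ω (x, u x) (v, fderiv ℝ u x v) = 0 := by
  have : CompleteSpace W := FiniteDimensional.complete ℝ W
  let inl := ContinuousLinearMap.inl ℝ E W
  let inr := ContinuousLinearMap.inr ℝ E W
  -- A left inverse at the base point alone suffices: `A ∘ Ω ∘ inr` is the identity there and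
  -- remains invertible nearby. Thus `Ω p (v, w) = 0` can be solved for `w = F p v` with `F` smooth.
  obtain ⟨A₀, hA₀⟩ := LinearMap.exists_leftInverse_of_injective
    ((Ω (x₀, w₀)).comp inr).toLinearMap (LinearMap.ker_eq_bot'.2 fun w hw =>
      hinj.self_of_nhds w hw)
  let A : R →L[ℝ] W := A₀.toContinuousLinearMap
  let G : E × W → W →L[ℝ] W := fun p => A.comp ((Ω p).comp inr)
  have hG0 : G (x₀, w₀) = ContinuousLinearEquiv.refl ℝ W := by
    ext w
    exact LinearMap.congr_fun hA₀ w
  have hGs : ∀ {p}, ContDiffAt ℝ ∞ Ω p → ContDiffAt ℝ ∞ G p := fun hp =>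
    contDiffAt_const.clm_comp (hp.clm_comp contDiffAt_const)
  have hGe : ∀ᶠ p in 𝓝 (x₀, w₀), ∃ e : W ≃L[ℝ] W, (e : W →L[ℝ] W) = G p := by
    have h1 := ContinuousLinearEquiv.nhds (ContinuousLinearEquiv.refl ℝ W)
    rw [← hG0] at h1
    exact (hGs hΩ.self_of_nhds).continuousAt h1
  let F : E × W → E →L[ℝ] W := fun p => -((G p).inverse.comp (A.comp ((Ω p).comp inl)))
  have hFs : ∀ᶠ p in 𝓝 (x₀, w₀), ContDiffAt ℝ ∞ F p := by
    filter_upwards [hΩ, hGe] with p hp ⟨e, he⟩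
    refine (ContDiffAt.clm_comp ?_ (contDiffAt_const.clm_comp (hp.clm_comp contDiffAt_const))).neg
    have h1 : ContDiffAt ℝ ∞ ContinuousLinearMap.inverse (G p) := he ▸ contDiffAt_map_inverse e
    exact h1.comp p (hGs hp)
  have hsplit : ∀ p v w, Ω p (v, w) = Ω p (v, 0) + Ω p (0, w) := fun p v w => by
    rw [← map_add]; simp
  have hFΩ : ∀ᶠ p in 𝓝 (x₀, w₀), ∀ v, Ω p (v, F p v) = 0 := by
    filter_upwards [hex, hGe] with p hp ⟨e, he⟩ v
    obtain ⟨w, hw⟩ := hp v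
    have h1 : Ω p (v, 0) = - Ω p (0, w) := eq_neg_of_add_eq_zero_left ((hsplit p v w).symm.trans hw)
    have h2 : F p v = w := by
      have h3 : A (Ω p (v, 0)) = - G p w := by rw [h1, map_neg]; rfl
      have h4 : F p v = - (G p).inverse (A (Ω p (v, 0))) := rfl
      rw [h4, h3, map_neg, neg_neg, ← he, ContinuousLinearMap.inverse_equiv]
      simp
    rw [h2, hw]
  have hint : ∀ᶠ p in 𝓝 (x₀, w₀), ∀ v v',
      fderiv ℝ F p (v, F p v) v' = fderiv ℝ F p (v', F p v') v := by
    filter_upwards [hFΩ, hFΩ.eventually_nhds, hΩ, hFs, hinj, hd] with p h0 h1 h2 h3 h4 h5 v v'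
    have hΩd := (h2.differentiableAt (by simp)).hasFDerivAt
    have hFd := (h3.differentiableAt (by simp)).hasFDerivAt
    -- This is the identity `Ω p (a, F p a) = 0` differentiated in the direction `X`. Subtracting
    -- its instances for the two horizontal lifts, involutivity cancels the derivatives of `Ω` and
    -- leaves a vertical vector in the kernel.
    have hder : ∀ X a, fderiv ℝ Ω p X (a, F p a) + Ω p (0, fderiv ℝ F p X a) = 0 := by
      intro X a
      have e1 : HasFDerivAt (fun p => (a, F p a))
          ((0 : E × W →L[ℝ] E).prod ((fderiv ℝ F p).flip a)) p := by
        refine (hasFDerivAt_const a p).prodMk ?_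
        simpa using hFd.clm_apply (hasFDerivAt_const a p)
      have e2 := hΩd.clm_apply e1
      have e3 : HasFDerivAt (fun p => Ω p (a, F p a)) (0 : E × W →L[ℝ] R) p := by
        refine (hasFDerivAt_const (0 : R) p).congr_of_eventuallyEq ?_
        filter_upwards [h1] with q hq using hq a
      have e4 := DFunLike.congr_fun (e2.unique e3) X
      simp only [add_apply, ContinuousLinearMap.comp_apply, ContinuousLinearMap.flip_apply,
        ContinuousLinearMap.prod_apply, zero_apply] at e4
      rw [add_comm]; exact e4
    have g1 := hder (v, F p v) v'
    have g2 := hder (v', F p v') v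
    have g3 := h5 (v, F p v) (v', F p v') (h0 v) (h0 v')
    have g4 : Ω p (0, fderiv ℝ F p (v, F p v) v' - fderiv ℝ F p (v', F p v') v) = 0 := by
      have : ((0 : E), fderiv ℝ F p (v, F p v) v' - fderiv ℝ F p (v', F p v') v) =
          (0, fderiv ℝ F p (v, F p v) v') - (0, fderiv ℝ F p (v', F p v') v) := by simp
      rw [this, map_sub]
      rw [g3] at g1
      rw [← sub_eq_zero.2 (g1.trans g2.symm)]
      abel
    exact sub_eq_zero.1 (h4 _ g4)
  obtain ⟨u, hu0, hu⟩ := exists_hasFDerivAt_of_integrable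
    (hFs.self_of_nhds.of_le (by norm_cast)) hint
  refine ⟨u, hu0, ?_⟩
  have hc : ContinuousAt (fun x => (x, u x)) x₀ :=
    continuousAt_id.prodMk hu.self_of_nhds.continuousAt
  rw [← hu0] at hFs hFΩ
  filter_upwards [contDiffAt_of_hasFDerivAt hFs hu, hu, hc.eventually hFΩ] with x h1 h2 h3
  refine ⟨h1, fun v => ?_⟩
  rw [h2.fderiv]
  exact h3 v

/-- Two maps with the same value at a point and with `Φ(f) ∘ Df = Φ(g) ∘ Dg`, where `Φ` is
injective, agree near the point. -/
theorem eventuallyEq_of_injective_comp_fderiv {N R : Type*} [NormedAddCommGroup N]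
    [NormedSpace ℝ N] [NormedAddCommGroup R] [NormedSpace ℝ R] [FiniteDimensional ℝ E]
    {Φ : E → E →L[ℝ] R} {f g : N → E} {y : N} (hΦ : ContDiffAt ℝ 1 Φ (f y))
    (hinj : Function.Injective (Φ (f y))) (hfg : f y = g y) (hf : ContDiffAt ℝ 1 f y)
    (hg : ContDiffAt ℝ 1 g y)
    (h : ∀ᶠ x in 𝓝 y, ∀ v, Φ (f x) (fderiv ℝ f x v) = Φ (g x) (fderiv ℝ g x v)) :
    f =ᶠ[𝓝 y] g := by
  obtain ⟨K, s, hs, hL⟩ := hΦ.exists_lipschitzOnWith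
  obtain ⟨c, hc0, hc⟩ := (Φ (f y)).toLinearMap.exists_antilipschitzWith (LinearMap.ker_eq_bot.2 hinj)
  -- Injectivity with a lower bound persists under small perturbations; the factor `2` absorbs the
  -- change of `Φ`.
  have hbd : ∀ᶠ z in 𝓝 (f y), ∀ v, ‖v‖ ≤ 2 * c * ‖Φ z v‖ := by
    have h1 : ∀ᶠ z in 𝓝 (f y), ‖Φ z - Φ (f y)‖ < 1 / (2 * c) := by
      have : ContinuousAt (fun z => ‖Φ z - Φ (f y)‖) (f y) :=
        (hΦ.continuousAt.sub continuousAt_const).norm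
      exact this.eventually_lt_const (by simpa using by positivity)
    filter_upwards [h1] with z hz v
    have h2 : ‖v‖ ≤ c * ‖Φ (f y) v‖ := by
      have := hc.le_mul_dist v 0
      simpa using this
    have h3 : ‖Φ (f y) v‖ ≤ ‖Φ z v‖ + 1 / (2 * c) * ‖v‖ := by
      have e : Φ (f y) v = Φ z v - (Φ z - Φ (f y)) v := by rw [sub_apply]; abel
      rw [e]
      refine (norm_sub_le _ _).trans ?_
      gcongr
      refine (ContinuousLinearMap.le_opNorm _ _).trans ?_
      gcongr
    have h4 : (c : ℝ) * (‖Φ z v‖ + 1 / (2 * c) * ‖v‖) = c * ‖Φ z v‖ + ‖v‖ / 2 := by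
      have : (c : ℝ) ≠ 0 := by exact_mod_cast hc0.ne'
      field_simp
    have h5 : (c : ℝ) * ‖Φ (f y) v‖ ≤ c * (‖Φ z v‖ + 1 / (2 * c) * ‖v‖) := by gcongr
    linarith
  have hgd : ∀ᶠ x in 𝓝 y, ‖fderiv ℝ g x‖ < ‖fderiv ℝ g y‖ + 1 :=
    (hg.fderiv_right (m := 0) (by norm_num)).continuousAt.norm.eventually_lt_const (by linarith)
  have hfs : ∀ᶠ x in 𝓝 y, f x ∈ s := hf.continuousAt hs
  have hgs : ∀ᶠ x in 𝓝 y, g x ∈ s := hg.continuousAt (hfg ▸ hs)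
  have hfdiff := (hf.eventually (by simp)).mono fun x hx => hx.differentiableAt one_ne_zero
  have hgdiff := (hg.eventually (by simp)).mono fun x hx => hx.differentiableAt one_ne_zero
  obtain ⟨ρ, hρ, hball⟩ := Metric.nhds_basis_ball.eventually_iff.1 (h.and (hgd.and (hfs.and
    (hgs.and (hfdiff.and (hgdiff.and (hf.continuousAt.eventually hbd)))))))
  filter_upwards [ball_mem_nhds y hρ] with x hx
  have hseg : ∀ t ∈ Icc (0 : ℝ) 1, y + t • (x - y) ∈ ball y ρ := by
    intro t ht
    rw [mem_ball, dist_eq_norm] at hx ⊢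
    rw [add_sub_cancel_left, norm_smul, Real.norm_of_nonneg ht.1]
    nlinarith [ht.2, ht.1, norm_nonneg (x - y)]
  have hder : ∀ t ∈ Icc (0 : ℝ) 1, HasDerivAt (fun t : ℝ => f (y + t • (x - y)) - g (y + t • (x - y)))
      (fderiv ℝ f (y + t • (x - y)) (x - y) - fderiv ℝ g (y + t • (x - y)) (x - y)) t := by
    intro t ht
    obtain ⟨-, -, -, -, b1, b2, -⟩ := hball (hseg t ht)
    have h1 : HasDerivAt (fun t : ℝ => y + t • (x - y)) (x - y) t := by
      simpa using ((hasDerivAt_id t).smul_const (x - y)).const_add y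
    exact (b1.hasFDerivAt.comp_hasDerivAt t h1).sub (b2.hasFDerivAt.comp_hasDerivAt t h1)
  have := eq_zero_of_abs_deriv_le_mul_abs_self_of_eq_zero_right (a := 0) (b := 1)
    (K := 2 * c * (K * ((‖fderiv ℝ g y‖ + 1) * ‖x - y‖)))
    (fun t ht => (hder t ht).continuousAt.continuousWithinAt)
    (fun t ht => (hder t ⟨ht.1, ht.2.le⟩).hasDerivWithinAt) (by simp [hfg]) (fun t ht => ?_) 1 (by simp)
  · simpa [sub_eq_zero] using this
  · obtain ⟨b1, b2, b3, b4, -, -, b5⟩ := hball (hseg t ⟨ht.1, ht.2.le⟩)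
    set q := y + t • (x - y)
    refine (b5 _).trans ?_
    -- From `Φ(f) Df = Φ(g) Dg` follows `Φ(f)(Df - Dg) = (Φ(g) - Φ(f)) Dg`. As `Φ` is Lipschitz, the
    -- derivative of `f - g` along the segment is bounded by a multiple of `f - g`, and Gronwall
    -- gives `f = g`.
    have e1 : Φ (f q) (fderiv ℝ f q (x - y) - fderiv ℝ g q (x - y)) =
        (Φ (g q) - Φ (f q)) (fderiv ℝ g q (x - y)) := by
      rw [map_sub, b1, sub_apply]
    rw [e1, mul_assoc (2 * (c : ℝ))]
    gcongr
    refine (ContinuousLinearMap.le_opNorm _ _).trans ?_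
    have e2 : ‖Φ (g q) - Φ (f q)‖ ≤ K * ‖f q - g q‖ := by
      have := hL.dist_le_mul _ b4 _ b3
      rwa [dist_eq_norm, dist_eq_norm, norm_sub_rev (g q)] at this
    have e3 : ‖fderiv ℝ g q (x - y)‖ ≤ (‖fderiv ℝ g y‖ + 1) * ‖x - y‖ := by
      refine (ContinuousLinearMap.le_opNorm _ _).trans ?_
      gcongr
    calc _ ≤ (K * ‖f q - g q‖) * ((‖fderiv ℝ g y‖ + 1) * ‖x - y‖) := by gcongr
      _ = _ := by ring

/-- The inverse function theorem, with a smooth inverse on an open set. -/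
theorem exists_openPartialHomeomorph_contDiffAt [CompleteSpace E] {f : E → W} {a : E}
    (hf : ∀ᶠ x in 𝓝 a, ContDiffAt ℝ ∞ f x) (e : E ≃L[ℝ] W) (he : fderiv ℝ f a = e) :
    ∃ φ : OpenPartialHomeomorph E W, (φ : E → W) = f ∧ a ∈ φ.source ∧
      ∀ y ∈ φ.target, ContDiffAt ℝ ∞ φ.symm y := by
  have h0 := hf.self_of_nhds
  have hd : HasFDerivAt f (e : E →L[ℝ] W) a := he ▸ (h0.differentiableAt (by simp)).hasFDerivAt
  let φ := h0.toOpenPartialHomeomorph f hd (by simp)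
  have hinv : ∀ᶠ x in 𝓝 a, ∃ e' : E ≃L[ℝ] W, (e' : E →L[ℝ] W) = fderiv ℝ f x := by
    have h1 := ContinuousLinearEquiv.nhds e
    rw [← he] at h1
    exact (h0.fderiv_right (m := 0) (by norm_num)).continuousAt h1
  obtain ⟨V, hV, hVo, haV⟩ := _root_.eventually_nhds_iff.1 (hf.and hinv)
  refine ⟨φ.restrOpen V hVo, rfl, ⟨h0.mem_toOpenPartialHomeomorph_source hd (by simp), haV⟩,
    fun y hy => ?_⟩
  obtain ⟨hc, e', he'⟩ := hV _ ((φ.restrOpen V hVo).map_target hy).2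
  exact (φ.restrOpen V hVo).contDiffAt_symm hy
    (he' ▸ (hc.differentiableAt (by simp)).hasFDerivAt) hc

end Analysis

namespace Pfaff

/-! ### 1-forms in charts, pullbacks and the exterior derivative -/

section Forms

variable {E : Type*} [NormedAddCommGroup E] [NormedSpace ℝ E]
  {H : Type*} [TopologicalSpace H] {J : ModelWithCorners ℝ E H}
  {M : Type*} [TopologicalSpace M] [ChartedSpace H M]
  {E' : Type*} [NormedAddCommGroup E'] [NormedSpace ℝ E']
  {H' : Type*} [TopologicalSpace H'] {J' : ModelWithCorners ℝ E' H'}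
  {M' : Type*} [TopologicalSpace M'] [ChartedSpace H' M']
  {F : Type*} [NormedAddCommGroup F] [NormedSpace ℝ F]

theorem eventually_extChartAt_left_inv (x : M) :
    ∀ᶠ z in 𝓝 x, (extChartAt J x).symm (extChartAt J x z) = z := by
  filter_upwards [extChartAt_source_mem_nhds (I := J) x] with z hz
  exact (extChartAt J x).left_inv hz

theorem tendsto_extChartAt_symm (x : M) :
    Filter.Tendsto (extChartAt J x).symm (𝓝 (extChartAt J x x)) (𝓝 x) := by
  have := continuousAt_extChartAt_symm (I := J) x
  rwa [ContinuousAt, extChartAt_to_inv] at this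

variable [J.Boundaryless] [J'.Boundaryless]

theorem eventually_mem_extChartAt_target (x : M) :
    ∀ᶠ y in 𝓝 (extChartAt J x x), y ∈ (extChartAt J x).target :=
  extChartAt_target_mem_nhds x

variable [IsManifold J ∞ M] [IsManifold J' ∞ M']

theorem contMDiffAt_extChartAt_symm_of_mem {x : M} {y : E} (hy : y ∈ (extChartAt J x).target) :
    ContMDiffAt 𝓘(ℝ, E) J ∞ (extChartAt J x).symm y :=
  (contMDiffOn_extChartAt_symm x).contMDiffAt ((isOpen_extChartAt_target x).mem_nhds hy)

theorem contMDiffAt_extChartAt_symm (x : M) :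
    ContMDiffAt 𝓘(ℝ, E) J ∞ (extChartAt J x).symm (extChartAt J x x) :=
  contMDiffAt_extChartAt_symm_of_mem (mem_extChartAt_target x)

theorem mfderiv_extChartAt_symm_self (x : M) :
    mfderiv 𝓘(ℝ, E) J (extChartAt J x).symm (extChartAt J x x) = ContinuousLinearMap.id ℝ E := by
  have : IsManifold J 1 M := IsManifold.of_le (n := ∞) (by simp)
  have h := mfderivWithin_range_extChartAt_symm (I := J) (x := x)
  rwa [J.range_eq_univ, mfderivWithin_univ] at h

theorem contMDiffAt_iff_contDiffAt_comp_extChartAt_symm {g : M → F} {x : M} :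
    ContMDiffAt J 𝓘(ℝ, F) ∞ g x ↔
      ContDiffAt ℝ ∞ (fun y => g ((extChartAt J x).symm y)) (extChartAt J x x) := by
  constructor
  · intro h
    rw [← contMDiffAt_iff_contDiffAt]
    refine ContMDiffAt.comp (g := g) (extChartAt J x x) ?_ (contMDiffAt_extChartAt_symm x)
    rwa [extChartAt_to_inv]
  · intro h
    have h1 := h.contMDiffAt.comp x (contMDiffAt_extChartAt (I := J) (n := ∞))
    refine h1.congr_of_eventuallyEq ?_
    filter_upwards [eventually_extChartAt_left_inv (J := J) x] with z hz
    rw [Function.comp_apply, hz]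

/-- The trivialization of the tangent bundle at `x` is the differential of the chart at `x`, so the
bundle coordinates of `θ` are those of its pullback by the inverse chart. -/
theorem contMDiffAt_form_iff {θ : OneForm J M} {x : M} :
    ContMDiffAt J (J.prod 𝓘(ℝ, E →L[ℝ] ℝ)) ∞
    (fun x => (Bundle.TotalSpace.mk' (E →L[ℝ] ℝ) x (θ x) :
      Bundle.TotalSpace (E →L[ℝ] ℝ)
        (fun x : M => TangentSpace J x →L[ℝ] Bundle.Trivial M ℝ x))) x ↔
      ContDiffAt ℝ ∞ (chartForm J θ x) (extChartAt J x x) := by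
  have : IsManifold J 1 M := IsManifold.of_le (n := ∞) (by simp)
  rw [contMDiffAt_hom_bundle]
  refine (and_iff_right contMDiffAt_id).trans ?_
  rw [contMDiffAt_iff_contDiffAt_comp_extChartAt_symm]
  have h : ∀ {f g : E → E →L[ℝ] ℝ} {a : E}, f =ᶠ[𝓝 a] g →
      (ContDiffAt ℝ ∞ f a ↔ ContDiffAt ℝ ∞ g a) := fun h =>
    ⟨fun hf => hf.congr_of_eventuallyEq h.symm, fun hg => hg.congr_of_eventuallyEq h⟩
  refine h ?_
  filter_upwards [eventually_mem_extChartAt_target (J := J) x] with y hy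
  have hy' : (extChartAt J x).symm y ∈ (chartAt H x).source := by
    rw [← extChartAt_source J]; exact (extChartAt J x).map_target hy
  rw [ContinuousLinearMap.inCoordinates, TangentBundle.symmL_trivializationAt hy',
    (extChartAt J x).right_inv hy, J.range_eq_univ, mfderivWithin_univ]
  ext v
  simp [chartForm]

theorem smoothFormOn_iff {θ : OneForm J M} {U : Set M} (hU : IsOpen U) :
    SmoothFormOn J θ U ↔ ∀ x ∈ U, ContDiffAt ℝ ∞ (chartForm J θ x) (extChartAt J x x) :=
  ⟨fun h x hx => contMDiffAt_form_iff.1 ((h x hx).contMDiffAt (hU.mem_nhds hx)),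
    fun h x hx => (contMDiffAt_form_iff.2 (h x hx)).contMDiffWithinAt⟩

omit [J.Boundaryless] [IsManifold J ∞ M] in
theorem chartForm_add (θ θ' : OneForm J M) (x : M) :
    chartForm J (fun y => θ y + θ' y) x = chartForm J θ x + chartForm J θ' x := by
  ext y v; rfl

omit [J.Boundaryless] [IsManifold J ∞ M] in
theorem chartForm_smul (c : ℝ) (θ : OneForm J M) (x : M) :
    chartForm J (fun y => c • θ y) x = c • chartForm J θ x := by
  ext y v; rfl

theorem chartForm_self (θ : OneForm J M) (x : M) : chartForm J θ x (extChartAt J x x) = θ x := by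
  have h : ∀ z, z = x → (θ z : E →L[ℝ] ℝ) = θ x := by rintro z rfl; rfl
  rw [chartForm, mfderiv_extChartAt_symm_self]
  exact (ContinuousLinearMap.comp_id _).trans (h _ (extChartAt_to_inv x))

omit [J.Boundaryless] [IsManifold J ∞ M] in
theorem dForm_eq (θ : OneForm J M) (x : M) (v w : TangentSpace J x) :
    dForm J θ x v w = (fderiv ℝ (chartForm J θ x) (extChartAt J x x) (v : E) : E →L[ℝ] ℝ) (w : E) -
      (fderiv ℝ (chartForm J θ x) (extChartAt J x x) (w : E) : E →L[ℝ] ℝ) (v : E) := rfl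

omit [J.Boundaryless] [IsManifold J ∞ M] in
theorem dForm_add {θ θ' : OneForm J M} {x : M}
    (h : ContDiffAt ℝ ∞ (chartForm J θ x) (extChartAt J x x))
    (h' : ContDiffAt ℝ ∞ (chartForm J θ' x) (extChartAt J x x)) (v w : TangentSpace J x) :
    dForm J (fun y => θ y + θ' y) x v w = dForm J θ x v w + dForm J θ' x v w := by
  have key : ∀ a b : E, (fderiv ℝ (chartForm J (fun y => θ y + θ' y) x) (extChartAt J x x) a) b =
      fderiv ℝ (chartForm J θ x) (extChartAt J x x) a b +
      fderiv ℝ (chartForm J θ' x) (extChartAt J x x) a b := fun a b => by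
    rw [chartForm_add, fderiv_add (h.differentiableAt (by simp)) (h'.differentiableAt (by simp))]
    rfl
  refine (congrArg₂ (· - ·) (key v w) (key w v)).trans ?_
  rw [dForm_eq, dForm_eq]
  ring

omit [J.Boundaryless] [IsManifold J ∞ M] in
theorem dForm_smul (c : ℝ) {θ : OneForm J M} {x : M}
    (h : ContDiffAt ℝ ∞ (chartForm J θ x) (extChartAt J x x)) (v w : TangentSpace J x) :
    dForm J (fun y => c • θ y) x v w = c * dForm J θ x v w := by
  have key : ∀ a b : E, (fderiv ℝ (chartForm J (fun y => c • θ y) x) (extChartAt J x x) a) b =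
      c * fderiv ℝ (chartForm J θ x) (extChartAt J x x) a b := fun a b => by
    rw [chartForm_smul, fderiv_const_smul (h.differentiableAt (by simp))]
    rfl
  refine (congrArg₂ (· - ·) (key v w) (key w v)).trans ?_
  rw [dForm_eq]
  ring

omit [J.Boundaryless] [IsManifold J ∞ M] in
theorem dForm_congr {θ θ' : OneForm J M} {x : M} (h : ∀ᶠ y in 𝓝 x, θ y = θ' y)
    (v w : TangentSpace J x) : dForm J θ x v w = dForm J θ' x v w := by
  have : chartForm J θ x =ᶠ[𝓝 (extChartAt J x x)] chartForm J θ' x := by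
    filter_upwards [(tendsto_extChartAt_symm (J := J) x).eventually h] with y hy
    rw [chartForm, chartForm, hy]
  rw [dForm_eq, dForm_eq, this.fderiv_eq]

/-- The pullback of a 1-form. -/
def pullForm (J : ModelWithCorners ℝ E H) (J' : ModelWithCorners ℝ E' H') (f : M → M')
    (θ : OneForm J' M') : OneForm J M :=
  fun x => pullCov J J' f x (θ (f x))

omit [J.Boundaryless] [J'.Boundaryless] in
theorem eventually_mdifferentiableAt {f : M → M'} {x : M} (hf : ContMDiffAt J J' ∞ f x) :
    ∀ᶠ z in 𝓝 x, MDifferentiableAt J J' f z := by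
  have : IsManifold J 1 M := IsManifold.of_le (n := ∞) (by simp)
  have : IsManifold J' 1 M' := IsManifold.of_le (n := ∞) (by simp)
  have h1 : ContMDiffAt J J' 1 f x := hf.of_le (by simp)
  exact ((contMDiffAt_iff_contMDiffAt_nhds (by simp)).1 h1).mono fun z hz => hz.mdifferentiableAt one_ne_zero

omit [J'.Boundaryless] [IsManifold J ∞ M] [IsManifold J' ∞ M'] in
theorem contDiffAt_writtenInExtChartAt {f : M → M'} {x : M} (hf : ContMDiffAt J J' ∞ f x) :
    ContDiffAt ℝ ∞ (writtenInExtChartAt J J' x f) (extChartAt J x x) := by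
  have := (contMDiffAt_iff.1 hf).2
  rwa [J.range_eq_univ, contDiffWithinAt_univ] at this

omit [J'.Boundaryless] [IsManifold J ∞ M] [IsManifold J' ∞ M'] in
theorem mfderiv_eq_fderiv_writtenInExtChartAt {f : M → M'} {x : M}
    (hf : MDifferentiableAt J J' f x) :
    mfderiv J J' f x = fderiv ℝ (writtenInExtChartAt J J' x f) (extChartAt J x x) := by
  rw [hf.mfderiv, J.range_eq_univ, fderivWithin_univ]

/-- Chain rule applied to the two sides of `f ∘ c⁻¹ = c'⁻¹ ∘ φ`, where `φ` is `f` written in the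
charts `c` at `x` and `c'` at `f x`. -/
theorem chartForm_pullForm {f : M → M'} {x : M} (hf : ContMDiffAt J J' ∞ f x)
    (θ : OneForm J' M') : chartForm J (pullForm J J' f θ) x =ᶠ[𝓝 (extChartAt J x x)]
      fun y => (chartForm J' θ (f x) (writtenInExtChartAt J J' x f y)).comp
        (fderiv ℝ (writtenInExtChartAt J J' x f) y) := by
  have hθ : ∀ z z', z = z' → (θ z : E' →L[ℝ] ℝ) = θ z' := by rintro z z' rfl; rfl
  have hs := tendsto_extChartAt_symm (J := J) x
  have hsrc : ∀ᶠ z in 𝓝 x, f z ∈ (extChartAt J' (f x)).source :=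
    hf.continuousAt (extChartAt_source_mem_nhds (f x))
  have hw := contDiffAt_writtenInExtChartAt hf
  have hwd := ((hw.of_le (m := 1) (by simp)).eventually (by simp)).mono
    fun y hy => hy.differentiableAt one_ne_zero
  have hsd : ∀ᶠ y in 𝓝 (extChartAt J x x),
      MDifferentiableAt 𝓘(ℝ, E) J (extChartAt J x).symm y := by
    filter_upwards [eventually_mem_extChartAt_target (J := J) x] with y hy
    exact (contMDiffAt_extChartAt_symm_of_mem hy).mdifferentiableAt (by simp)
  filter_upwards [hs.eventually (eventually_mdifferentiableAt hf), hs.eventually hsrc,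
    (hs.eventually hsrc).eventually_nhds, hwd, hsd] with y h1 h2 h3 h4 h5
  have e1 : (extChartAt J' (f x)).symm (writtenInExtChartAt J J' x f y) =
      f ((extChartAt J x).symm y) := (extChartAt J' (f x)).left_inv h2
  have h6 : MDifferentiableAt 𝓘(ℝ, E') J' (extChartAt J' (f x)).symm
      (writtenInExtChartAt J J' x f y) :=
    (contMDiffAt_extChartAt_symm_of_mem ((extChartAt J' (f x)).map_source h2)).mdifferentiableAt
      (by simp)
  have e2 : mfderiv 𝓘(ℝ, E) J' (f ∘ (extChartAt J x).symm) y =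
      mfderiv 𝓘(ℝ, E) J' ((extChartAt J' (f x)).symm ∘ writtenInExtChartAt J J' x f) y := by
    refine Filter.EventuallyEq.mfderiv_eq ?_
    filter_upwards [h3] with z hz
    exact ((extChartAt J' (f x)).left_inv hz).symm
  rw [mfderiv_comp y h1 h5, mfderiv_comp y h6 h4.mdifferentiableAt, mfderiv_eq_fderiv] at e2
  ext v
  have e3 := DFunLike.congr_fun e2 v
  change θ (f ((extChartAt J x).symm y)) (((mfderiv J J' f ((extChartAt J x).symm y)).comp
    (mfderiv 𝓘(ℝ, E) J (extChartAt J x).symm y)) v) = _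
  refine (congrArg (θ (f ((extChartAt J x).symm y))) e3).trans ?_
  have e4 : (θ (f ((extChartAt J x).symm y)) : E' →L[ℝ] ℝ) =
      θ ((extChartAt J' (f x)).symm (writtenInExtChartAt J J' x f y)) := hθ _ _ e1.symm
  exact DFunLike.congr_fun e4 _

theorem contDiffAt_chartForm_pullForm {f : M → M'} {x : M} (hf : ContMDiffAt J J' ∞ f x)
    {θ : OneForm J' M'} (hθ : ContDiffAt ℝ ∞ (chartForm J' θ (f x)) (extChartAt J' (f x) (f x))) :
    ContDiffAt ℝ ∞ (chartForm J (pullForm J J' f θ) x) (extChartAt J x x) := by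
  refine ContDiffAt.congr_of_eventuallyEq ?_ (chartForm_pullForm hf θ)
  have hw := contDiffAt_writtenInExtChartAt hf
  refine ContDiffAt.clm_comp ?_ (hw.fderiv_right (by simp))
  refine ContDiffAt.comp (g := chartForm J' θ (f x)) (extChartAt J x x) ?_ hw
  rwa [writtenInExtChartAt, Function.comp_apply, Function.comp_apply, extChartAt_to_inv]

/-- The exterior derivative commutes with pullbacks. -/
theorem dForm_pullForm {f : M → M'} {x : M} (hf : ContMDiffAt J J' ∞ f x)
    {θ : OneForm J' M'} (hθ : ContDiffAt ℝ ∞ (chartForm J' θ (f x)) (extChartAt J' (f x) (f x)))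
    (v w : TangentSpace J x) :
    dForm J (pullForm J J' f θ) x v w =
      dForm J' θ (f x) (mfderiv J J' f x v) (mfderiv J J' f x w) := by
  have hw := contDiffAt_writtenInExtChartAt hf
  have hfx : writtenInExtChartAt J J' x f (extChartAt J x x) = extChartAt J' (f x) (f x) := by
    rw [writtenInExtChartAt, Function.comp_apply, Function.comp_apply, extChartAt_to_inv]
  rw [dForm_eq, dForm_eq, (chartForm_pullForm hf θ).fderiv_eq,
    mfderiv_eq_fderiv_writtenInExtChartAt (hf.mdifferentiableAt (by simp))]
  set φ := writtenInExtChartAt J J' x f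
  set a := extChartAt J x x
  rw [← hfx] at hθ ⊢
  set β := chartForm J' θ (f x)
  have h1 : HasFDerivAt (fun y => β (φ y)) ((fderiv ℝ β (φ a)).comp (fderiv ℝ φ a)) a :=
    (hθ.differentiableAt (by simp)).hasFDerivAt.comp a (hw.differentiableAt (by simp)).hasFDerivAt
  have h2 : HasFDerivAt (fderiv ℝ φ) (fderiv ℝ (fderiv ℝ φ) a) a :=
    ((hw.fderiv_right (m := 1) (by norm_cast)).differentiableAt (by simp)).hasFDerivAt
  -- The second derivative of `φ` enters symmetrically in the two vectors and drops out of the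
  -- antisymmetrized difference.
  have h3 : IsSymmSndFDerivAt ℝ φ a := hw.isSymmSndFDerivAt (by simp; norm_cast)
  have key : ∀ v w : E, (fderiv ℝ (fun y => (β (φ y)).comp (fderiv ℝ φ y)) a v : E →L[ℝ] ℝ) w -
      (fderiv ℝ (fun y => (β (φ y)).comp (fderiv ℝ φ y)) a w : E →L[ℝ] ℝ) v =
      fderiv ℝ β (φ a) (fderiv ℝ φ a v) (fderiv ℝ φ a w) -
      fderiv ℝ β (φ a) (fderiv ℝ φ a w) (fderiv ℝ φ a v) := by
    intro v w
    rw [(h1.clm_comp h2).fderiv]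
    have h4 := h3.eq v w
    simp only [add_apply, ContinuousLinearMap.comp_apply, ContinuousLinearMap.flip_apply,
      ContinuousLinearMap.compL_apply]
    rw [h4]
    ring
  exact key v w

end Forms

end Pfaff

/-! ### Duality in finite dimension and spans of independent forms -/

section LinearAlgebra

variable {E : Type*} [NormedAddCommGroup E] [NormedSpace ℝ E] [FiniteDimensional ℝ E]
  {F : Type*} [NormedAddCommGroup F] [NormedSpace ℝ F] [FiniteDimensional ℝ F]

theorem exists_apply_eq_of_linearMap (f : (E →L[ℝ] ℝ) →ₗ[ℝ] ℝ) : ∃ v : E, ∀ α, f α = α v := by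
  let g : Module.Dual ℝ (Module.Dual ℝ E) :=
    f.comp (LinearMap.toContinuousLinearMap (𝕜 := ℝ) (E := E) (F' := ℝ)).toLinearMap
  refine ⟨(Module.evalEquiv ℝ E).symm g, fun α => ?_⟩
  have h1 : g α.toLinearMap = α ((Module.evalEquiv ℝ E).symm g) :=
    (Module.apply_evalEquiv_symm_apply (R := ℝ) (M := E) α.toLinearMap g).symm
  rw [← h1]
  rfl

/-- A subspace of the dual contains each functional that vanishes on its annihilator. -/
theorem Submodule.mem_of_forall_apply_eq_zero {K : Submodule ℝ (E →L[ℝ] ℝ)} {α : E →L[ℝ] ℝ}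
    (h : ∀ v, (∀ β ∈ K, β v = 0) → α v = 0) : α ∈ K := by
  by_contra hα
  obtain ⟨f, hf, hK⟩ := K.exists_le_ker_of_notMem hα
  obtain ⟨v, hv⟩ := exists_apply_eq_of_linearMap f
  exact hf ((hv α).trans (h v fun β hβ => (hv β).symm.trans (hK hβ)))

/-- Since no nonzero vector of `N` is annihilated by `D`, the sum of `D` and the functionals
vanishing on `N` has zero annihilator and is the whole dual. The `D`-part of `α` then has the
required restriction. -/
theorem Submodule.exists_mem_eqOn {N : Submodule ℝ E} {D : Submodule ℝ (E →L[ℝ] ℝ)}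
    (h : ∀ v ∈ N, (∀ α ∈ D, α v = 0) → v = 0) (α : E →L[ℝ] ℝ) : ∃ κ ∈ D, ∀ v ∈ N, κ v = α v := by
  let P : Submodule ℝ (E →L[ℝ] ℝ) :=
    { carrier := {β | ∀ v ∈ N, β v = 0}
      add_mem' := fun ha hb v hv => by simp [ha v hv, hb v hv]
      zero_mem' := fun v _ => rfl
      smul_mem' := fun c a ha v hv => by simp [ha v hv] }
  have hmem : α ∈ D ⊔ P := by
    refine Submodule.mem_of_forall_apply_eq_zero fun v hv => ?_
    have hvN : v ∈ N := by
      by_contra hvN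
      obtain ⟨f, hf, hK⟩ := N.exists_le_ker_of_notMem hvN
      exact hf (hv f.toContinuousLinearMap (Submodule.mem_sup_right fun w hw => hK hw))
    rw [h v hvN fun β hβ => hv β (Submodule.mem_sup_left hβ), map_zero]
  obtain ⟨κ, hκ, β, hβ, rfl⟩ := Submodule.mem_sup.1 hmem
  exact ⟨κ, hκ, fun v hv => by simp [hβ v hv]⟩

/-- If `w` were outside the image of the annihilator of `K`, some functional `f` would kill that
image but not `w`. Then `f ∘ A` kills the annihilator of `K` and so belongs to `K`, against the
hypothesis. -/
theorem ContinuousLinearMap.exists_lift_of_forall (A : E →L[ℝ] F) {K : Submodule ℝ (E →L[ℝ] ℝ)}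
    {w : F} (h : ∀ β : F →L[ℝ] ℝ, β.comp A ∈ K → β w = 0) :
    ∃ v, (∀ α ∈ K, α v = 0) ∧ A v = w := by
  let S : Submodule ℝ E :=
    { carrier := {v | ∀ α ∈ K, α v = 0}
      add_mem' := fun ha hb α hα => by simp [ha α hα, hb α hα]
      zero_mem' := fun α _ => map_zero α
      smul_mem' := fun c a ha α hα => by simp [ha α hα] }
  by_contra hw
  have hw' : w ∉ S.map A.toLinearMap := by
    rintro ⟨v, hv, rfl⟩
    exact hw ⟨v, hv, rfl⟩
  obtain ⟨f, hf, hK⟩ := Submodule.exists_le_ker_of_notMem hw'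
  refine hf (h f.toContinuousLinearMap (Submodule.mem_of_forall_apply_eq_zero fun v hv => ?_))
  exact hK ⟨v, hv, rfl⟩

omit [FiniteDimensional ℝ E] in
theorem ContDiffAt.clm_pi {X : Type*} [NormedAddCommGroup X] [NormedSpace ℝ X] {r : ℕ}
    {θ : Fin r → X → E →L[ℝ] ℝ} {a : X} {n : WithTop ℕ∞} (hθ : ∀ i, ContDiffAt ℝ n (θ i) a) :
    ContDiffAt ℝ n (fun y => ContinuousLinearMap.pi fun i => θ i y) a := by
  have h : (fun y => ContinuousLinearMap.pi fun i => θ i y) =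
      fun y => ∑ i, (ContinuousLinearMap.single ℝ (fun _ : Fin r => ℝ) i).comp (θ i y) := by
    ext y v j
    simp [Finset.sum_apply, Pi.single_apply]
  rw [h]
  exact ContDiffAt.sum fun i _ => contDiffAt_const.clm_comp (hθ i)

omit [FiniteDimensional ℝ E] in
-- A functional on `ℝ^r` that vanishes on the range is a linear relation between the `θ i`.
theorem LinearIndependent.surjective_clm_pi {r : ℕ} {θ : Fin r → E →L[ℝ] ℝ}
    (h : LinearIndependent ℝ θ) : Function.Surjective (ContinuousLinearMap.pi θ) := by
  rw [← ContinuousLinearMap.coe_coe, ← LinearMap.range_eq_top]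
  by_contra hlt
  obtain ⟨f, hf, hle⟩ := Submodule.exists_le_ker_of_lt_top _ (lt_top_iff_ne_top.2 hlt)
  refine hf (LinearMap.pi_ext' fun i => LinearMap.ext_ring ?_)
  refine Fintype.linearIndependent_iff.1 h (fun i => f (Pi.single i 1)) ?_ i
  ext v
  have h1 : f (fun i => θ i v) = 0 := hle ⟨v, rfl⟩
  rw [LinearMap.pi_apply_eq_sum_univ] at h1
  simp only [sum_apply, smul_apply, zero_apply, smul_eq_mul]
  rw [← h1]
  refine Finset.sum_congr rfl fun i _ => ?_
  rw [smul_eq_mul, mul_comm]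
  congr 2
  ext j
  simp [Pi.single_apply, eq_comm]

omit [FiniteDimensional ℝ E] in
/-- If `η` is a linear combination of the independent forms `θ i` at each point and vanishes at `a`,
then so does the derivative of `η(w)` for `w` in the common kernel of the `θ i`. -/
theorem fderiv_apply_eq_zero_of_mem_span {r : ℕ} {θ : Fin r → E → E →L[ℝ] ℝ} {η : E → E →L[ℝ] ℝ}
    {a : E} (hθ : ∀ i, ContDiffAt ℝ 1 (θ i) a) (hη : DifferentiableAt ℝ η a)
    (hli : LinearIndependent ℝ fun i => θ i a)
    (hspan : ∀ᶠ y in 𝓝 a, η y ∈ Submodule.span ℝ (range fun i => θ i y)) (h0 : η a = 0)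
    (v : E) {w : E} (hw : ∀ i, θ i a w = 0) : fderiv ℝ η a v w = 0 := by
  let Θ : E → E →L[ℝ] (Fin r → ℝ) := fun y => ContinuousLinearMap.pi fun i => θ i y
  have hΘ : ContDiffAt ℝ 1 Θ a := ContDiffAt.clm_pi hθ
  obtain ⟨B₀, hB₀⟩ := LinearMap.exists_rightInverse_of_surjective (Θ a).toLinearMap
    (LinearMap.range_eq_top.2 hli.surjective_clm_pi)
  let B : (Fin r → ℝ) →L[ℝ] E := B₀.toContinuousLinearMap
  let G : E → (Fin r → ℝ) →L[ℝ] (Fin r → ℝ) := fun y => (Θ y).comp B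
  have hG : ContDiffAt ℝ 1 G a := hΘ.clm_comp contDiffAt_const
  have hGa : G a = ContinuousLinearEquiv.refl ℝ (Fin r → ℝ) := by
    refine ContinuousLinearMap.ext fun c => ?_
    exact LinearMap.congr_fun hB₀ c
  have hGe : ∀ᶠ y in 𝓝 a, ∃ e : (Fin r → ℝ) ≃L[ℝ] (Fin r → ℝ), e.toContinuousLinearMap = G y := by
    have h1 := ContinuousLinearEquiv.nhds (ContinuousLinearEquiv.refl ℝ (Fin r → ℝ))
    rw [← hGa] at h1
    exact hG.continuousAt h1
  -- A differentiable extension of `w` to a field in the common kernel of the `θ i`. Differentiating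
  -- `η(W) = 0` at a zero of `η` gives the claim without choosing smooth coefficients for `η` in
  -- terms of the `θ i`.
  let W : E → E := fun y => w - B ((G y).inverse (Θ y w))
  have hGi : ContDiffAt ℝ 1 (fun y => (G y).inverse) a := by
    have h1 : ContDiffAt ℝ 1 ContinuousLinearMap.inverse (G a) :=
      hGa ▸ contDiffAt_map_inverse (ContinuousLinearEquiv.refl ℝ (Fin r → ℝ))
    exact h1.comp a hG
  have hW : DifferentiableAt ℝ W a :=
    (contDiffAt_const.sub (contDiffAt_const.clm_apply (hGi.clm_apply
      (hΘ.clm_apply contDiffAt_const)))).differentiableAt (n := 1) (by simp)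
  have hWa : W a = w := by
    have : Θ a w = 0 := funext hw
    simp only [W, this, map_zero, sub_zero]
  have hηW : (fun y => η y (W y)) =ᶠ[𝓝 a] fun _ => 0 := by
    filter_upwards [hGe, hspan] with y ⟨e, he⟩ hy
    have h1 : Θ y (W y) = 0 := by
      have h2 : Θ y (B ((G y).inverse (Θ y w))) = G y ((G y).inverse (Θ y w)) := rfl
      rw [map_sub, h2, ← he, ContinuousLinearMap.inverse_equiv]
      simp
    refine Submodule.span_induction (p := fun β _ => β (W y) = 0) ?_ rfl ?_ ?_ hy
    · rintro _ ⟨i, rfl⟩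
      exact congrFun h1 i
    · intro β γ _ _ hβ hγ
      rw [add_apply, hβ, hγ, add_zero]
    · intro c β _ hβ
      rw [smul_apply, hβ, smul_zero]
  have h1 := (hη.hasFDerivAt.clm_apply hW.hasFDerivAt).unique
    ((hasFDerivAt_const (0 : ℝ) a).congr_of_eventuallyEq hηW)
  have h2 := DFunLike.congr_fun h1 v
  simpa [h0, hWa] using h2

end LinearAlgebra

namespace Pfaff

/-! ### Sections of a Pfaffian system -/

section Reduction

variable {E : Type*} [NormedAddCommGroup E] [NormedSpace ℝ E] [FiniteDimensional ℝ E]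
  {H : Type*} [TopologicalSpace H] {J : ModelWithCorners ℝ E H} [J.Boundaryless]
  {X : Type*} [TopologicalSpace X] [ChartedSpace H X] [IsManifold J ∞ X]
  {E' : Type*} [NormedAddCommGroup E'] [NormedSpace ℝ E'] [FiniteDimensional ℝ E']
  {H' : Type*} [TopologicalSpace H'] {J' : ModelWithCorners ℝ E' H'} [J'.Boundaryless]
  {M : Type*} [TopologicalSpace M] [ChartedSpace H' M] [IsManifold J' ∞ M]

omit [FiniteDimensional ℝ E] [J.Boundaryless] in
theorem derived_le (K : CovectorField J X) (x : X) : derived K x ≤ K x := by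
  refine Submodule.span_le.2 ?_
  rintro _ ⟨U, θ, -, hx, hθ, -, rfl⟩
  exact hθ.2 x hx

omit [FiniteDimensional ℝ E] in
theorem IsSectionOn.contDiffAt_chartForm {K : CovectorField J X} {θ : OneForm J X} {U : Set X}
    (h : IsSectionOn K θ U) (hU : IsOpen U) {x : X} (hx : x ∈ U) :
    ContDiffAt ℝ ∞ (chartForm J θ x) (extChartAt J x x) :=
  (smoothFormOn_iff hU).1 h.1 x hx

omit [FiniteDimensional ℝ E] in
theorem IsSectionOn.add {K : CovectorField J X} {θ θ' : OneForm J X} {U U' : Set X}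
    (h : IsSectionOn K θ U) (hU : IsOpen U) (h' : IsSectionOn K θ' U') (hU' : IsOpen U') :
    IsSectionOn K (fun y => θ y + θ' y) (U ∩ U') := by
  refine ⟨(smoothFormOn_iff (hU.inter hU')).2 fun x hx => ?_, fun y hy =>
    (K y).add_mem (h.2 y hy.1) (h'.2 y hy.2)⟩
  rw [chartForm_add]
  exact (h.contDiffAt_chartForm hU hx.1).add (h'.contDiffAt_chartForm hU' hx.2)

omit [FiniteDimensional ℝ E] in
theorem IsSectionOn.smul {K : CovectorField J X} {θ : OneForm J X} {U : Set X}
    (h : IsSectionOn K θ U) (hU : IsOpen U) (c : ℝ) : IsSectionOn K (fun y => c • θ y) U := by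
  refine ⟨(smoothFormOn_iff hU).2 fun x hx => ?_, fun y hy => (K y).smul_mem c (h.2 y hy)⟩
  rw [chartForm_smul]
  exact contDiffAt_const.smul (h.contDiffAt_chartForm hU hx)

omit [FiniteDimensional ℝ E] in
theorem isSectionOn_zero (K : CovectorField J X) {U : Set X} (hU : IsOpen U) :
    IsSectionOn K (fun _ => 0) U := by
  refine ⟨(smoothFormOn_iff hU).2 fun x hx => ?_, fun y _ => (K y).zero_mem⟩
  have : chartForm J (fun _ : X => 0) x = fun _ => 0 := by
    ext y v; rfl
  rw [this]
  exact contDiffAt_const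

omit [FiniteDimensional ℝ E] in
/-- `dθ` vanishes on `ann K` at the zeros of a section `θ` of `K`. -/
theorem IsPfaffian.dForm_eq_zero {K : CovectorField J X} (hK : IsPfaffian K) {θ : OneForm J X}
    {U : Set X} (hU : IsOpen U) (hθ : IsSectionOn K θ U) {x : X} (hx : x ∈ U) (h0 : θ x = 0)
    {v w : TangentSpace J x} (hv : v ∈ ann K x) (hw : w ∈ ann K x) : dForm J θ x v w = 0 := by
  obtain ⟨r, hr⟩ := hK
  obtain ⟨V, hV, hxV, β, hβ, hV'⟩ := hr x
  have hspan : ∀ᶠ y in 𝓝 (extChartAt J x x),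
      chartForm J θ x y ∈ Submodule.span ℝ (range fun i => chartForm J (β i) x y) := by
    filter_upwards [tendsto_extChartAt_symm (J := J) x ((hU.inter hV).mem_nhds ⟨hx, hxV⟩)] with y hy
    have h1 := hθ.2 _ hy.1
    rw [(hV' _ hy.2).2] at h1
    let T : (TangentSpace J ((extChartAt J x).symm y) →L[ℝ] ℝ) →ₗ[ℝ] (E →L[ℝ] ℝ) :=
      { toFun := fun α => α.comp (mfderiv 𝓘(ℝ, E) J (extChartAt J x).symm y)
        map_add' := fun α β => rfl
        map_smul' := fun c α => rfl }
    have h2 := Submodule.mem_map_of_mem (f := T) h1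
    rw [Submodule.map_span, ← range_comp] at h2
    exact h2
  have hβa : ∀ i, chartForm J (β i) x (extChartAt J x x) = β i x := fun i => chartForm_self _ _
  have hli : LinearIndependent ℝ fun i => chartForm J (β i) x (extChartAt J x x) := by
    have h1 := (hV' x hxV).1
    simp only [hβa]
    exact h1
  have key : ∀ {a b : E}, (∀ i, (β i x : E →L[ℝ] ℝ) b = 0) →
      fderiv ℝ (chartForm J θ x) (extChartAt J x x) a b = 0 := by
    intro a b hb
    refine fderiv_apply_eq_zero_of_mem_span
      (fun i => (((smoothFormOn_iff hV).1 (hβ i)) x hxV).of_le (by norm_cast))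
      ((hθ.contDiffAt_chartForm hU hx).differentiableAt (by simp)) hli hspan
      ((chartForm_self θ x).trans h0) a fun i => ?_
    rw [hβa i]
    exact hb i
  have hmem : ∀ i, β i x ∈ K x := fun i => by
    rw [(hV' x hxV).2]; exact Submodule.subset_span ⟨i, rfl⟩
  refine (congrArg₂ (· - ·) (key fun i => hw _ (hmem i)) (key fun i => hv _ (hmem i))).trans ?_
  simp

end Reduction

end Pfaff

theorem ContinuousLinearMap.exists_comp_eq_of_forall {E F : Type*} [NormedAddCommGroup E]
    [NormedSpace ℝ E] [NormedAddCommGroup F] [NormedSpace ℝ F] [FiniteDimensional ℝ F]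
    (A : E →L[ℝ] F) (hA : Function.Surjective A) (γ : E →L[ℝ] ℝ) (hγ : ∀ u, A u = 0 → γ u = 0) :
    ∃ β : F →L[ℝ] ℝ, β.comp A = γ := by
  obtain ⟨R, hR⟩ := LinearMap.exists_rightInverse_of_surjective A.toLinearMap
    (LinearMap.range_eq_top.2 hA)
  refine ⟨γ.comp R.toContinuousLinearMap, ?_⟩
  ext u
  have h := hγ (R (A u) - u) (by rw [map_sub, sub_eq_zero]; exact LinearMap.congr_fun hR _)
  rw [map_sub, sub_eq_zero] at h
  exact h

namespace Pfaff

/-! ### Transversal reductions and their polar spaces -/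

section Reduction

variable {E : Type*} [NormedAddCommGroup E] [NormedSpace ℝ E]
  {H : Type*} [TopologicalSpace H] {J : ModelWithCorners ℝ E H}
  {X : Type*} [TopologicalSpace X] [ChartedSpace H X] [IsManifold J ∞ X]
  {E' : Type*} [NormedAddCommGroup E'] [NormedSpace ℝ E']
  {H' : Type*} [TopologicalSpace H'] {J' : ModelWithCorners ℝ E' H'}
  {M : Type*} [TopologicalSpace M] [ChartedSpace H' M] [IsManifold J' ∞ M]

/-- `I` is the reduction of the Pfaffian system `K` by a submersion `q` which is transversal to the
derived system `K'`, and `I` is spanned by its local sections. -/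
structure IsTransversalReduction (K : CovectorField J X) (I : CovectorField J' M) (q : X → M) :
    Prop where
  pfaffian : IsPfaffian K
  smooth : ContMDiff J J' ∞ q
  submersion : ∀ x, Function.Surjective (mfderiv J J' q x)
  transversal : IsTransversal J' q (derived K)
  reduction : IsReduction J' q K I
  exists_section : ∀ x, ∀ α ∈ I x, ∃ (U : Set M) (φ : OneForm J' M), IsOpen U ∧ x ∈ U ∧
    IsSectionOn I φ U ∧ φ x = α

variable {K : CovectorField J X} {I : CovectorField J' M} {q : X → M}

/-- As `K' ⊂ K`, a vector of `ann K` lies in `ann K'`, which meets `ker q_*` trivially. Together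
with `exists_lift` this makes `q_*` an isomorphism from `ann K` onto `ann I`. -/
theorem IsTransversalReduction.eq_zero (h : IsTransversalReduction K I q) {x : X}
    {v : TangentSpace J x} (hv : v ∈ ann K x) (hqv : mfderiv J J' q x v = 0) : v = 0 := by
  have h1 : v ∈ LinearMap.ker (mfderiv J J' q x).toLinearMap ⊓ ann (derived K) x :=
    ⟨hqv, fun α hα => hv α (derived_le K x hα)⟩
  rw [h.transversal x] at h1
  exact h1

theorem IsTransversalReduction.mfderiv_mem_ann (h : IsTransversalReduction K I q) {x : X}
    {v : TangentSpace J x} (hv : v ∈ ann K x) : mfderiv J J' q x v ∈ ann I (q x) :=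
  fun α hα => hv _ ((h.reduction x α).1 hα)

/-- A covector whose pullback lies in `K` belongs to `I`, hence vanishes on `w`; this is the dual
criterion for `w` to be in the image of `ann K`. -/
theorem IsTransversalReduction.exists_lift [FiniteDimensional ℝ E] [FiniteDimensional ℝ E']
    (h : IsTransversalReduction K I q) {x : X}
    {w : TangentSpace J' (q x)} (hw : w ∈ ann I (q x)) :
    ∃ v ∈ ann K x, mfderiv J J' q x v = w := by
  have key := ContinuousLinearMap.exists_lift_of_forall (E := E) (F := E')
    (mfderiv J J' q x) (K := K x) (w := w) fun β hβ => hw β ((h.reduction x β).2 hβ)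
  exact key

theorem IsTransversalReduction.isSectionOn_pullForm [J.Boundaryless] [J'.Boundaryless]
    (h : IsTransversalReduction K I q) {U : Set M} (hU : IsOpen U) {φ : OneForm J' M}
    (hφ : IsSectionOn I φ U) : IsSectionOn K (pullForm J J' q φ) (q ⁻¹' U) := by
  refine ⟨(smoothFormOn_iff (hU.preimage h.smooth.continuous)).2 fun x hx => ?_, fun y hy =>
    (h.reduction y _).1 (hφ.2 _ hy)⟩
  exact contDiffAt_chartForm_pullForm (h.smooth x) (hφ.contDiffAt_chartForm hU hx)

variable [J.Boundaryless] [J'.Boundaryless] [FiniteDimensional ℝ E] [FiniteDimensional ℝ E']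

/-- On `ann K`, the exterior derivatives of the sections of `K` are determined by those of the
sections of the reduction `I`. -/
theorem IsTransversalReduction.dForm_eq_zero (h : IsTransversalReduction K I q) {x : X}
    {v w : TangentSpace J x} (hv : v ∈ ann K x) (hw : w ∈ ann K x)
    (hI : ∀ (U : Set M) (φ : OneForm J' M), IsOpen U → q x ∈ U → IsSectionOn I φ U →
      dForm J' φ (q x) (mfderiv J J' q x v) (mfderiv J J' q x w) = 0)
    {U : Set X} {θ : OneForm J X} (hU : IsOpen U) (hx : x ∈ U) (hθ : IsSectionOn K θ U) :
    dForm J θ x v w = 0 := by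
  -- The covectors at `x` that extend to some section of `K` with derivative vanishing on `(v, w)`.
  -- They are closed under linear combinations and contain `K'` and the pullbacks of `I`; these
  -- together span `K`.
  let P : (TangentSpace J x →L[ℝ] ℝ) → Prop := fun α => ∃ (V : Set X) (β : OneForm J X),
    IsOpen V ∧ x ∈ V ∧ IsSectionOn K β V ∧ β x = α ∧ dForm J β x v w = 0
  have hadd : ∀ {α α'}, P α → P α' → P (α + α') := by
    rintro _ _ ⟨V, β, hV, hxV, hβ, rfl, hd⟩ ⟨V', β', hV', hxV', hβ', rfl, hd'⟩
    refine ⟨V ∩ V', _, hV.inter hV', ⟨hxV, hxV'⟩, hβ.add hV hβ' hV', rfl, ?_⟩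
    rw [dForm_add (hβ.contDiffAt_chartForm hV hxV) (hβ'.contDiffAt_chartForm hV' hxV'), hd, hd',
      add_zero]
  have hsmul : ∀ (c : ℝ) {α}, P α → P (c • α) := by
    rintro c _ ⟨V, β, hV, hxV, hβ, rfl, hd⟩
    refine ⟨V, _, hV, hxV, hβ.smul hV c, rfl, ?_⟩
    rw [dForm_smul c (hβ.contDiffAt_chartForm hV hxV), hd, mul_zero]
  have hder : ∀ α ∈ derived K x, P α := by
    intro α hα
    refine Submodule.span_induction (p := fun α _ => P α) ?_ ?_ (fun _ _ _ _ => hadd)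
      (fun c _ _ => hsmul c) hα
    · rintro _ ⟨V, β, hV, hxV, hβ, hd, rfl⟩
      exact ⟨V, β, hV, hxV, hβ, rfl, hd x hxV v hv w hw⟩
    · have h0 : (0 : TangentSpace J x →L[ℝ] ℝ) = (0 : ℝ) • θ x := (zero_smul _ _).symm
      refine ⟨U, _, hU, hx, hθ.smul hU 0, h0.symm, ?_⟩
      rw [dForm_smul 0 (hθ.contDiffAt_chartForm hU hx), zero_mul]
  have hpull : ∀ α ∈ I (q x), P (pullCov J J' q x α) := by
    intro α hα
    obtain ⟨V, φ, hV, hxV, hφ, rfl⟩ := h.exists_section _ α hα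
    refine ⟨q ⁻¹' V, _, hV.preimage h.smooth.continuous, hxV, h.isSectionOn_pullForm hV hφ, rfl, ?_⟩
    rw [dForm_pullForm (h.smooth x) (hφ.contDiffAt_chartForm hV hxV)]
    exact hI V φ hV hxV hφ
  have hall : P (θ x) := by
    -- Transversality says that `K'` restricts onto the dual of `ker q_*`. Choose `κ` in `K'` with
    -- the restriction of `θ x`; the difference vanishes on `ker q_*` and is thus a pullback by `q`,
    -- of an element of `I` because it lies in `K`.
    obtain ⟨κ, hκ, hκ'⟩ : ∃ κ ∈ derived K x, ∀ v : TangentSpace J x,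
        mfderiv J J' q x v = 0 → κ v = θ x v := Submodule.exists_mem_eqOn (E := E)
      (N := LinearMap.ker (mfderiv J J' q x).toLinearMap) (D := derived K x)
      (fun v hv hv' => by
        have h1 : v ∈ LinearMap.ker (mfderiv J J' q x).toLinearMap ⊓ ann (derived K) x := ⟨hv, hv'⟩
        rw [h.transversal x] at h1
        exact h1) (θ x)
    obtain ⟨β, hβ⟩ : ∃ β : TangentSpace J' (q x) →L[ℝ] ℝ,
        pullCov J J' q x β = (θ x : TangentSpace J x →L[ℝ] ℝ) - κ := by
      have h1 := ContinuousLinearMap.exists_comp_eq_of_forall (E := E) (F := E')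
        (mfderiv J J' q x) (h.submersion x) ((θ x : TangentSpace J x →L[ℝ] ℝ) - κ)
        fun u hu => sub_eq_zero.2 (hκ' u hu).symm
      exact h1
    have hβI : β ∈ I (q x) := by
      refine (h.reduction x β).2 ?_
      rw [hβ]
      exact (K x).sub_mem (hθ.2 x hx) (derived_le K x hκ)
    have h1 := hadd (hpull β hβI) (hder κ hκ)
    rwa [hβ, sub_add_cancel] at h1
  -- The sections `θ` and `β` agree at `x`, so `θ - β` vanishes there and its derivative is zero on
  -- `ann K`. Hence `dθ(v, w) = dβ(v, w) = 0`.
  obtain ⟨V, β, hV, hxV, hβ, hβx, hd⟩ := hall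
  have hneg0 : ∀ α : E →L[ℝ] ℝ, α + (-1 : ℝ) • α = 0 := fun α => by ext; simp
  have hneg := hβ.smul hV (-1)
  have h1 := hθ.add hU hneg hV
  have h2 := h.pfaffian.dForm_eq_zero (hU.inter hV) h1 ⟨hx, hxV⟩
    (by rw [hβx]; exact hneg0 _) hv hw
  rw [dForm_add (hθ.contDiffAt_chartForm hU hx) (hneg.contDiffAt_chartForm hV hxV),
    dForm_smul _ (hβ.contDiffAt_chartForm hV hxV), hd] at h2
  simpa using h2

/-- The differential of `q` identifies the polar spaces of `K` with those of its reduction. -/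
theorem IsTransversalReduction.map_polarSpace (h : IsTransversalReduction K I q) {x : X}
    {F : Submodule ℝ (TangentSpace J x)} (hF : F ≤ ann K x) :
    (polarSpace K x F).map (mfderiv J J' q x).toLinearMap =
      polarSpace I (q x) (F.map (mfderiv J J' q x).toLinearMap) := by
  ext w
  constructor
  · rintro ⟨v, hv, rfl⟩
    refine ⟨h.mfderiv_mem_ann hv.1, ?_⟩
    rintro U φ hU hx hφ _ ⟨e, he, rfl⟩
    have h1 := hv.2 _ _ (hU.preimage h.smooth.continuous) hx (h.isSectionOn_pullForm hU hφ) e he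
    rwa [dForm_pullForm (h.smooth x) (hφ.contDiffAt_chartForm hU hx)] at h1
  · intro hw
    obtain ⟨v, hv, rfl⟩ := h.exists_lift hw.1
    refine ⟨v, ⟨hv, fun U θ hU hx hθ e he => ?_⟩, rfl⟩
    exact h.dForm_eq_zero hv (hF he) (fun V φ hV hxV hφ => hw.2 V φ hV hxV hφ _ ⟨e, he, rfl⟩) hU hx hθ

omit [J.Boundaryless] [J'.Boundaryless] [FiniteDimensional ℝ E] [FiniteDimensional ℝ E'] in
theorem IsTransversalReduction.finrank_map (h : IsTransversalReduction K I q) {x : X}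
    {F : Submodule ℝ (TangentSpace J x)} (hF : F ≤ ann K x) :
    Module.finrank ℝ (F.map (mfderiv J J' q x).toLinearMap) = Module.finrank ℝ F := by
  have h1 : F.map (mfderiv J J' q x).toLinearMap =
      LinearMap.range ((mfderiv J J' q x).toLinearMap.domRestrict F) := by
    rw [LinearMap.range_domRestrict]
  rw [h1]
  refine LinearMap.finrank_range_of_inj ?_
  rw [← LinearMap.ker_eq_bot, LinearMap.ker_eq_bot']
  rintro ⟨v, hv⟩ hv0
  exact Subtype.ext (h.eq_zero (hF hv) hv0)

theorem IsTransversalReduction.finrank_polarSpace (h : IsTransversalReduction K I q) {x : X}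
    {F : Submodule ℝ (TangentSpace J x)} (hF : F ≤ ann K x) :
    Module.finrank ℝ (polarSpace K x F) =
      Module.finrank ℝ (polarSpace I (q x) (F.map (mfderiv J J' q x).toLinearMap)) := by
  rw [← h.map_polarSpace hF]
  exact (h.finrank_map fun v (hv : v ∈ polarSpace K x F) => hv.1).symm

end Reduction

end Pfaff

namespace Pfaff

/-! ### Uniqueness of horizontal maps and submersions in coordinates -/

section Horizontal

variable {E : Type*} [NormedAddCommGroup E] [NormedSpace ℝ E] [FiniteDimensional ℝ E]
  {H : Type*} [TopologicalSpace H] {J : ModelWithCorners ℝ E H} [J.Boundaryless]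
  {X : Type*} [TopologicalSpace X] [ChartedSpace H X] [IsManifold J ∞ X]
  {E' : Type*} [NormedAddCommGroup E'] [NormedSpace ℝ E'] [FiniteDimensional ℝ E']
  {H' : Type*} [TopologicalSpace H'] {J' : ModelWithCorners ℝ E' H'} [J'.Boundaryless]
  {M : Type*} [TopologicalSpace M] [ChartedSpace H' M] [IsManifold J' ∞ M]
  {E'' : Type*} [NormedAddCommGroup E''] [NormedSpace ℝ E''] [FiniteDimensional ℝ E'']
  {H'' : Type*} [TopologicalSpace H''] {J'' : ModelWithCorners ℝ E'' H''} [J''.Boundaryless]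
  {S : Type*} [TopologicalSpace S] [ChartedSpace H'' S] [IsManifold J'' ∞ S]

variable {K : CovectorField J X} {I : CovectorField J' M} {q : X → M}

omit [FiniteDimensional ℝ E] [FiniteDimensional ℝ E'] [FiniteDimensional ℝ E''] [IsManifold J'' ∞ S]
  [J'.Boundaryless] [J''.Boundaryless] in
theorem eventually_contDiffAt_writtenInExtChartAt (hq : ContMDiff J J' ∞ q) (x : X) :
    ∀ᶠ z in 𝓝 (extChartAt J x x), ContDiffAt ℝ ∞ (writtenInExtChartAt J J' x q) z := by
  have hsrc : ∀ᶠ z in 𝓝 x, q z ∈ (chartAt H' (q x)).source :=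
    (hq x).continuousAt (chart_source_mem_nhds H' (q x))
  filter_upwards [eventually_mem_extChartAt_target (J := J) x,
    (tendsto_extChartAt_symm (J := J) x).eventually hsrc] with z hz hz'
  rw [← contMDiffAt_iff_contDiffAt]
  exact (contMDiffAt_extChartAt' hz').comp z
    ((hq _).comp z (contMDiffAt_extChartAt_symm_of_mem hz))

omit [FiniteDimensional ℝ E'] [J'.Boundaryless] [FiniteDimensional ℝ E''] in
/-- Horizontal maps with the same projection agree near a point if they agree at the point. -/
theorem IsTransversalReduction.eventuallyEq (h : IsTransversalReduction K I q) {f g : S → X} {y : S}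
    (hf : ContMDiffAt J'' J ∞ f y) (hg : ContMDiffAt J'' J ∞ g y) (hfg : f y = g y)
    (hq : ∀ᶠ z in 𝓝 y, q (f z) = q (g z))
    (hfK : ∀ᶠ z in 𝓝 y, ∀ v, mfderiv J'' J f z v ∈ ann K (f z))
    (hgK : ∀ᶠ z in 𝓝 y, ∀ v, mfderiv J'' J g z v ∈ ann K (g z)) : f =ᶠ[𝓝 y] g := by
  obtain ⟨r, hr⟩ := h.pfaffian
  obtain ⟨V, hV, hxV, θ, hθ, hVK⟩ := hr (f y)
  let c := extChartAt J (f y)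
  let cN := extChartAt J'' y
  let f' : E'' → E := fun p => c (f (cN.symm p))
  let g' : E'' → E := fun p => c (g (cN.symm p))
  let q' : E → E' := writtenInExtChartAt J J' (f y) q
  -- The differential of `q` together with a frame of `K`, in the chart at the common value of `f`
  -- and `g`. It is injective because `q_*` is injective on `ann K`. Along both maps the first
  -- component of `Φ ∘ D` is the derivative of the same projection, and the second is zero.
  let Φ : E → E →L[ℝ] E' × (Fin r → ℝ) := fun z =>
    (fderiv ℝ q' z).prod (ContinuousLinearMap.pi fun i => chartForm J (θ i) (f y) z)
  have hs := tendsto_extChartAt_symm (J := J'') y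
  have hq' : ContDiffAt ℝ ∞ q' (c (f y)) := contDiffAt_writtenInExtChartAt (h.smooth _)
  have hf'y : f' (cN y) = c (f y) := by simp only [f', cN, extChartAt_to_inv]
  have hg'y : g' (cN y) = c (f y) := by simp only [g', cN, extChartAt_to_inv, hfg]
  have hf'w : f' = writtenInExtChartAt J'' J y f := rfl
  have hg'w : g' = writtenInExtChartAt J'' J y g := by
    ext p; simp only [g', c, hfg]; rfl
  have hf's : ContDiffAt ℝ ∞ f' (cN y) := contDiffAt_writtenInExtChartAt hf
  have hg's : ContDiffAt ℝ ∞ g' (cN y) := hg'w ▸ contDiffAt_writtenInExtChartAt hg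
  have hΦ : ContDiffAt ℝ ∞ Φ (c (f y)) := by
    have h1 : ContDiffAt ℝ ∞ (fun z => ContinuousLinearMap.pi fun i => chartForm J (θ i) (f y) z)
      (c (f y)) := ContDiffAt.clm_pi fun i => (smoothFormOn_iff hV).1 (hθ i) _ hxV
    have h2 : ContDiffAt ℝ ∞ (fderiv ℝ q') (c (f y)) := hq'.fderiv_right (by simp)
    have h3 : Φ = fun z => (ContinuousLinearMap.inl ℝ E' (Fin r → ℝ)).comp (fderiv ℝ q' z) +
        (ContinuousLinearMap.inr ℝ E' (Fin r → ℝ)).comp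
          (ContinuousLinearMap.pi fun i => chartForm J (θ i) (f y) z) := by
      ext z v <;> simp [Φ]
    rw [h3]
    exact (contDiffAt_const.clm_comp h2).add (contDiffAt_const.clm_comp h1)
  have hinj : Function.Injective (Φ (c (f y))) := by
    rw [← ContinuousLinearMap.coe_coe, ← LinearMap.ker_eq_bot, LinearMap.ker_eq_bot']
    intro v hv
    have hv1 : fderiv ℝ q' (c (f y)) v = 0 := congrArg Prod.fst hv
    have hv2 : ∀ i, chartForm J (θ i) (f y) (c (f y)) v = 0 := fun i =>
      congrFun (congrArg Prod.snd hv) i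
    have hvK : (v : TangentSpace J (f y)) ∈ ann K (f y) := by
      intro α hα
      rw [(hVK _ hxV).2] at hα
      refine Submodule.span_induction (p := fun (α : TangentSpace J (f y) →L[ℝ] ℝ) _ => α v = 0)
        ?_ rfl ?_ ?_ hα
      · rintro _ ⟨i, rfl⟩
        have h1 := hv2 i
        rwa [chartForm_self] at h1
      · intro β γ _ _ hβ hγ
        exact (congrArg₂ (· + ·) hβ hγ).trans (add_zero _)
      · intro t β _ hβ
        exact (congrArg (t * ·) hβ).trans (mul_zero _)
    refine h.eq_zero hvK ?_
    rw [mfderiv_eq_fderiv_writtenInExtChartAt ((h.smooth _).mdifferentiableAt (by simp))]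
    exact hv1
  -- the forms `θ i` vanish along horizontal maps
  have hform : ∀ {k : S → X}, ContMDiffAt J'' J ∞ k y → k y = f y →
      (∀ᶠ z in 𝓝 y, ∀ v, mfderiv J'' J k z v ∈ ann K (k z)) →
      ∀ᶠ p in 𝓝 (cN y), ∀ i v, chartForm J (θ i) (f y) (c (k (cN.symm p)))
        (fderiv ℝ (fun p => c (k (cN.symm p))) p v) = 0 := by
    intro k hk hky hkK
    have h1 : ∀ᶠ p in 𝓝 (cN y), ∀ i, chartForm J'' (pullForm J'' J k (θ i)) y p =
        (chartForm J (θ i) (k y) (writtenInExtChartAt J'' J y k p)).comp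
          (fderiv ℝ (writtenInExtChartAt J'' J y k) p) :=
      Filter.eventually_all.2 fun i => chartForm_pullForm hk (θ i)
    have h2 : ∀ᶠ z in 𝓝 y, k z ∈ V := hk.continuousAt (hky ▸ hV.mem_nhds hxV)
    have hw : writtenInExtChartAt J'' J y k = fun p => c (k (cN.symm p)) := by
      ext p; simp only [c, ← hky]; rfl
    filter_upwards [h1, hs.eventually h2, hs.eventually hkK] with p h1 h2 h3 i v
    have h4 := DFunLike.congr_fun (h1 i) v
    rw [hw, hky] at h4
    refine h4.symm.trans ?_
    refine h3 _ (θ i (k (cN.symm p))) ?_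
    rw [(hVK _ h2).2]
    exact Submodule.subset_span ⟨i, rfl⟩
  have hqeq : ∀ᶠ p in 𝓝 (cN y), ∀ v, fderiv ℝ q' (f' p) (fderiv ℝ f' p v) =
      fderiv ℝ q' (g' p) (fderiv ℝ g' p v) := by
    have hfd := ((hf's.of_le (m := 1) (by simp)).eventually (by simp)).mono
      fun p hp => hp.differentiableAt one_ne_zero
    have hgd := ((hg's.of_le (m := 1) (by simp)).eventually (by simp)).mono
      fun p hp => hp.differentiableAt one_ne_zero
    have hqd := ((hq'.of_le (m := 1) (by simp)).eventually (by simp)).mono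
      fun p hp => hp.differentiableAt one_ne_zero
    have hqf : ∀ᶠ p in 𝓝 (cN y), DifferentiableAt ℝ q' (f' p) :=
      hf's.continuousAt.eventually (hf'y ▸ hqd)
    have hqg : ∀ᶠ p in 𝓝 (cN y), DifferentiableAt ℝ q' (g' p) :=
      hg's.continuousAt.eventually (hg'y ▸ hqd)
    have hfs : ∀ᶠ z in 𝓝 y, f z ∈ c.source := hf.continuousAt (extChartAt_source_mem_nhds _)
    have hgs : ∀ᶠ z in 𝓝 y, g z ∈ c.source :=
      hg.continuousAt (hfg ▸ extChartAt_source_mem_nhds _)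
    have hcomp : ∀ᶠ p in 𝓝 (cN y), q' (f' p) = q' (g' p) := by
      filter_upwards [hs.eventually hq, hs.eventually hfs, hs.eventually hgs] with p h1 h2 h3
      change extChartAt J' (q (f y)) (q (c.symm (c (f (cN.symm p))))) =
        extChartAt J' (q (f y)) (q (c.symm (c (g (cN.symm p)))))
      rw [c.left_inv h2, c.left_inv h3, h1]
    filter_upwards [hfd, hgd, hqf, hqg, hcomp.eventually_nhds] with p h1 h2 h3 h4 h5 v
    have h6 : fderiv ℝ (q' ∘ f') p = fderiv ℝ (q' ∘ g') p := Filter.EventuallyEq.fderiv_eq h5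
    rw [fderiv_comp p h3 h1, fderiv_comp p h4 h2] at h6
    exact DFunLike.congr_fun h6 v
  have key : f' =ᶠ[𝓝 (cN y)] g' := by
    refine eventuallyEq_of_injective_comp_fderiv (Φ := Φ) (hf'y ▸ hΦ.of_le (by simp))
      (hf'y ▸ hinj) (hf'y.trans hg'y.symm) (hf's.of_le (by simp)) (hg's.of_le (by simp)) ?_
    filter_upwards [hqeq, hform hf rfl hfK, hform hg hfg.symm hgK] with p h1 h2 h3 v
    refine Prod.ext (h1 v) (funext fun i => ?_)
    exact (h2 i v).trans (h3 i v).symm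
  have hcN : ContinuousAt cN y := continuousAt_extChartAt y
  have hfs : ∀ᶠ z in 𝓝 y, f z ∈ c.source := hf.continuousAt (extChartAt_source_mem_nhds _)
  have hgs : ∀ᶠ z in 𝓝 y, g z ∈ c.source :=
    hg.continuousAt (hfg ▸ extChartAt_source_mem_nhds _)
  filter_upwards [hcN.eventually key, hfs, hgs, eventually_extChartAt_left_inv (J := J'') y] with z h1 h2 h3 h4
  simp only [f', g'] at h1
  rw [h4] at h1
  exact c.injOn h2 h3 h1

omit [FiniteDimensional ℝ E'] [J'.Boundaryless] in
/-- A submersion is a projection in suitable coordinates. -/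
theorem exists_local_parametrization (hq : ContMDiff J J' ∞ q) {z₀ : X}
    (hsub : Function.Surjective (mfderiv J J' q z₀)) :
    ∃ (W : Submodule ℝ E) (Ψ : E' × W → X) (ρ : X → W),
      Module.finrank ℝ E' + Module.finrank ℝ W = Module.finrank ℝ E ∧
      Ψ (extChartAt J' (q z₀) (q z₀), ρ z₀) = z₀ ∧
      ∀ᶠ p in 𝓝 (extChartAt J' (q z₀) (q z₀), ρ z₀),
        ContMDiffAt 𝓘(ℝ, E' × W) J ∞ Ψ p ∧ ContMDiffAt J 𝓘(ℝ, W) ∞ ρ (Ψ p) ∧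
        q (Ψ p) = (extChartAt J' (q z₀)).symm p.1 ∧ ρ (Ψ p) = p.2 := by
  let c := extChartAt J z₀
  let a : E := c z₀
  let q' : E → E' := writtenInExtChartAt J J' z₀ q
  have hq's : ∀ᶠ z in 𝓝 a, ContDiffAt ℝ ∞ q' z := eventually_contDiffAt_writtenInExtChartAt hq z₀
  let A : E →L[ℝ] E' := fderiv ℝ q' a
  have hA : Function.Surjective A := by
    have h1 := mfderiv_eq_fderiv_writtenInExtChartAt ((hq z₀).mdifferentiableAt (by simp))
    rw [h1] at hsub
    exact hsub
  let W : Submodule ℝ E := LinearMap.ker A.toLinearMap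
  -- A projection `B` onto `W = ker A` completes `q'` to a local diffeomorphism. In the chart, `B`
  -- is the fibre coordinate that is returned as `ρ`.
  obtain ⟨B₀, hB₀⟩ := LinearMap.exists_leftInverse_of_injective W.subtype W.ker_subtype
  let B : E →L[ℝ] W := B₀.toContinuousLinearMap
  have hB : ∀ w : W, B w = w := fun w => LinearMap.congr_fun hB₀ w
  have hbij : Function.Bijective (A.prod B).toLinearMap := by
    constructor
    · rw [← LinearMap.ker_eq_bot, LinearMap.ker_eq_bot']
      intro v hv
      have hv1 : A v = 0 := congrArg Prod.fst hv
      have hv2 : B v = 0 := congrArg Prod.snd hv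
      have h1 := hB ⟨v, hv1⟩
      rw [hv2] at h1
      exact (congrArg Subtype.val h1).symm
    · rintro ⟨b, w⟩
      obtain ⟨v, rfl⟩ := hA b
      refine ⟨v + ((w - B v : W) : E), Prod.ext ?_ ?_⟩
      · have h1 : A ((w - B v : W) : E) = 0 := (w - B v).2
        change A (v + _) = _
        rw [map_add, h1, add_zero]
      · change B (v + _) = _
        rw [map_add, hB, add_sub_cancel]
  let e : E ≃L[ℝ] E' × W := (LinearEquiv.ofBijective _ hbij).toContinuousLinearEquiv
  have hψ : ∀ᶠ z in 𝓝 a, ContDiffAt ℝ ∞ (fun z => (q' z, B z)) z :=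
    hq's.mono fun z hz => hz.prodMk B.contDiff.contDiffAt
  have he : fderiv ℝ (fun z => (q' z, B z)) a = e := by
    rw [((hq's.self_of_nhds.differentiableAt (by simp)).hasFDerivAt.prodMk
      B.hasFDerivAt).fderiv]
    rfl
  obtain ⟨φ, hφ, haφ, hφs⟩ := exists_openPartialHomeomorph_contDiffAt hψ e he
  have hφa : φ a = (extChartAt J' (q z₀) (q z₀), B a) := by
    rw [hφ]
    refine Prod.ext ?_ rfl
    change extChartAt J' (q z₀) (q (c.symm (c z₀))) = _
    rw [extChartAt_to_inv]
  refine ⟨W, fun p => c.symm (φ.symm p), fun z => B (c z), ?_, ?_, ?_⟩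
  · have h1 := LinearMap.finrank_range_add_finrank_ker A.toLinearMap
    rwa [LinearMap.range_eq_top.2 hA, finrank_top] at h1
  · rw [← hφa]
    change c.symm (φ.symm (φ a)) = z₀
    rw [φ.left_inv haφ]
    exact extChartAt_to_inv z₀
  · rw [← hφa]
    have hc : Filter.Tendsto φ.symm (𝓝 (φ a)) (𝓝 a) := φ.tendsto_symm haφ
    have hsrc : ∀ᶠ z in 𝓝 z₀, q z ∈ (extChartAt J' (q z₀)).source :=
      (hq z₀).continuousAt (extChartAt_source_mem_nhds (q z₀))
    filter_upwards [φ.open_target.mem_nhds (φ.map_source haφ),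
      hc.eventually (eventually_mem_extChartAt_target (J := J) z₀),
      hc.eventually ((tendsto_extChartAt_symm (J := J) z₀).eventually hsrc)] with p h1 h2 h3
    have h4 := φ.right_inv h1
    rw [hφ] at h4
    have h5 : q' (φ.symm p) = p.1 := congrArg Prod.fst h4
    have h6 : B (φ.symm p) = p.2 := congrArg Prod.snd h4
    refine ⟨(contMDiffAt_extChartAt_symm_of_mem h2).comp p (hφs p h1).contMDiffAt, ?_, ?_, ?_⟩
    · have h7 : c.symm (φ.symm p) ∈ (chartAt H z₀).source := by
        rw [← extChartAt_source J]; exact c.map_target h2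
      exact B.contMDiff.contMDiffAt.comp _ (contMDiffAt_extChartAt' h7)
    · rw [← h5]
      exact ((extChartAt J' (q z₀)).left_inv h3).symm
    · rw [c.right_inv h2, h6]

end Horizontal

end Pfaff

/-- A complement of the kernel of a surjection is cut out by an injection of the right rank. -/
theorem LinearMap.exists_apply_eq_of_finrank {E F W : Type*} [AddCommGroup E] [Module ℝ E]
    [FiniteDimensional ℝ E] [AddCommGroup F] [Module ℝ F] [AddCommGroup W] [Module ℝ W]
    {A : E →ₗ[ℝ] F} (hA : Function.Surjective A) {C : W →ₗ[ℝ] E} (hC : Function.Injective C)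
    (hAC : ∀ w, A (C w) = 0) (hr : Module.finrank ℝ F + Module.finrank ℝ W = Module.finrank ℝ E)
    {v : E} (hv : A v = 0) : ∃ w, C w = v := by
  have h1 := A.finrank_range_add_finrank_ker
  rw [LinearMap.range_eq_top.2 hA, finrank_top] at h1
  have h2 : LinearMap.range C = LinearMap.ker A := by
    refine Submodule.eq_of_le_of_finrank_eq ?_ ?_
    · rintro _ ⟨w, rfl⟩
      exact hAC w
    · rw [LinearMap.finrank_range_of_inj hC]
      omega
  have h3 : v ∈ LinearMap.range C := h2 ▸ hv
  exact h3

namespace Pfaff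

/-! ### Annihilators, and forms on the model space -/

section Ann

variable {E : Type*} [NormedAddCommGroup E] [NormedSpace ℝ E]
  {H : Type*} [TopologicalSpace H] {J : ModelWithCorners ℝ E H}
  {X : Type*} [TopologicalSpace X] [ChartedSpace H X]

theorem mem_ann_congr (K : CovectorField J X) {x y : X} (h : x = y) (v : E) :
    (show TangentSpace J x from v) ∈ ann K x ↔ (show TangentSpace J y from v) ∈ ann K y := by
  subst h; rfl

theorem mem_ann_of_eq_span {ι : Type*} {K : CovectorField J X} {x : X}
    {θ : ι → TangentSpace J x →L[ℝ] ℝ} (h : K x = Submodule.span ℝ (range θ))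
    {v : TangentSpace J x} : v ∈ ann K x ↔ ∀ i, θ i v = 0 := by
  constructor
  · intro hv i
    exact hv _ (h ▸ Submodule.subset_span ⟨i, rfl⟩)
  · intro hv α hα
    rw [h] at hα
    refine Submodule.span_induction (p := fun α _ => α v = 0) ?_ rfl ?_ ?_ hα
    · rintro _ ⟨i, rfl⟩
      exact hv i
    · intro β γ _ _ hβ hγ
      exact (congrArg₂ (· + ·) hβ hγ).trans (add_zero _)
    · intro t β _ hβ
      exact (congrArg (t * ·) hβ).trans (mul_zero _)

/-- The chart of a vector space is the identity, so forms pulled back to a parameter space may be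
differentiated directly. -/
theorem chartForm_modelSpace (θ : OneForm 𝓘(ℝ, E) E) (x : E) : chartForm 𝓘(ℝ, E) θ x = θ := by
  funext y
  have h1 : mfderiv 𝓘(ℝ, E) 𝓘(ℝ, E) (extChartAt 𝓘(ℝ, E) x).symm y =
      ContinuousLinearMap.id ℝ (TangentSpace 𝓘(ℝ, E) y) := by
    have : ((extChartAt 𝓘(ℝ, E) x).symm : E → E) = id := by
      rw [extChartAt_model_space_eq_id]; rfl
    rw [this]
    exact mfderiv_id
  unfold chartForm
  rw [h1]
  have h2 : (extChartAt 𝓘(ℝ, E) x).symm y = y := by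
    rw [extChartAt_model_space_eq_id]; rfl
  have h3 : ∀ z, z = y → (θ z : E →L[ℝ] ℝ) = θ y := by rintro z rfl; rfl
  exact h3 _ h2

theorem dForm_modelSpace (θ : OneForm 𝓘(ℝ, E) E) (x v w : E) :
    dForm 𝓘(ℝ, E) θ x v w = fderiv ℝ (F := E →L[ℝ] ℝ) θ x v w -
      fderiv ℝ (F := E →L[ℝ] ℝ) θ x w v := by
  have h1 : fderiv ℝ (chartForm 𝓘(ℝ, E) θ x) (extChartAt 𝓘(ℝ, E) x x) =
      fderiv ℝ (F := E →L[ℝ] ℝ) θ x := by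
    rw [chartForm_modelSpace, extChartAt_model_space_eq_id]; rfl
  change (fderiv ℝ (chartForm 𝓘(ℝ, E) θ x) (extChartAt 𝓘(ℝ, E) x x) : E →L[ℝ] E →L[ℝ] ℝ) v w -
    (fderiv ℝ (chartForm 𝓘(ℝ, E) θ x) (extChartAt 𝓘(ℝ, E) x x) : E →L[ℝ] E →L[ℝ] ℝ) w v = _
  rw [h1]

end Ann

/-! ### Existence of horizontal lifts -/

section Existence

variable {E : Type*} [NormedAddCommGroup E] [NormedSpace ℝ E] [FiniteDimensional ℝ E]
  {H : Type*} [TopologicalSpace H] {J : ModelWithCorners ℝ E H} [J.Boundaryless]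
  {X : Type*} [TopologicalSpace X] [ChartedSpace H X] [IsManifold J ∞ X]
  {E' : Type*} [NormedAddCommGroup E'] [NormedSpace ℝ E'] [FiniteDimensional ℝ E']
  {H' : Type*} [TopologicalSpace H'] {J' : ModelWithCorners ℝ E' H'} [J'.Boundaryless]
  {M : Type*} [TopologicalSpace M] [ChartedSpace H' M] [IsManifold J' ∞ M]
  {E'' : Type*} [NormedAddCommGroup E''] [NormedSpace ℝ E''] [FiniteDimensional ℝ E'']
  {H'' : Type*} [TopologicalSpace H''] {J'' : ModelWithCorners ℝ E'' H''} [J''.Boundaryless]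
  {S : Type*} [TopologicalSpace S] [ChartedSpace H'' S] [IsManifold J'' ∞ S]
  {W : Type*} [NormedAddCommGroup W] [NormedSpace ℝ W] [FiniteDimensional ℝ W]

variable {K : CovectorField J X} {I : CovectorField J' M} {q : X → M}

omit [FiniteDimensional ℝ E''] in
/-- If `q ∘ Z` is an integral map of the reduction `I`, then `d(Z^*θ) = 0` on the vectors that `Z`
maps to `ann K`. -/
theorem IsTransversalReduction.dForm_pullForm_eq_zero (h : IsTransversalReduction K I q)
    {Z : E'' → X} {p : E''} (hZ : ContMDiffAt 𝓘(ℝ, E'') J ∞ Z p)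
    (hI : ∀ᶠ p' in 𝓝 p, ∀ v, mfderiv 𝓘(ℝ, E'') J' (q ∘ Z) p' v ∈ ann I (q (Z p')))
    {U : Set X} {θ : OneForm J X} (hU : IsOpen U) (hx : Z p ∈ U) (hθ : IsSectionOn K θ U)
    {v w : TangentSpace 𝓘(ℝ, E'') p} (hv : mfderiv 𝓘(ℝ, E'') J Z p v ∈ ann K (Z p))
    (hw : mfderiv 𝓘(ℝ, E'') J Z p w ∈ ann K (Z p)) :
    dForm 𝓘(ℝ, E'') (pullForm 𝓘(ℝ, E'') J Z θ) p v w = 0 := by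
  rw [dForm_pullForm hZ (hθ.contDiffAt_chartForm hU hx)]
  refine h.dForm_eq_zero hv hw (fun V φ hV hxV hφ => ?_) hU hx hθ
  have hqZ : ContMDiffAt 𝓘(ℝ, E'') J' ∞ (q ∘ Z) p := (h.smooth _).comp p hZ
  have h1 := dForm_pullForm hqZ (hφ.contDiffAt_chartForm hV hxV) v w
  have h2 : mfderiv 𝓘(ℝ, E'') J' (q ∘ Z) p = (mfderiv J J' q (Z p)).comp
      (mfderiv 𝓘(ℝ, E'') J Z p) :=
    mfderiv_comp p ((h.smooth _).mdifferentiableAt (by simp)) (hZ.mdifferentiableAt (by simp))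
  rw [h2] at h1
  refine h1.symm.trans ?_
  -- As `q ∘ Z` is an integral map of `I`, the pullback of `φ` is identically zero near `p`, and so
  -- is its exterior derivative.
  have h3 : ∀ᶠ p' in 𝓝 p, pullForm 𝓘(ℝ, E'') J' (q ∘ Z) φ p' =
      (fun _ => 0 : OneForm 𝓘(ℝ, E'') E'') p' := by
    filter_upwards [hI, hqZ.continuousAt (hV.mem_nhds hxV)] with p' h4 h5
    ext v
    exact h4 v _ (hφ.2 _ h5)
  rw [dForm_congr h3, dForm_eq, chartForm_modelSpace]
  have h4 : fderiv ℝ (fun _ : E'' => (0 : E'' →L[ℝ] ℝ)) (extChartAt 𝓘(ℝ, E'') p p) = 0 := by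
    simp
  have key : ∀ v w : E'', fderiv ℝ (fun _ : E'' => (0 : E'' →L[ℝ] ℝ))
      (extChartAt 𝓘(ℝ, E'') p p) v w - fderiv ℝ (fun _ : E'' => (0 : E'' →L[ℝ] ℝ))
      (extChartAt 𝓘(ℝ, E'') p p) w v = 0 := by
    intro v w
    rw [h4]; simp
  exact key v w

omit [FiniteDimensional ℝ E''] in
/-- Horizontal lifts in a local parametrization `Z` of a submersion over an integral map `t`. -/
theorem IsTransversalReduction.exists_graph (h : IsTransversalReduction K I q) {x₀ : E''} {w₀ : W}
    {Z : E'' × W → X} {t : E'' → M} {ρ : X → W}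
    (hr : Module.finrank ℝ E' + Module.finrank ℝ W = Module.finrank ℝ E)
    (ht : ∀ᶠ x in 𝓝 x₀, ContMDiffAt 𝓘(ℝ, E'') J' ∞ t x ∧
      ∀ v, mfderiv 𝓘(ℝ, E'') J' t x v ∈ ann I (t x))
    (hZ : ∀ᶠ p in 𝓝 (x₀, w₀), ContMDiffAt 𝓘(ℝ, E'' × W) J ∞ Z p ∧
      ContMDiffAt J 𝓘(ℝ, W) ∞ ρ (Z p) ∧ q (Z p) = t p.1 ∧ ρ (Z p) = p.2) :
    ∃ u : E'' → W, u x₀ = w₀ ∧ ∀ᶠ x in 𝓝 x₀, ContDiffAt ℝ ∞ u x ∧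
      ContMDiffAt 𝓘(ℝ, E'' × W) J ∞ Z (x, u x) ∧ q (Z (x, u x)) = t x ∧
      ∀ v : E'', mfderiv 𝓘(ℝ, E'' × W) J Z (x, u x)
        (show TangentSpace 𝓘(ℝ, E'' × W) (x, u x) from (v, fderiv ℝ u x v)) ∈
        ann K (Z (x, u x)) := by
  obtain ⟨r, hK⟩ := h.pfaffian
  obtain ⟨U, hU, hxU, θ, hθ, hUK⟩ := hK (Z (x₀, w₀))
  let D : E'' × W → E'' × W →L[ℝ] E := fun p => mfderiv 𝓘(ℝ, E'' × W) J Z p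
  let Q : E'' × W → E →L[ℝ] E' := fun p => mfderiv J J' q (Z p)
  -- The pulled-back frame of `K`; its kernel at `p` consists of the vectors that `Z` maps into `ann
  -- K`. A graph tangent to these kernels is a horizontal lift of `t`.
  let Ω : E'' × W → E'' × W →L[ℝ] (Fin r → ℝ) := fun p =>
    ContinuousLinearMap.pi fun i => pullForm 𝓘(ℝ, E'' × W) J Z (θ i) p
  have hθK : ∀ i, IsSectionOn K (θ i) U := fun i => ⟨hθ i, fun y hy => by
    rw [(hUK y hy).2]; exact Submodule.subset_span ⟨i, rfl⟩⟩
  have hZU : ∀ᶠ p in 𝓝 (x₀, w₀), Z p ∈ U :=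
    hZ.self_of_nhds.1.continuousAt (hU.mem_nhds hxU)
  have hfst : Filter.Tendsto Prod.fst (𝓝 (x₀, w₀)) (𝓝 x₀) := continuousAt_fst
  -- the differential of `q ∘ Z = t ∘ fst`
  have hQt : ∀ᶠ p in 𝓝 (x₀, w₀), (mfderiv 𝓘(ℝ, E'' × W) J' (q ∘ Z) p : E'' × W →L[ℝ] E') =
      (mfderiv 𝓘(ℝ, E'') J' t p.1 : E'' →L[ℝ] E').comp (ContinuousLinearMap.fst ℝ E'' W) := by
    filter_upwards [hZ.eventually_nhds, hfst.eventually ht] with p h1 h2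
    have h3 : q ∘ Z =ᶠ[𝓝 p] t ∘ Prod.fst := h1.mono fun p' hp' => hp'.2.2.1
    refine (Filter.EventuallyEq.mfderiv_eq h3).trans ?_
    rw [mfderiv_comp p (h2.1.mdifferentiableAt (by simp)) differentiableAt_fst.mdifferentiableAt,
      mfderiv_eq_fderiv, fderiv_fst]
    rfl
  have hQD : ∀ᶠ p in 𝓝 (x₀, w₀), (mfderiv 𝓘(ℝ, E'' × W) J' (q ∘ Z) p : E'' × W →L[ℝ] E') =
      (Q p).comp (D p) := by
    filter_upwards [hZ] with p h1
    exact mfderiv_comp p ((h.smooth _).mdifferentiableAt (by simp))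
      (h1.1.mdifferentiableAt (by simp))
  have hIt : ∀ᶠ p in 𝓝 (x₀, w₀), ∀ v, mfderiv 𝓘(ℝ, E'' × W) J' (q ∘ Z) p v ∈ ann I (q (Z p)) := by
    filter_upwards [hZ, hfst.eventually ht, hQt] with p h1 h2 h3 v
    have h4 := h2.2 (show E'' × W from v).1
    have h5 := DFunLike.congr_fun h3 v
    refine (mem_ann_congr I h1.2.2.1 _).2 ?_
    exact h5 ▸ h4
  -- `Z` is an immersion in the directions of the fibre
  have hinj : ∀ᶠ p in 𝓝 (x₀, w₀), ∀ w : W, D p (0, w) = 0 → w = 0 := by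
    filter_upwards [hZ.eventually_nhds] with p h1 w hw
    have h2 : ρ ∘ Z =ᶠ[𝓝 p] Prod.snd := h1.mono fun p' hp' => hp'.2.2.2
    have h3 := Filter.EventuallyEq.mfderiv_eq (I := 𝓘(ℝ, E'' × W)) (I' := 𝓘(ℝ, W)) h2
    rw [mfderiv_comp p (h1.self_of_nhds.2.1.mdifferentiableAt (by simp))
      (h1.self_of_nhds.1.mdifferentiableAt (by simp)), mfderiv_eq_fderiv, fderiv_snd] at h3
    have h4 := DFunLike.congr_fun h3 ((0, w) : E'' × W)
    refine Eq.trans ?_ (h4.symm.trans ?_)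
    · rfl
    · exact (congrArg (mfderiv J 𝓘(ℝ, W) ρ (Z p)) hw).trans (map_zero _)
  have hΩ0 : ∀ {p}, Z p ∈ U → ∀ {v : E'' × W}, Ω p v = 0 ↔
      (show TangentSpace J (Z p) from D p v) ∈ ann K (Z p) := by
    intro p hp v
    rw [mem_ann_of_eq_span (hUK _ hp).2]
    exact funext_iff
  have hker : ∀ᶠ p in 𝓝 (x₀, w₀), ∀ w : W, Q p (D p (0, w)) = 0 := by
    filter_upwards [hQt, hQD] with p h1 h2 w
    have h3 := DFunLike.congr_fun (h2.symm.trans h1) ((0, w) : E'' × W)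
    exact h3.trans (map_zero (mfderiv 𝓘(ℝ, E'') J' t p.1 : E'' →L[ℝ] E'))
  have hcomp : ∀ᶠ p in 𝓝 (x₀, w₀), ∀ i,
      ContDiffAt ℝ ∞ (F := E'' × W →L[ℝ] ℝ) (pullForm 𝓘(ℝ, E'' × W) J Z (θ i)) p := by
    filter_upwards [hZ, hZU] with p h1 h2 i
    have h3 := contDiffAt_chartForm_pullForm h1.1 ((hθK i).contDiffAt_chartForm hU h2)
    rw [chartForm_modelSpace] at h3
    exact h3
  have key := exists_graph_tangent (Ω := Ω) (x₀ := x₀) (w₀ := w₀) ?_ ?_ ?_ ?_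
  · obtain ⟨u, hu, hu'⟩ := key
    have huc : Filter.Tendsto (fun x => (x, u x)) (𝓝 x₀) (𝓝 (x₀, w₀)) := by
      have h1 := (continuousAt_id (x := x₀)).prodMk hu'.self_of_nhds.1.continuousAt
      rw [← hu]
      exact h1
    refine ⟨u, hu, ?_⟩
    filter_upwards [hu', huc.eventually hZ, huc.eventually hZU] with x h1 h2 h3
    exact ⟨h1.1, h2.1, h2.2.2.1, fun v => (hΩ0 h3).1 (h1.2 v)⟩
  · filter_upwards [hcomp] with p h1
    exact ContDiffAt.clm_pi h1
  · filter_upwards [hZ, hZU, hIt, hQD, hinj, hker] with p h1 h2 h3 h4 h5 h6 v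
    -- The kernel contains a vector over `v`: lift the image of `(v, 0)` under `d(q ∘ Z)` to some
    -- `e` in `ann K`. The difference of `e` and `D p (v, 0)` lies in `ker q_*`, which by dimension
    -- count is the image of the fibre directions.
    obtain ⟨e, he, heq⟩ := h.exists_lift (h3 ((v, 0) : E'' × W))
    have h7 : Q p ((show E from e) - D p (v, 0)) = 0 := by
      rw [map_sub, sub_eq_zero]
      exact heq.trans (DFunLike.congr_fun h4 ((v, 0) : E'' × W))
    obtain ⟨w, hw⟩ := LinearMap.exists_apply_eq_of_finrank (A := (Q p).toLinearMap)
      (h.submersion _) (C := (D p).toLinearMap ∘ₗ LinearMap.inr ℝ E'' W)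
      (LinearMap.ker_eq_bot.1 (LinearMap.ker_eq_bot'.2 h5)) h6 hr h7
    refine ⟨w, (hΩ0 h2).2 ?_⟩
    have h8 : D p (v, w) = e := by
      have h9 : ((v, w) : E'' × W) = (v, 0) + (0, w) := by simp
      have h10 : D p (0, w) = (show E from e) - D p (v, 0) := hw
      rw [h9, map_add, h10, add_sub_cancel]
    rw [h8]
    exact he
  -- A vertical vector of the kernel goes to `ann K ∩ ker q_* = 0`, and `Z` is immersive along the
  -- fibres.
  · filter_upwards [hZU, hinj, hker] with p h2 h5 h6 w hw
    exact h5 w (h.eq_zero ((hΩ0 h2).1 hw) (h6 w))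
  -- Involutivity: the pulled-back frame forms have vanishing exterior derivative on the kernel of
  -- `Ω`.
  · filter_upwards [hZ, hZU, hIt.eventually_nhds, hcomp] with p h1 h2 h3 h4 a b ha hb
    have h5 : ∀ i (a b : E'' × W), fderiv ℝ Ω p a b i =
        fderiv ℝ (F := E'' × W →L[ℝ] ℝ) (pullForm 𝓘(ℝ, E'' × W) J Z (θ i)) p a b := by
      intro i a b
      have h6 : HasFDerivAt (fun p => (ContinuousLinearMap.proj (R := ℝ) (φ := fun _ : Fin r => ℝ) i).comp (Ω p))
          _ p := (hasFDerivAt_const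
            (ContinuousLinearMap.proj (R := ℝ) (φ := fun _ : Fin r => ℝ) i) p).clm_comp
            ((ContDiffAt.clm_pi h4).differentiableAt (by simp)).hasFDerivAt
      have h7 : (pullForm 𝓘(ℝ, E'' × W) J Z (θ i)) = fun p =>
          (ContinuousLinearMap.proj (R := ℝ) (φ := fun _ : Fin r => ℝ) i).comp (Ω p) := rfl
      rw [h7, h6.fderiv]
      simp
      rfl
    funext i
    have h6 := h.dForm_pullForm_eq_zero h1.1 h3 hU h2 (hθK i) ((hΩ0 h2).1 ha) ((hΩ0 h2).1 hb)
    rw [h5, h5]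
    exact sub_eq_zero.1 ((dForm_modelSpace _ p a b).symm.trans h6)

omit [FiniteDimensional ℝ E''] in
/-- Horizontal lifts of an integral manifold of the reduction exist locally. -/
theorem IsTransversalReduction.exists_horizontal_lift (h : IsTransversalReduction K I q) {s : S → M}
    (hs : IsIntegralManifold J'' I s) {y₀ : S} {z₀ : X} (hz : q z₀ = s y₀) :
    ∃ u : S → X, u y₀ = z₀ ∧ ∀ᶠ y in 𝓝 y₀, ContMDiffAt J'' J ∞ u y ∧ q (u y) = s y ∧
      ∀ v, mfderiv J'' J u y v ∈ ann K (u y) := by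
  obtain ⟨W, Ψ, ρ, hr, hΨ₀, hΨ⟩ := exists_local_parametrization (J := J) (J' := J') h.smooth
    (h.submersion z₀)
  rw [hz] at hΨ₀ hΨ
  let cS := extChartAt J'' y₀
  let cM := extChartAt J' (s y₀)
  let t : E'' → M := fun x => s (cS.symm x)
  -- A parametrization of `q⁻¹(S)` by a chart of `S` and the fibre coordinate: by construction `q (Z
  -- (x, w)) = t x`.
  let Z : E'' × W → X := fun p => Ψ (cM (t p.1), p.2)
  let x₀ : E'' := cS y₀
  let w₀ : W := ρ z₀
  have hcS := tendsto_extChartAt_symm (J := J'') y₀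
  have ht0 : t x₀ = s y₀ := by simp only [t, x₀, cS, extChartAt_to_inv]
  have hZ0 : Z (x₀, w₀) = z₀ := by
    simp only [Z, ht0]; exact hΨ₀
  have hts : ∀ᶠ x in 𝓝 x₀, ContMDiffAt 𝓘(ℝ, E'') J' ∞ t x := by
    filter_upwards [eventually_mem_extChartAt_target (J := J'') y₀] with x hx
    exact (hs.smooth _).comp x (contMDiffAt_extChartAt_symm_of_mem hx)
  have hsrc : ∀ᶠ x in 𝓝 x₀, t x ∈ cM.source := by
    have h1 : ∀ᶠ y in 𝓝 y₀, s y ∈ cM.source :=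
      (hs.smooth y₀).continuousAt (extChartAt_source_mem_nhds (s y₀))
    exact hcS.eventually h1
  have ht : ∀ᶠ x in 𝓝 x₀, ContMDiffAt 𝓘(ℝ, E'') J' ∞ t x ∧
      ∀ v, mfderiv 𝓘(ℝ, E'') J' t x v ∈ ann I (t x) := by
    filter_upwards [hts, eventually_mem_extChartAt_target (J := J'') y₀] with x h1 h2
    refine ⟨h1, fun v α hα => ?_⟩
    have h3 : mfderiv 𝓘(ℝ, E'') J' t x = (mfderiv J'' J' s (cS.symm x)).comp
        (mfderiv 𝓘(ℝ, E'') J'' cS.symm x) :=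
      mfderiv_comp x ((hs.smooth _).mdifferentiableAt (by simp))
        ((contMDiffAt_extChartAt_symm_of_mem h2).mdifferentiableAt (by simp))
    rw [h3]
    exact DFunLike.congr_fun (hs.pull_eq_zero _ α hα) _
  have hfst : Filter.Tendsto Prod.fst (𝓝 (x₀, w₀)) (𝓝 x₀) := continuousAt_fst
  have hm : ∀ᶠ p in 𝓝 (x₀, w₀), ContMDiffAt 𝓘(ℝ, E'' × W) 𝓘(ℝ, E' × W) ∞
      (fun p : E'' × W => (cM (t p.1), p.2)) p := by
    filter_upwards [hfst.eventually hts, hfst.eventually hsrc] with p h1 h2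
    have h3 : ContMDiffAt 𝓘(ℝ, E'') 𝓘(ℝ, E') ∞ (fun x => cM (t x)) p.1 :=
      (contMDiffAt_extChartAt' (by rwa [← extChartAt_source J'])).comp _ h1
    exact (h3.contDiffAt.comp p contDiffAt_fst |>.prodMk contDiffAt_snd).contMDiffAt
  have hm0 : Filter.Tendsto (fun p : E'' × W => (cM (t p.1), p.2)) (𝓝 (x₀, w₀))
      (𝓝 (cM (s y₀), w₀)) := by
    have h1 := hm.self_of_nhds.continuousAt
    change Filter.Tendsto _ _ (𝓝 (cM (t x₀), w₀)) at h1
    rwa [ht0] at h1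
  obtain ⟨w, hw0, hw⟩ := h.exists_graph (x₀ := x₀) (w₀ := w₀) (Z := Z) (t := t) (ρ := ρ) hr ht (by
    filter_upwards [hm, hm0.eventually hΨ, hfst.eventually hsrc] with p h1 h2 h3
    refine ⟨h2.1.comp p h1, h2.2.1, h2.2.2.1.trans (cM.left_inv h3), h2.2.2.2⟩)
  have hcy : Filter.Tendsto cS (𝓝 y₀) (𝓝 x₀) := continuousAt_extChartAt y₀
  refine ⟨fun y => Z (cS y, w (cS y)), ?_, ?_⟩
  · change Z (x₀, w x₀) = z₀
    rw [hw0, hZ0]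
  · filter_upwards [hcy.eventually hw, eventually_extChartAt_left_inv (J := J'') y₀,
      extChartAt_source_mem_nhds (I := J'') y₀] with y h1 h2 h3
    obtain ⟨h4, h5, h6, h7⟩ := h1
    have hcs : ContMDiffAt J'' 𝓘(ℝ, E'') ∞ cS y :=
      contMDiffAt_extChartAt' (by rwa [← extChartAt_source J''])
    have hg : ContMDiffAt 𝓘(ℝ, E'') 𝓘(ℝ, E'' × W) ∞ (fun x => (x, w x)) (cS y) :=
      (contDiffAt_id.prodMk h4).contMDiffAt
    have hg' : mfderiv 𝓘(ℝ, E'') 𝓘(ℝ, E'' × W) (fun x => (x, w x)) (cS y) =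
        (ContinuousLinearMap.id ℝ E'').prod (fderiv ℝ w (cS y)) := by
      rw [mfderiv_eq_fderiv]
      exact ((hasFDerivAt_id _).prodMk (h4.differentiableAt (by simp)).hasFDerivAt).fderiv
    refine ⟨(h5.comp (cS y) hg).comp y hcs, h6.trans (congrArg s h2), fun v => ?_⟩
    have h8 : mfderiv J'' J (fun y => Z (cS y, w (cS y))) y =
        ((mfderiv 𝓘(ℝ, E'' × W) J Z (cS y, w (cS y))).comp
          (mfderiv 𝓘(ℝ, E'') 𝓘(ℝ, E'' × W) (fun x => (x, w x)) (cS y))).comp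
          (mfderiv J'' 𝓘(ℝ, E'') cS y) := by
      have h9 := mfderiv_comp y ((h5.comp (cS y) hg).mdifferentiableAt (by simp))
        (hcs.mdifferentiableAt (by simp))
      have h10 := mfderiv_comp (cS y) (h5.mdifferentiableAt (by simp))
        (hg.mdifferentiableAt (by simp))
      refine h9.trans ?_
      rw [h10]
    rw [h8, hg']
    exact h7 (mfderiv J'' 𝓘(ℝ, E'') cS y v)

end Existence

end Pfaff

/-! ### The étale space of a family of local sections -/

section EtaleSpace

variable {P S : Type*} [TopologicalSpace S] {π : P → S} {𝓢 : Set (Set S × (S → P))}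

/-- A family of local sections of `π`, through each point of the total space, any two of which agree
near the points where they agree. -/
structure IsSectionFamily (π : P → S) (𝓢 : Set (Set S × (S → P))) : Prop where
  isOpen : ∀ u ∈ 𝓢, IsOpen u.1
  proj : ∀ u ∈ 𝓢, ∀ y ∈ u.1, π (u.2 y) = y
  exists_mem : ∀ z, ∃ u ∈ 𝓢, π z ∈ u.1 ∧ u.2 (π z) = z
  eventuallyEq : ∀ u ∈ 𝓢, ∀ v ∈ 𝓢, ∀ y ∈ u.1, y ∈ v.1 → u.2 y = v.2 y → u.2 =ᶠ[𝓝 y] v.2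

/-- The finest topology in which the given local sections are continuous. -/
@[reducible] def sectionTopology (𝓢 : Set (Set S × (S → P))) : TopologicalSpace P where
  IsOpen A := ∀ u ∈ 𝓢, ∀ y ∈ u.1, u.2 y ∈ A → ∀ᶠ y' in 𝓝 y, u.2 y' ∈ A
  isOpen_univ _ _ _ _ _ := Filter.univ_mem
  isOpen_inter A B hA hB u hu y hy hy' :=
    (hA u hu y hy hy'.1).and (hB u hu y hy hy'.2)
  isOpen_sUnion T hT u hu y hy := by
    rintro ⟨A, hA, hyA⟩
    exact (hT A hA u hu y hy hyA).mono fun y' hy' => ⟨A, hA, hy'⟩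

theorem continuousAt_sectionTopology {u : Set S × (S → P)} (hu : u ∈ 𝓢) {y : S} (hy : y ∈ u.1) :
    @ContinuousAt S P _ (sectionTopology 𝓢) u.2 y := by
  let : TopologicalSpace P := sectionTopology 𝓢
  refine tendsto_nhds.2 fun A hA hyA => hA u hu y hy hyA

/-- Two sections that meet in a point have the same base point there, since both are sections of
`π`, and then they agree near it. -/
theorem IsSectionFamily.isOpen_image (h : IsSectionFamily π 𝓢) {u : Set S × (S → P)}
    (hu : u ∈ 𝓢) : IsOpen[sectionTopology 𝓢] (u.2 '' u.1) := by
  rintro v hv y hy ⟨y', hy', he⟩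
  have h1 : y' = y := by rw [← h.proj u hu y' hy', he, h.proj v hv y hy]
  subst h1
  filter_upwards [h.eventuallyEq u hu v hv y' hy' hy he, (h.isOpen u hu).mem_nhds hy']
    with y'' h2 h3
  exact ⟨y'', h3, h2⟩

/-- The sections themselves are the local inverses: they are continuous, have open images, and pass
through every point. -/
theorem IsSectionFamily.isLocalHomeomorph (h : IsSectionFamily π 𝓢) :
    @IsLocalHomeomorph P S (sectionTopology 𝓢) _ π := by
  let : TopologicalSpace P := sectionTopology 𝓢
  have hπ : Continuous π := by
    refine continuous_def.2 fun O hO u hu y hy hyO => ?_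
    rw [mem_preimage, h.proj u hu y hy] at hyO
    filter_upwards [hO.mem_nhds hyO, (h.isOpen u hu).mem_nhds hy] with y' h1 h2
    rwa [mem_preimage, h.proj u hu y' h2]
  intro z
  obtain ⟨u, hu, hzu, huz⟩ := h.exists_mem z
  refine ⟨{ toFun := π, invFun := u.2, source := u.2 '' u.1, target := u.1,
            map_source' := ?_, map_target' := fun y hy => mem_image_of_mem _ hy,
            left_inv' := ?_, right_inv' := h.proj u hu, open_source := h.isOpen_image hu,
            open_target := h.isOpen u hu, continuousOn_toFun := hπ.continuousOn,
            continuousOn_invFun := fun y hy =>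
              (continuousAt_sectionTopology hu hy).continuousWithinAt }, ⟨_, hzu, huz⟩, rfl⟩
  · rintro _ ⟨y, hy, rfl⟩
    rwa [h.proj u hu y hy]
  · rintro _ ⟨y, hy, rfl⟩
    rw [h.proj u hu y hy]

theorem continuous_of_sectionTopology {X : Type*} [TopologicalSpace X] {ι : P → X}
    (hι : ∀ u ∈ 𝓢, ∀ y ∈ u.1, ContinuousAt (fun y => ι (u.2 y)) y) :
    @Continuous P X (sectionTopology 𝓢) _ ι := by
  let : TopologicalSpace P := sectionTopology 𝓢
  exact continuous_def.2 fun O hO u hu y hy hyO => hι u hu y hy (hO.mem_nhds hyO)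

end EtaleSpace

/-! ### The theorem of Poincaré and Volterra -/

section SecondCountable

open TopologicalSpace

/-- A second countable locally connected space has a countable basis of connected open sets. -/
theorem exists_countable_connected_basis (S : Type*) [TopologicalSpace S] [LocallyConnectedSpace S]
    [SecondCountableTopology S] : ∃ b : Set (Set S), b.Countable ∧ (∀ V ∈ b, IsOpen V) ∧
      (∀ V ∈ b, IsPreconnected V) ∧ ∀ O : Set S, IsOpen O → ∀ y ∈ O, ∃ V ∈ b, y ∈ V ∧ V ⊆ O := by
  obtain ⟨D, hD, hD'⟩ := exists_countable_dense S
  refine ⟨image2 connectedComponentIn (countableBasis S) D, (countable_countableBasis S).image2 hD _,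
    ?_, ?_, ?_⟩
  · rintro _ ⟨U, hU, y, -, rfl⟩
    exact (isOpen_of_mem_countableBasis hU).connectedComponentIn
  · rintro _ ⟨U, hU, y, -, rfl⟩
    exact isPreconnected_connectedComponentIn
  · intro O hO y hy
    obtain ⟨U, hU, hyU, hUO⟩ := (isBasis_countableBasis S).exists_subset_of_mem_open hy hO
    have h1 : IsOpen (connectedComponentIn U y) :=
      (isOpen_of_mem_countableBasis hU).connectedComponentIn
    -- Components of a basic open set are open, so each of them meets the countable dense set; this
    -- is why countably many suffice.
    obtain ⟨a, ha, haD⟩ := hD'.inter_open_nonempty _ h1 ⟨y, mem_connectedComponentIn hyU⟩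
    have h2 := connectedComponentIn_eq ha
    exact ⟨_, ⟨U, hU, a, haD, rfl⟩, h2 ▸ mem_connectedComponentIn hyU,
      (connectedComponentIn_subset U a).trans hUO⟩

/-- The theorem of Poincaré and Volterra: a connected Hausdorff space which is spread over a second
countable locally connected space is second countable. -/
theorem IsLocalHomeomorph.secondCountableTopology {L S : Type*} [TopologicalSpace L]
    [TopologicalSpace S] [T2Space L] [ConnectedSpace L] [LocallyConnectedSpace S]
    [SecondCountableTopology S] {π : L → S} (hπ : IsLocalHomeomorph π) :
    SecondCountableTopology L := by
  obtain ⟨b, hb, hbo, hbc, hbb⟩ := exists_countable_connected_basis S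
  -- the sheets over the connected open sets `V ∈ b`
  let sheets : Set S → Set (Set L) := fun V => {W | ∃ g : C(V, L), π ∘ g = (↑) ∧ range g = W}
  have hemb : ∀ V ∈ b, ∀ g : C(V, L), π ∘ g = (↑) → IsOpenEmbedding g := fun V hV g hg =>
    hπ.isOpenEmbedding_of_comp (hg ▸ (hbo V hV).isOpenEmbedding_subtypeVal) g.continuous
  have hopen : ∀ V ∈ b, ∀ W ∈ sheets V, IsOpen W := by
    rintro V hV _ ⟨g, hg, rfl⟩
    exact (hemb V hV g hg).isOpen_range
  have hsc : ∀ V ∈ b, ∀ W ∈ sheets V, SecondCountableTopology W := by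
    rintro V hV _ ⟨g, hg, rfl⟩
    exact (hemb V hV g hg).isEmbedding.toHomeomorph.symm.secondCountableTopology
  -- Two sheets over a connected `V` that meet are equal, by uniqueness of lifts into the Hausdorff
  -- space `L`.
  have hdisj : ∀ V ∈ b, (sheets V).PairwiseDisjoint id := by
    rintro V hV _ ⟨g, hg, rfl⟩ _ ⟨g', hg', rfl⟩ hne
    refine Set.disjoint_left.2 ?_
    rintro _ ⟨y, rfl⟩ ⟨y', hy'⟩
    refine hne ?_
    have : PreconnectedSpace V := isPreconnected_iff_preconnectedSpace.1 (hbc V hV)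
    have h1 : y' = y := Subtype.ext (by
      rw [← congrFun hg y, ← congrFun hg' y']; exact congrArg π hy')
    subst h1
    have h2 := (T2Space.isSeparatedMap π).eq_of_comp_eq hπ.isLocallyInjective g.continuous
      g'.continuous (hg.trans hg'.symm) y' hy'.symm
    rw [h2]
  have hcov : ∀ z, ∃ V ∈ b, ∃ W ∈ sheets V, z ∈ W := by
    intro z
    obtain ⟨e, hze, he⟩ := hπ z
    obtain ⟨V, hV, hzV, hVe⟩ := hbb e.target e.open_target (e z) (e.map_source hze)
    refine ⟨V, hV, _, ⟨⟨fun y => e.symm y, continuousOn_iff_continuous_domRestrict.1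
      (e.continuousOn_symm.mono hVe)⟩, ?_, rfl⟩, ⟨e z, hzV⟩, e.left_inv hze⟩
    ext y
    rw [he]
    exact e.right_inv (hVe y.2)
  -- For a fixed `V'` the sheets over it meet `W` in disjoint nonempty open sets, of which the
  -- second countable `W` has at most countably many.
  have hmeet : ∀ V ∈ b, ∀ W ∈ sheets V,
      {W' | (∃ V' ∈ b, W' ∈ sheets V') ∧ (W ∩ W').Nonempty}.Countable := by
    intro V hV W hW
    have := hsc V hV W hW
    have h1 : {W' | (∃ V' ∈ b, W' ∈ sheets V') ∧ (W ∩ W').Nonempty} =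
        ⋃ V' ∈ b, {W' | W' ∈ sheets V' ∧ (W ∩ W').Nonempty} := by
      ext W'
      simp only [mem_ofPred_eq, mem_iUnion, exists_prop]
      tauto
    rw [h1]
    refine hb.biUnion fun V' hV' => ?_
    refine Set.PairwiseDisjoint.countable_of_isOpen (α := W) (s := fun W' => (↑) ⁻¹' W')
      ?_ ?_ ?_
    · intro W₁ h1 W₂ h2 hne
      exact (hdisj V' hV' h1.1 h2.1 hne).preimage _
    · intro W' h1
      exact (hopen V' hV' W' h1.1).preimage continuous_subtype_val
    · rintro W' ⟨-, z, hz, hz'⟩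
      exact ⟨⟨z, hz⟩, hz'⟩
  -- All sheets that meet a given collection. Iterating from one sheet reaches countably many, and
  -- their union is open and closed, hence everything as `L` is connected.
  let step : Set (Set L) → Set (Set L) := fun 𝒲 =>
    ⋃ W ∈ 𝒲, {W' | (∃ V' ∈ b, W' ∈ sheets V') ∧ (W ∩ W').Nonempty}
  let z₀ : L := Classical.arbitrary L
  obtain ⟨V₀, hV₀, W₀, hW₀, hz₀⟩ := hcov z₀
  let 𝒲 : ℕ → Set (Set L) := fun n => step^[n] {W₀}
  have h𝒲 : ∀ n, (𝒲 n).Countable ∧ ∀ W ∈ 𝒲 n, ∃ V ∈ b, W ∈ sheets V := by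
    intro n
    induction n with
    | zero =>
      refine ⟨countable_singleton _, ?_⟩
      intro W hW
      have h1 : W = W₀ := hW
      exact ⟨V₀, hV₀, h1 ▸ hW₀⟩
    | succ n ih =>
      have h1 : 𝒲 (n + 1) = step (𝒲 n) := Function.iterate_succ_apply' step n _
      rw [h1]
      refine ⟨ih.1.biUnion fun W hW => ?_, fun W hW => ?_⟩
      · obtain ⟨V, hV, hWV⟩ := ih.2 W hW
        exact hmeet V hV W hWV
      · simp only [step, mem_iUnion] at hW
        obtain ⟨W', hW', h2, -⟩ := hW
        exact h2
  let 𝒯 : Set (Set L) := ⋃ n, 𝒲 n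
  have h𝒯 : 𝒯.Countable := countable_iUnion fun n => (h𝒲 n).1
  have h𝒯' : ∀ W ∈ 𝒯, ∃ V ∈ b, W ∈ sheets V := by
    intro W hW
    obtain ⟨n, hn⟩ := mem_iUnion.1 hW
    exact (h𝒲 n).2 W hn
  have hclosed : ∀ W ∈ 𝒯, ∀ V' ∈ b, ∀ W' ∈ sheets V', (W ∩ W').Nonempty → W' ∈ 𝒯 := by
    intro W hW V' hV' W' hW' hne
    obtain ⟨n, hn⟩ := mem_iUnion.1 hW
    refine mem_iUnion.2 ⟨n + 1, ?_⟩
    have h1 : 𝒲 (n + 1) = step (𝒲 n) := Function.iterate_succ_apply' step n _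
    rw [h1]
    exact mem_biUnion hn ⟨⟨V', hV', hW'⟩, hne⟩
  have hT : ⋃₀ 𝒯 = univ := by
    refine IsClopen.eq_univ ⟨⟨?_⟩, ?_⟩ ⟨z₀, W₀, mem_iUnion.2 ⟨0, rfl⟩, hz₀⟩
    · refine isOpen_iff_mem_nhds.2 fun z hz => ?_
      obtain ⟨V, hV, W, hW, hzW⟩ := hcov z
      refine Filter.mem_of_superset ((hopen V hV W hW).mem_nhds hzW) ?_
      rintro z' hz' ⟨W', hW', hz''⟩
      exact hz ⟨W, hclosed W' hW' V hV W hW ⟨z', hz'', hz'⟩, hzW⟩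
    · refine isOpen_sUnion fun W hW => ?_
      obtain ⟨V, hV, hWV⟩ := h𝒯' W hW
      exact hopen V hV W hWV
  have : Countable 𝒯 := h𝒯.to_subtype
  have : ∀ W : 𝒯, SecondCountableTopology (W : Set L) := by
    intro W
    obtain ⟨V, hV, hWV⟩ := h𝒯' W W.2
    exact hsc V hV W hWV
  refine secondCountableTopology_of_countable_cover (U := fun W : 𝒯 => (W : Set L)) ?_ ?_
  · intro W
    obtain ⟨V, hV, hWV⟩ := h𝒯' W W.2
    exact hopen V hV W hWV
  · rw [← sUnion_eq_iUnion, hT]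

end SecondCountable

/-! ### Manifold structure pulled back by a local homeomorphism -/

namespace IsLocalHomeomorph

variable {E : Type*} [NormedAddCommGroup E] [NormedSpace ℝ E]
  {H : Type*} [TopologicalSpace H] {J : ModelWithCorners ℝ E H}
  {S : Type*} [TopologicalSpace S] [ChartedSpace H S]
  {L : Type*} [TopologicalSpace L] {π : L → S}

/-- The charts of `S`, pulled back by a local homeomorphism `π : L → S`. -/
@[reducible] def pullbackChartedSpace (hπ : IsLocalHomeomorph π) : ChartedSpace H L where
  atlas := range fun z => (hπ z).choose.trans (chartAt H (π z))
  chartAt z := (hπ z).choose.trans (chartAt H (π z))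
  mem_chart_source z := by
    rw [OpenPartialHomeomorph.trans_source]
    refine ⟨(hπ z).choose_spec.1, ?_⟩
    rw [← (hπ z).choose_spec.2]
    exact mem_chart_source H (π z)
  chart_mem_atlas z := ⟨z, rfl⟩

/-- Any two local inverses of `π` are inverse to the same map, so they cancel in a change of charts,
which becomes a restriction of one of `S`. -/
theorem isManifold_pullback [IsManifold J ∞ S] (hπ : IsLocalHomeomorph π) :
    @IsManifold ℝ _ E _ _ H _ J ∞ L _ hπ.pullbackChartedSpace := by
  let : ChartedSpace H L := hπ.pullbackChartedSpace
  refine isManifold_of_contDiffOn J ∞ L ?_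
  rintro _ _ ⟨z, rfl⟩ ⟨z', rfl⟩
  obtain ⟨-, he⟩ := (hπ z).choose_spec
  obtain ⟨-, he'⟩ := (hπ z').choose_spec
  set e := (hπ z).choose with hez
  set e' := (hπ z').choose with hez'
  let c := chartAt H (π z)
  let c' := chartAt H (π z')
  have h1 : ContDiffOn ℝ ∞ (J ∘ (c.symm ≫ₕ c') ∘ J.symm)
      (J.symm ⁻¹' (c.symm ≫ₕ c').source ∩ range J) :=
    (mem_groupoid_of_pregroupoid.1 (HasGroupoid.compatible (G := contDiffGroupoid ∞ J)
      (chart_mem_atlas H (π z)) (chart_mem_atlas H (π z')))).1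
  have h2 : ∀ x ∈ ((e ≫ₕ c).symm ≫ₕ (e' ≫ₕ c')).source,
      x ∈ c.target ∧ c.symm x ∈ c'.source ∧ e' (e.symm (c.symm x)) = c.symm x := by
    intro x hx
    obtain ⟨⟨h3, h4⟩, h5, h6⟩ := hx
    have h7 : e' (e.symm (c.symm x)) = c.symm x := by
      rw [← he', he]
      exact e.right_inv h4
    refine ⟨h3, ?_, h7⟩
    rw [← h7]
    exact h6
  refine (h1.mono ?_).congr ?_
  · rintro p ⟨hp, hp'⟩
    obtain ⟨h3, h4, -⟩ := h2 _ hp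
    exact ⟨⟨h3, h4⟩, hp'⟩
  · rintro p ⟨hp, -⟩
    obtain ⟨-, -, h5⟩ := h2 _ hp
    exact congrArg (fun y => J (c' y)) h5

/-- With these charts `π` is the identity in coordinates, which makes it smooth with identity
differential. -/
theorem extChartAt_pullback (hπ : IsLocalHomeomorph π) (z z' : L) :
    @extChartAt ℝ E L H _ _ _ _ _ J hπ.pullbackChartedSpace z z' = extChartAt J (π z) (π z') := by
  change J (chartAt H (π z) ((hπ z).choose z')) = _
  rw [← (hπ z).choose_spec.2]
  rfl

variable [J.Boundaryless]

theorem contMDiff_pullback (hπ : IsLocalHomeomorph π) :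
    @ContMDiff ℝ _ E _ _ H _ J L _ hπ.pullbackChartedSpace E _ _ H _ J S _ _ ∞ π := by
  let : ChartedSpace H L := hπ.pullbackChartedSpace
  intro z
  rw [contMDiffAt_iff]
  refine ⟨hπ.continuous.continuousAt, ?_⟩
  rw [J.range_eq_univ, contDiffWithinAt_univ]
  refine contDiffAt_id.congr_of_eventuallyEq ?_
  filter_upwards [Pfaff.eventually_mem_extChartAt_target (J := J) z] with p hp
  refine Eq.trans ?_ ((extChartAt J z).right_inv hp)
  exact (hπ.extChartAt_pullback z _).symm

theorem mfderiv_pullback (hπ : IsLocalHomeomorph π) (z : L) :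
    @mfderiv ℝ _ E _ _ H _ J L _ hπ.pullbackChartedSpace E _ _ H _ J S _ _ π z =
      ContinuousLinearMap.id ℝ E := by
  let : ChartedSpace H L := hπ.pullbackChartedSpace
  rw [Pfaff.mfderiv_eq_fderiv_writtenInExtChartAt
    ((hπ.contMDiff_pullback z).mdifferentiableAt (by simp))]
  refine Eq.trans (Filter.EventuallyEq.fderiv_eq ?_) fderiv_id
  filter_upwards [Pfaff.eventually_mem_extChartAt_target (J := J) z] with p hp
  refine Eq.trans ?_ ((extChartAt J z).right_inv hp)
  exact (hπ.extChartAt_pullback z _).symm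

end IsLocalHomeomorph

/-! ### Maps into embedded submanifolds -/

section Immersion

open Pfaff

variable {E : Type*} [NormedAddCommGroup E] [NormedSpace ℝ E] [FiniteDimensional ℝ E]
  {H : Type*} [TopologicalSpace H] {J : ModelWithCorners ℝ E H} [J.Boundaryless]
  {S : Type*} [TopologicalSpace S] [ChartedSpace H S] [IsManifold J ∞ S]
  {E' : Type*} [NormedAddCommGroup E'] [NormedSpace ℝ E'] [FiniteDimensional ℝ E']
  {H' : Type*} [TopologicalSpace H'] {J' : ModelWithCorners ℝ E' H'}
  {M : Type*} [TopologicalSpace M] [ChartedSpace H' M] [IsManifold J' ∞ M]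
  {E'' : Type*} [NormedAddCommGroup E''] [NormedSpace ℝ E'']
  {H'' : Type*} [TopologicalSpace H''] {J'' : ModelWithCorners ℝ E'' H''}
  {N : Type*} [TopologicalSpace N] [ChartedSpace H'' N]

/-- An immersion has smooth local left inverses. -/
theorem exists_contMDiffAt_leftInverse {s : S → M} {y : S} (hs : ContMDiff J J' ∞ s)
    (hi : Function.Injective (mfderiv J J' s y)) :
    ∃ r : M → S, ContMDiffAt J' J ∞ r (s y) ∧ ∀ᶠ y' in 𝓝 y, r (s y') = y' := by
  let c := extChartAt J y
  let c' := extChartAt J' (s y)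
  let s' : E → E' := writtenInExtChartAt J J' y s
  have hd := mfderiv_eq_fderiv_writtenInExtChartAt ((hs y).mdifferentiableAt (by simp))
  rw [hd] at hi
  -- Composing with a linear left inverse `A` of the differential gives a map between spaces of
  -- equal dimension with identity derivative, which the inverse function theorem inverts.
  obtain ⟨A₀, hA₀⟩ := LinearMap.exists_leftInverse_of_injective (fderiv ℝ s' (c y)).toLinearMap
    (LinearMap.ker_eq_bot.2 hi)
  let A : E' →L[ℝ] E := A₀.toContinuousLinearMap
  have hs' : ∀ᶠ x in 𝓝 (c y), ContDiffAt ℝ ∞ s' x := eventually_contDiffAt_writtenInExtChartAt hs y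
  have hf : ∀ᶠ x in 𝓝 (c y), ContDiffAt ℝ ∞ (fun x => A (s' x)) x :=
    hs'.mono fun x hx => A.contDiff.contDiffAt.comp x hx
  have hf' : fderiv ℝ (fun x => A (s' x)) (c y) = (ContinuousLinearEquiv.refl ℝ E : E →L[ℝ] E) := by
    have h1 := (A.hasFDerivAt.comp (c y)
      (hs'.self_of_nhds.differentiableAt (by simp)).hasFDerivAt).fderiv
    refine h1.trans ?_
    ext v
    exact LinearMap.congr_fun hA₀ v
  obtain ⟨φ, hφ, hyφ, hφs⟩ := exists_openPartialHomeomorph_contDiffAt hf _ hf'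
  have hsy : A (c' (s y)) = φ (c y) := by
    rw [hφ]
    change _ = A (c' (s (c.symm (c y))))
    rw [extChartAt_to_inv]
  refine ⟨fun m => c.symm (φ.symm (A (c' m))), ?_, ?_⟩
  · have h1 : ContMDiffAt J' 𝓘(ℝ, E) ∞ (fun m => A (c' m)) (s y) :=
      A.contMDiff.contMDiffAt.comp (s y) contMDiffAt_extChartAt
    have h2 : ContMDiffAt J' 𝓘(ℝ, E) ∞ (fun m => φ.symm (A (c' m))) (s y) :=
      ContMDiffAt.comp (s y) (g := φ.symm)
        (hφs _ (hsy ▸ φ.map_source hyφ)).contMDiffAt h1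
    refine ContMDiffAt.comp (s y) (g := c.symm) ?_ h2
    rw [hsy, φ.left_inv hyφ]
    exact contMDiffAt_extChartAt_symm y
  · have h1 : Filter.Tendsto c (𝓝 y) (𝓝 (c y)) := continuousAt_extChartAt y
    filter_upwards [eventually_extChartAt_left_inv (J := J) y,
      h1.eventually (φ.open_source.mem_nhds hyφ)] with y' h2 h3
    have h4 : A (c' (s y')) = φ (c y') := by
      rw [hφ]
      change _ = A (c' (s (c.symm (c y'))))
      rw [h2]
    change c.symm (φ.symm (A (c' (s y')))) = y'
    rw [h4, φ.left_inv h3, h2]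

/-- Maps into an embedded submanifold which are smooth as maps into the ambient manifold are
smooth. -/
theorem contMDiff_of_comp_immersion {s : S → M} (hs : ContMDiff J J' ∞ s)
    (hi : ∀ y, Function.Injective (mfderiv J J' s y)) (he : IsInducing s) {σ : N → S}
    (h : ContMDiff J'' J' ∞ (s ∘ σ)) : ContMDiff J'' J ∞ σ := by
  intro z
  obtain ⟨r, hr, hr'⟩ := exists_contMDiffAt_leftInverse hs (hi (σ z))
  -- The topology of `S` is induced from `M`, so `σ` is continuous; this keeps `σ z'` in the domain
  -- where `r` inverts `s`.
  have hσ : Continuous σ := he.continuous_iff.2 h.continuous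
  refine (ContMDiffAt.comp z (g := r) (f := s ∘ σ) hr (h z)).congr_of_eventuallyEq ?_
  filter_upwards [hσ.continuousAt hr'] with z' hz'
  exact hz'.symm

end Immersion

/-! ### Smooth images and Hausdorff dimension -/

section Dimension

open Pfaff MeasureTheory

variable {E : Type*} [NormedAddCommGroup E] [NormedSpace ℝ E] [FiniteDimensional ℝ E]
  {H : Type*} [TopologicalSpace H] {J : ModelWithCorners ℝ E H} [J.Boundaryless]
  {N : Type*} [TopologicalSpace N] [ChartedSpace H N] [IsManifold J ∞ N]
  [SecondCountableTopology N]
  {E' : Type*} [NormedAddCommGroup E'] [NormedSpace ℝ E'] [FiniteDimensional ℝ E']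
  {H' : Type*} [TopologicalSpace H'] {J' : ModelWithCorners ℝ E' H'} [J'.Boundaryless]
  {S : Type*} [TopologicalSpace S] [ChartedSpace H' S] [IsManifold J' ∞ S]

/-- The image of a smooth map into a manifold of larger dimension has empty interior. -/
theorem finrank_le_of_range_mem_nhds {f : N → S} (hf : ContMDiff J J' ∞ f) {y : S}
    (hy : range f ∈ 𝓝 y) : Module.finrank ℝ E' ≤ Module.finrank ℝ E := by
  let c := extChartAt J' y
  let N' : Set N := f ⁻¹' (chartAt H' y).source
  have hN' : IsOpen N' := (chartAt H' y).open_source.preimage hf.continuous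
  -- A `C¹` map does not raise Hausdorff dimension, so locally the image has dimension at most that
  -- of `N`. By second countability the same holds for the whole image in the chart, whereas a
  -- neighbourhood in `E'` has dimension `finrank ℝ E'`.
  have hloc : ∀ z ∈ N', ∃ O ∈ 𝓝 z, dimH ((fun z => c (f z)) '' O) ≤ Module.finrank ℝ E := by
    intro z hz
    let g : E → E' := (fun z => c (f z)) ∘ (extChartAt J z).symm
    have h1 : ContMDiffAt J 𝓘(ℝ, E') ∞ (fun z => c (f z)) z :=
      (contMDiffAt_extChartAt' hz).comp z (hf z)
    have h2 : ContDiffAt ℝ ∞ g (extChartAt J z z) :=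
      contMDiffAt_iff_contDiffAt_comp_extChartAt_symm.1 h1
    obtain ⟨ε, hε, hB⟩ := Metric.eventually_nhds_iff_ball.1
      ((h2.of_le (m := 1) (by simp)).eventually (by simp))
    have h3 : ∀ᶠ z' in 𝓝 z, extChartAt J z z' ∈ Metric.ball (extChartAt J z z) ε :=
      (continuousAt_extChartAt z) (Metric.ball_mem_nhds _ hε)
    refine ⟨_, h3.and (eventually_extChartAt_left_inv (J := J) z), ?_⟩
    calc dimH _ ≤ dimH (g '' Metric.ball (extChartAt J z z) ε) := by
          refine dimH_mono ?_
          rintro _ ⟨z', hz', rfl⟩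
          exact ⟨_, hz'.1, congrArg (fun z => c (f z)) hz'.2⟩
      _ ≤ dimH (Metric.ball (extChartAt J z z) ε) :=
          ContDiffOn.dimH_image_le (fun p hp => (hB p hp).contDiffWithinAt)
            (convex_ball _ _) subset_rfl
      _ ≤ Module.finrank ℝ E :=
          (Real.dimH_of_mem_nhds (Metric.ball_mem_nhds _ hε)).le
  choose! O hO hO' using hloc
  obtain ⟨t, htN, ht, hcov⟩ := TopologicalSpace.countable_cover_nhdsWithin (f := O)
    (s := N') fun z hz => mem_nhdsWithin_of_mem_nhds (hO z hz)
  have h1 : (⋃ z ∈ t, (fun z => c (f z)) '' O z) ∈ 𝓝 (c y) := by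
    have h2 : ∀ᶠ y' in 𝓝 y, y' ∈ (chartAt H' y).source := chart_source_mem_nhds H' y
    filter_upwards [(tendsto_extChartAt_symm (J := J') y).eventually hy,
      (tendsto_extChartAt_symm (J := J') y).eventually h2,
      eventually_mem_extChartAt_target (J := J') y] with p h3 h4 h5
    obtain ⟨z, hz⟩ : ∃ z, f z = (extChartAt J' y).symm p := h3
    have hzN : z ∈ N' := by
      change f z ∈ (chartAt H' y).source
      rwa [hz]
    obtain ⟨z', hz', hzO⟩ := mem_iUnion₂.1 (hcov hzN)
    refine mem_iUnion₂.2 ⟨z', hz', z, hzO, ?_⟩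
    change c (f z) = p
    rw [hz]
    exact c.right_inv h5
  have h2 := Real.dimH_of_mem_nhds h1
  rw [dimH_bUnion ht] at h2
  have h3 : ((Module.finrank ℝ E' : ℕ) : ENNReal) ≤ (Module.finrank ℝ E : ℕ) := by
    rw [← h2]
    exact iSup₂_le fun z hz => hO' z (htN hz)
  exact_mod_cast h3

end Dimension

namespace Pfaff

/-! ### The leaf topology over an integral manifold of the reduction -/

section Leaves

variable {E : Type*} [NormedAddCommGroup E] [NormedSpace ℝ E]
  {H : Type*} [TopologicalSpace H] {J : ModelWithCorners ℝ E H}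
  {X : Type u} [TopologicalSpace X] [ChartedSpace H X]
  {E' : Type*} [NormedAddCommGroup E'] [NormedSpace ℝ E']
  {H' : Type*} [TopologicalSpace H'] {J' : ModelWithCorners ℝ E' H'}
  {M : Type*} [TopologicalSpace M] [ChartedSpace H' M]
  {E'' : Type*} [NormedAddCommGroup E''] [NormedSpace ℝ E'']
  {H'' : Type*} [TopologicalSpace H''] {J'' : ModelWithCorners ℝ E'' H''}
  {S : Type*} [TopologicalSpace S] [ChartedSpace H'' S]
  {F : Type*} [NormedAddCommGroup F] [NormedSpace ℝ F]
  {B : Type*} [TopologicalSpace B] {JN : ModelWithCorners ℝ F B}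
  {N : Type*} [TopologicalSpace N] [ChartedSpace B N]
  {K : CovectorField J X} {I : CovectorField J' M} {q : X → M} {s : S → M}

theorem IsIntegralManifold.mfderiv_mem_ann (hs : IsIntegralManifold J'' I s) (y : S)
    (v : TangentSpace J'' y) : mfderiv J'' J' s y v ∈ ann I (s y) :=
  fun α hα => DFunLike.congr_fun (hs.pull_eq_zero y α hα) v

theorem finrank_polarSpace_congr [IsManifold J' ∞ M] (I : CovectorField J' M) {x y : M} (h : x = y)
    (F : Submodule ℝ E') :
    Module.finrank ℝ (polarSpace I x (show Submodule ℝ (TangentSpace J' x) from F)) =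
      Module.finrank ℝ (polarSpace I y (show Submodule ℝ (TangentSpace J' y) from F)) := by
  subst h; rfl

/-- The points of `X` over the submanifold `s : S → M`, to be given the leaf topology. -/
def LeafSpace (q : X → M) (s : S → M) : Type u := {x : X // q x ∈ range s}

/-- The inclusion of the leaf space. -/
def LeafSpace.val (z : LeafSpace q s) : X := Subtype.val z

omit [TopologicalSpace X] [TopologicalSpace M] [TopologicalSpace S] in
theorem LeafSpace.val_injective : Function.Injective (LeafSpace.val : LeafSpace q s → X) :=
  Subtype.val_injective

/-- The projection of the leaf space. -/
def LeafSpace.proj (z : LeafSpace q s) : S := Classical.choose (Subtype.property z)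

omit [TopologicalSpace X] [TopologicalSpace M] [TopologicalSpace S] in
theorem LeafSpace.apply_proj (z : LeafSpace q s) : s z.proj = q z.val :=
  Classical.choose_spec (Subtype.property z)

variable (J'' K q s) in
/-- The horizontal local sections of the leaf space. -/
def horizontalSections : Set (Set S × (S → LeafSpace q s)) :=
  {u | IsOpen u.1 ∧ ∀ y ∈ u.1, (u.2 y).proj = y ∧
    ContMDiffAt J'' J ∞ (fun y => (u.2 y).val) y ∧
    ∀ v, mfderiv J'' J (fun y => (u.2 y).val) y v ∈ ann K (u.2 y).val}

variable [FiniteDimensional ℝ E] [FiniteDimensional ℝ E'] [FiniteDimensional ℝ E'']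
  [J.Boundaryless] [J'.Boundaryless] [J''.Boundaryless] [JN.Boundaryless]
  [IsManifold J ∞ X] [IsManifold J' ∞ M] [IsManifold J'' ∞ S] [IsManifold JN ∞ N]

omit [FiniteDimensional ℝ E''] in
-- Sections through each point come from the local existence of horizontal lifts, their agreement
-- from the uniqueness of horizontal maps with a given projection.
theorem IsTransversalReduction.isSectionFamily (h : IsTransversalReduction K I q)
    (hs : IsIntegralManifold J'' I s) (hinj : Function.Injective s) :
    IsSectionFamily LeafSpace.proj (horizontalSections J'' K q s) where
  isOpen u hu := hu.1
  proj u hu y hy := (hu.2 y hy).1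
  exists_mem z := by
    classical
    obtain ⟨u, hu, hu'⟩ := h.exists_horizontal_lift hs (y₀ := z.proj) (z₀ := z.val)
      z.apply_proj.symm
    obtain ⟨U, hUu, hU, hzU⟩ := eventually_nhds_iff.1 hu'
    -- The lift `u` lies over `S` only near the base point; elsewhere `z` serves as an irrelevant
    -- value.
    let w : S → LeafSpace q s := fun y => if hy : q (u y) ∈ range s then ⟨u y, hy⟩ else z
    have hw : ∀ y ∈ U, (w y).val = u y := by
      intro y hy
      have h1 : q (u y) ∈ range s := ⟨y, (hUu y hy).2.1.symm⟩
      have h2 : w y = ⟨u y, h1⟩ := dif_pos h1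
      rw [h2]
      rfl
    refine ⟨(U, w), ⟨hU, fun y hy => ?_⟩, hzU, LeafSpace.val_injective ((hw _ hzU).trans hu)⟩
    obtain ⟨h1, h2, h3⟩ := hUu y hy
    have h4 : (fun y => (w y).val) =ᶠ[𝓝 y] u := by
      filter_upwards [hU.mem_nhds hy] with y' hy' using hw y' hy'
    refine ⟨hinj ?_, h1.congr_of_eventuallyEq h4, fun v => ?_⟩
    · refine (w y).apply_proj.trans ?_
      rw [hw y hy, h2]
    · rw [h4.mfderiv_eq]
      exact (mem_ann_congr K (hw y hy) _).2 (h3 v)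
  eventuallyEq u hu v hv y hy hy' he := by
    have hU := hu.1.mem_nhds hy
    have hV := hv.1.mem_nhds hy'
    have h1 := h.eventuallyEq (hu.2 y hy).2.1 (hv.2 y hy').2.1 (congrArg LeafSpace.val he) ?_ ?_ ?_
    · exact h1.mono fun y' h2 => LeafSpace.val_injective h2
    · filter_upwards [hU, hV] with y' h1 h2
      rw [← (u.2 y').apply_proj, ← (v.2 y').apply_proj, (hu.2 y' h1).1, (hv.2 y' h2).1]
    · filter_upwards [hU] with y' h1 using (hu.2 y' h1).2.2
    · filter_upwards [hV] with y' h1 using (hv.2 y' h1).2.2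

omit [FiniteDimensional ℝ E] [J.Boundaryless] [J'.Boundaryless] [JN.Boundaryless]
  [IsManifold JN ∞ N] in
/-- Integral manifolds of `K` over the integral manifold `s` of the reduction project to immersed
submanifolds of `S`. -/
theorem IsTransversalReduction.exists_projection (h : IsTransversalReduction K I q)
    (hs : IsIntegralManifold J'' I s) (he : IsInducing s) {i : N → X}
    (hi : IsIntegralManifold JN K i) (hiP : range i ⊆ q ⁻¹' range s) :
    ∃ σ : N → S, ContMDiff JN J'' ∞ σ ∧ s ∘ σ = q ∘ i ∧
      ∀ z, Function.Injective (mfderiv JN J'' σ z) := by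
  choose σ hσ using fun z : N => hiP ⟨z, rfl⟩
  have h1 : s ∘ σ = q ∘ i := funext hσ
  have hqi : ContMDiff JN J' ∞ (q ∘ i) := h.smooth.comp hi.smooth
  have hσs : ContMDiff JN J'' ∞ σ :=
    contMDiff_of_comp_immersion hs.smooth hs.immersion he (h1 ▸ hqi)
  refine ⟨σ, hσs, h1, fun z => ?_⟩
  have h2 : mfderiv JN J' (s ∘ σ) z = (mfderiv J'' J' s (σ z)).comp (mfderiv JN J'' σ z) :=
    mfderiv_comp z ((hs.smooth _).mdifferentiableAt (by simp))
      ((hσs z).mdifferentiableAt (by simp))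
  have h3 : mfderiv JN J' (q ∘ i) z = (mfderiv J J' q (i z)).comp (mfderiv JN J i z) :=
    mfderiv_comp z ((h.smooth _).mdifferentiableAt (by simp))
      ((hi.smooth z).mdifferentiableAt (by simp))
  rw [h1] at h2
  have h4 : ∀ v : F, mfderiv J J' q (i z) (mfderiv JN J i z v) =
      mfderiv J'' J' s (σ z) (mfderiv JN J'' σ z v) := fun v =>
    DFunLike.congr_fun (h3.symm.trans h2) v
  rw [← ContinuousLinearMap.coe_coe, ← LinearMap.ker_eq_bot, LinearMap.ker_eq_bot']
  intro v hv
  have h5 : mfderiv J J' q (i z) (mfderiv JN J i z v) = 0 := by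
    have h6 : mfderiv JN J'' σ z v = 0 := hv
    exact (h4 v).trans ((congrArg _ h6).trans (map_zero _))
  have h7 := h.eq_zero (hi.mfderiv_mem_ann z v) h5
  exact hi.immersion z (h7.trans (map_zero _).symm)

/-- Integral manifolds of `K` over `S` are continuous for the leaf topology. -/
theorem IsTransversalReduction.continuous_leafSpace (h : IsTransversalReduction K I q)
    (hs : IsIntegralManifold J'' I s) (he : IsEmbedding s) {i : N → LeafSpace q s}
    (hi : IsIntegralManifold JN K fun z => (i z).val) :
    @Continuous N (LeafSpace q s) _ (sectionTopology (horizontalSections J'' K q s)) i := by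
  let : TopologicalSpace (LeafSpace q s) := sectionTopology (horizontalSections J'' K q s)
  have hF := h.isSectionFamily hs he.injective
  obtain ⟨σ, hσ, hσi, -⟩ := h.exists_projection hs he.isInducing hi (by
    rintro _ ⟨z, rfl⟩; exact Subtype.property (i z))
  have hproj : ∀ z, (i z).proj = σ z := fun z => he.injective
    ((i z).apply_proj.trans (congrFun hσi z).symm)
  refine continuous_iff_continuousAt.2 fun z => ?_
  obtain ⟨u, hu, hzu, huz⟩ := hF.exists_mem (i z)
  rw [hproj] at hzu huz
  have hσu : ∀ᶠ z' in 𝓝 z, σ z' ∈ u.1 := (hσ z).continuousAt ((hF.isOpen u hu).mem_nhds hzu)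
  have hsm : ∀ᶠ z' in 𝓝 z, ContMDiffAt J'' J ∞ (fun y => (u.2 y).val) (σ z') :=
    hσu.mono fun z' hz' => (hu.2 _ hz').2.1
  -- The maps `u ∘ σ` and `i` are both horizontal, have the same projection, and agree at `z`.
  have h1 : (fun z' => (u.2 (σ z')).val) =ᶠ[𝓝 z] fun z' => (i z').val := by
    refine h.eventuallyEq (hsm.self_of_nhds.comp z (hσ z)) (hi.smooth z)
      (congrArg LeafSpace.val huz) ?_ ?_ (Filter.Eventually.of_forall hi.mfderiv_mem_ann)
    · filter_upwards [hσu] with z' h1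
      rw [← (u.2 (σ z')).apply_proj, ← (i z').apply_proj, hproj, (hu.2 _ h1).1]
    · filter_upwards [hσu, hsm] with z' h1 h2 v
      have h3 : mfderiv JN J (fun z' => (u.2 (σ z')).val) z' =
          (mfderiv J'' J (fun y => (u.2 y).val) (σ z')).comp (mfderiv JN J'' σ z') :=
        mfderiv_comp z' (h2.mdifferentiableAt (by simp)) ((hσ z').mdifferentiableAt (by simp))
      rw [h3]
      exact (hu.2 _ h1).2.2 _
  have h2 : ContinuousAt (fun z' => u.2 (σ z')) z :=
    ContinuousAt.comp (g := u.2) (continuousAt_sectionTopology hu hzu) (hσ z).continuousAt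
  exact h2.congr (h1.mono fun z' hz' => LeafSpace.val_injective hz')

end Leaves

/-! ### The maximal integral manifold, its dimension and its polar spaces -/

section Maximal

variable {E : Type*} [NormedAddCommGroup E] [NormedSpace ℝ E] [FiniteDimensional ℝ E]
  {H : Type*} [TopologicalSpace H] {J : ModelWithCorners ℝ E H} [J.Boundaryless]
  {X : Type u} [TopologicalSpace X] [ChartedSpace H X] [IsManifold J ∞ X]
  {E' : Type*} [NormedAddCommGroup E'] [NormedSpace ℝ E'] [FiniteDimensional ℝ E']
  {H' : Type*} [TopologicalSpace H'] {J' : ModelWithCorners ℝ E' H'} [J'.Boundaryless]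
  {M : Type*} [TopologicalSpace M] [ChartedSpace H' M] [IsManifold J' ∞ M]
  {d : ℕ} {S : Type*} [TopologicalSpace S] [ChartedSpace (EuclideanSpace ℝ (Fin d)) S]
  [IsManifold (𝓡 d) ∞ S]
  {K : CovectorField J X} {I : CovectorField J' M} {q : X → M} {s : S → M}

/-- There is a maximal integral manifold of `K` over the integral manifold `s` of the reduction
through each point; it has the dimension of `S` and projects onto a neighbourhood. -/
theorem IsTransversalReduction.exists_isMaximalIntegralManifold [T2Space X]
    [SecondCountableTopology S] (h : IsTransversalReduction K I q)
    (hs : IsIntegralManifold (𝓡 d) I s) (he : IsEmbedding s) {p : X} (hp : q p ∈ range s) :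
    ∃ (L : Type u) (_ : TopologicalSpace L) (_ : ChartedSpace (EuclideanSpace ℝ (Fin d)) L)
      (j : L → X), IsMaximalIntegralManifold d K (q ⁻¹' range s) p j ∧
      ∃ y, ∀ᶠ y' in 𝓝 y, ∃ z, q (j z) = s y' := by
  have hF := h.isSectionFamily hs he.injective
  let : TopologicalSpace (LeafSpace q s) := sectionTopology (horizontalSections (𝓡 d) K q s)
  have hπ₀ : IsLocalHomeomorph (LeafSpace.proj : LeafSpace q s → S) := hF.isLocalHomeomorph
  have hval : Continuous (LeafSpace.val : LeafSpace q s → X) :=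
    continuous_of_sectionTopology fun u hu y hy => (hu.2 y hy).2.1.continuousAt
  -- The leaf topology is finer than the one induced from the Hausdorff space `X`.
  have : T2Space (LeafSpace q s) := T2Space.of_injective_continuous LeafSpace.val_injective hval
  have : LocallyConnectedSpace S :=
    ChartedSpace.locallyConnectedSpace (EuclideanSpace ℝ (Fin d)) S
  have : LocallyConnectedSpace (LeafSpace q s) := by
    let := hπ₀.pullbackChartedSpace (H := EuclideanSpace ℝ (Fin d))
    exact ChartedSpace.locallyConnectedSpace (EuclideanSpace ℝ (Fin d)) (LeafSpace q s)
  let p₀ : LeafSpace q s := ⟨p, hp⟩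
  -- The leaf space is locally connected, being spread over `S`, so its components are open and
  -- inherit the local homeomorphism to `S`.
  let L := connectedComponent p₀
  have hL : IsOpen L := isOpen_connectedComponent
  let π : L → S := fun z => z.1.proj
  let j : L → X := fun z => z.1.val
  have hπ : IsLocalHomeomorph π := hπ₀.comp hL.isOpenEmbedding_subtypeVal.isLocalHomeomorph
  have hconn : ConnectedSpace L := isConnected_iff_connectedSpace.1 isConnected_connectedComponent
  have hsπ : s ∘ π = q ∘ j := funext fun z => z.1.apply_proj
  let : ChartedSpace (EuclideanSpace ℝ (Fin d)) L := hπ.pullbackChartedSpace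
  have hπs : ContMDiff (𝓡 d) (𝓡 d) ∞ π := hπ.contMDiff_pullback
  have hloc : ∀ z : L, ∃ u ∈ horizontalSections (𝓡 d) K q s, π z ∈ u.1 ∧
      j =ᶠ[𝓝 z] (fun y => (u.2 y).val) ∘ π := by
    intro z
    obtain ⟨u, hu, hzu, huz⟩ := hF.exists_mem z.1
    refine ⟨u, hu, hzu, ?_⟩
    have h1 : ∀ᶠ z' : L in 𝓝 z, z'.1 ∈ u.2 '' u.1 :=
      continuous_subtype_val.continuousAt ((hF.isOpen_image hu).mem_nhds ⟨_, hzu, huz⟩)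
    filter_upwards [h1] with z' hz'
    obtain ⟨y, hy, hyz⟩ := hz'
    have h2 : π z' = y := by
      change z'.1.proj = y
      rw [← hyz, (hu.2 y hy).1]
    change z'.1.val = (u.2 (π z')).val
    rw [h2, hyz]
  have hjs : ContMDiff (𝓡 d) J ∞ j := by
    intro z
    obtain ⟨u, hu, hzu, hz⟩ := hloc z
    exact ((hu.2 _ hzu).2.1.comp z (hπs z)).congr_of_eventuallyEq hz
  have hj : IsIntegralManifold (𝓡 d) K j := by
    refine ⟨hjs, fun z => ?_, fun z α hα => ?_⟩
    · have h1 : mfderiv (𝓡 d) J' (s ∘ π) z =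
          (mfderiv (𝓡 d) J' s (π z)).comp (mfderiv (𝓡 d) (𝓡 d) π z) :=
        mfderiv_comp z ((hs.smooth _).mdifferentiableAt (by simp))
          ((hπs z).mdifferentiableAt (by simp))
      have h2 : mfderiv (𝓡 d) J' (q ∘ j) z = (mfderiv J J' q (j z)).comp (mfderiv (𝓡 d) J j z) :=
        mfderiv_comp z ((h.smooth _).mdifferentiableAt (by simp))
          ((hjs z).mdifferentiableAt (by simp))
      rw [hsπ, hπ.mfderiv_pullback] at h1
      have h3 : ∀ v : EuclideanSpace ℝ (Fin d), mfderiv J J' q (j z) (mfderiv (𝓡 d) J j z v) =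
          mfderiv (𝓡 d) J' s (π z) v := fun v => DFunLike.congr_fun (h2.symm.trans h1) v
      intro v w hvw
      refine hs.immersion (π z) ?_
      refine (h3 v).symm.trans (Eq.trans ?_ (h3 w))
      rw [hvw]
    · obtain ⟨u, hu, hzu, hz⟩ := hloc z
      have h1 : mfderiv (𝓡 d) J j z = (mfderiv (𝓡 d) J (fun y => (u.2 y).val) (π z)).comp
          (mfderiv (𝓡 d) (𝓡 d) π z) := hz.mfderiv_eq.trans
        (mfderiv_comp z ((hu.2 _ hzu).2.1.mdifferentiableAt (by simp))
          ((hπs z).mdifferentiableAt (by simp)))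
      ext v
      have h2 := (hu.2 _ hzu).2.2 (mfderiv (𝓡 d) (𝓡 d) π z v)
      have h3 := (mem_ann_congr K hz.self_of_nhds.symm _).1 h2
      have h4 := DFunLike.congr_fun h1 v
      refine Eq.trans ?_ (h3 α hα)
      exact congrArg α h4
  refine ⟨L, inferInstance, inferInstance, j, ?_, ?_⟩
  · refine { isManifold := hπ.isManifold_pullback, t2Space := inferInstance,
             secondCountable := hπ.secondCountableTopology, connected := hconn,
             injective := LeafSpace.val_injective.comp Subtype.val_injective, integral := hj,
             subset := ?_, mem := ⟨⟨p₀, mem_connectedComponent⟩, rfl⟩, maximal := ?_ }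
    · rintro _ ⟨z, rfl⟩
      exact Subtype.property z.1
    · intro k N _ _ _ _ _ _ i hi hiP ⟨n, hn⟩
      let i' : N → LeafSpace q s := fun n => ⟨i n, hiP ⟨n, rfl⟩⟩
      have hi' : Continuous i' := h.continuous_leafSpace (JN := 𝓡 k) hs he hi
      -- Since `i'` is continuous for the leaf topology, its image is a connected set through `p₀`
      -- and lies in the component.
      have h1 : range i' ⊆ L := (isPreconnected_range hi').subset_connectedComponent
        ⟨n, LeafSpace.val_injective hn⟩
      rintro _ ⟨n, rfl⟩
      exact ⟨⟨i' n, h1 ⟨n, rfl⟩⟩, rfl⟩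
  · refine ⟨π ⟨p₀, mem_connectedComponent⟩, ?_⟩
    filter_upwards [hπ.isOpenMap.range_mem_nhds ⟨p₀, mem_connectedComponent⟩] with y' hy'
    obtain ⟨z, rfl⟩ := hy'
    exact ⟨z, (congrFun hsπ z).symm⟩

/-- The maximal integral manifolds of `K` over `S` have the dimension of `S`. -/
theorem IsTransversalReduction.dim_eq [T2Space X] [SecondCountableTopology S]
    (h : IsTransversalReduction K I q) (hs : IsIntegralManifold (𝓡 d) I s) (he : IsEmbedding s)
    {p : X} {k : ℕ} {L : Type u} [TopologicalSpace L] [ChartedSpace (EuclideanSpace ℝ (Fin k)) L]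
    {j : L → X} (hj : IsMaximalIntegralManifold k K (q ⁻¹' range s) p j) : k = d := by
  obtain ⟨z, hz⟩ := hj.mem
  obtain ⟨L', _, _, j', hj', y, hy⟩ := h.exists_isMaximalIntegralManifold hs he
    (hj.subset ⟨z, hz⟩)
  have := hj.isManifold
  have := hj.secondCountable
  have := hj'.isManifold
  have := hj'.secondCountable
  have := hj'.t2Space
  have := hj'.connected
  obtain ⟨σ, hσ, hσj, hσi⟩ := h.exists_projection hs he.isInducing hj.integral hj.subset
  refine le_antisymm ?_ ?_
  -- Upper bound: the projection to `S` is an immersion.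
  · have h1 := LinearMap.finrank_le_finrank_of_injective (R := ℝ)
      (M := EuclideanSpace ℝ (Fin k)) (M' := EuclideanSpace ℝ (Fin d))
      (f := (mfderiv (𝓡 k) (𝓡 d) σ z).toLinearMap) (hσi z)
    rwa [finrank_euclideanSpace_fin, finrank_euclideanSpace_fin] at h1
  -- Lower bound: by maximality the given manifold contains the leaf `L'`, whose projection contains
  -- a neighbourhood in `S`.
  · have h1 := finrank_le_of_range_mem_nhds hσ (y := y) (by
      filter_upwards [hy] with y' hy'
      obtain ⟨z', hz'⟩ := hy'
      obtain ⟨w, hw⟩ := hj.maximal d L' j' hj'.integral hj'.subset hj'.mem ⟨z', rfl⟩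
      refine ⟨w, he.injective ?_⟩
      rw [← hz', ← hw]
      exact congrFun hσj w)
    rwa [finrank_euclideanSpace_fin, finrank_euclideanSpace_fin] at h1

/-- Integral manifolds of `K` over a non-characteristic integral manifold of the reduction of the
same dimension are non-characteristic. -/
theorem IsTransversalReduction.isNonCharacteristic (h : IsTransversalReduction K I q)
    (hs : IsIntegralManifold (𝓡 d) I s) (he : IsEmbedding s) (hnc : IsNonCharacteristic (𝓡 d) I s)
    {L : Type*} [TopologicalSpace L] [ChartedSpace (EuclideanSpace ℝ (Fin d)) L]
    {j : L → X} (hj : IsIntegralManifold (𝓡 d) K j) (hjP : range j ⊆ q ⁻¹' range s) :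
    IsNonCharacteristic (𝓡 d) K j := by
  intro z
  obtain ⟨σ, hσ, hσj, hσi⟩ := h.exists_projection hs he.isInducing hj hjP
  let A : EuclideanSpace ℝ (Fin d) →L[ℝ] E := mfderiv (𝓡 d) J j z
  let Q : E →L[ℝ] E' := mfderiv J J' q (j z)
  let D : EuclideanSpace ℝ (Fin d) →L[ℝ] E' := mfderiv (𝓡 d) J' s (σ z)
  let T : EuclideanSpace ℝ (Fin d) →L[ℝ] EuclideanSpace ℝ (Fin d) := mfderiv (𝓡 d) (𝓡 d) σ z
  have hqs : q (j z) = s (σ z) := (congrFun hσj z).symm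
  have h1 : mfderiv (𝓡 d) J' (s ∘ σ) z = D.comp T :=
    mfderiv_comp z ((hs.smooth _).mdifferentiableAt (by simp))
      ((hσ z).mdifferentiableAt (by simp))
  have h2 : mfderiv (𝓡 d) J' (q ∘ j) z = Q.comp A :=
    mfderiv_comp z ((h.smooth _).mdifferentiableAt (by simp))
      ((hj.smooth z).mdifferentiableAt (by simp))
  rw [hσj] at h1
  have h3 : Q.comp A = D.comp T := h2.symm.trans h1
  -- An injective map between spaces of the same dimension. Thus `q_*` takes the tangent space of
  -- `L` onto that of `S`, and the polar spaces of the two have equal dimension.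
  have hT : Function.Surjective T := by
    have h4 : Function.Injective T.toLinearMap := hσi z
    exact LinearMap.injective_iff_surjective.1 h4
  have hmap : (LinearMap.range A.toLinearMap).map Q.toLinearMap = LinearMap.range D.toLinearMap := by
    ext w
    constructor
    · rintro ⟨_, ⟨v, rfl⟩, rfl⟩
      exact ⟨T v, (DFunLike.congr_fun h3 v).symm⟩
    · rintro ⟨v, rfl⟩
      obtain ⟨v, rfl⟩ := hT v
      exact ⟨_, ⟨v, rfl⟩, DFunLike.congr_fun h3 v⟩
  have hF : LinearMap.range (mfderiv (𝓡 d) J j z).toLinearMap ≤ ann K (j z) := by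
    rintro _ ⟨v, rfl⟩
    exact hj.mfderiv_mem_ann z v
  have hr1 : Module.finrank ℝ (LinearMap.range (mfderiv (𝓡 d) J j z).toLinearMap) = d := by
    rw [LinearMap.finrank_range_of_inj (hj.immersion z)]
    exact finrank_euclideanSpace_fin
  have hr2 : Module.finrank ℝ (LinearMap.range (mfderiv (𝓡 d) J' s (σ z)).toLinearMap) = d := by
    rw [LinearMap.finrank_range_of_inj (hs.immersion (σ z))]
    exact finrank_euclideanSpace_fin
  have h4 := hnc (σ z)
  rw [hr2] at h4
  rw [h.finrank_polarSpace hF, hr1, ← h4]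
  refine Eq.trans ?_ (finrank_polarSpace_congr I hqs (LinearMap.range D.toLinearMap))
  exact congrArg (fun F : Submodule ℝ E' => Module.finrank ℝ
    (polarSpace I (q (j z)) (show Submodule ℝ (TangentSpace J' (q (j z))) from F))) hmap

end Maximal

end Pfaff

namespace Pfaff

/-! ### Pullbacks of systems and their sections -/

section Pullback

variable {E : Type*} [NormedAddCommGroup E] [NormedSpace ℝ E]
  {H : Type*} [TopologicalSpace H] {J : ModelWithCorners ℝ E H} [J.Boundaryless]
  {X : Type*} [TopologicalSpace X] [ChartedSpace H X] [IsManifold J ∞ X]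
  {E' : Type*} [NormedAddCommGroup E'] [NormedSpace ℝ E']
  {H' : Type*} [TopologicalSpace H'] {J' : ModelWithCorners ℝ E' H'} [J'.Boundaryless]
  {M : Type*} [TopologicalSpace M] [ChartedSpace H' M] [IsManifold J' ∞ M]
  {K : CovectorField J X} {I : CovectorField J' M} {f : X → M}

theorem SmoothFormOn.pullForm {θ : OneForm J' M} {U : Set M} (hθ : SmoothFormOn J' θ U)
    (hU : IsOpen U) (hf : ContMDiff J J' ∞ f) : SmoothFormOn J (pullForm J J' f θ) (f ⁻¹' U) :=
  (smoothFormOn_iff (hU.preimage hf.continuous)).2 fun x hx =>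
    contDiffAt_chartForm_pullForm (hf x) ((smoothFormOn_iff hU).1 hθ _ hx)

/-- If `f^* I ⊆ K`, then `f^* I' ⊆ K'`. -/
theorem map_derived_le (hf : ContMDiff J J' ∞ f)
    (hIK : ∀ x, (I (f x)).map (pullCov J J' f x) ≤ K x) (x : X) :
    (derived I (f x)).map (pullCov J J' f x) ≤ derived K x := by
  refine (Submodule.map_span_le _ _ _).2 ?_
  rintro _ ⟨U, θ, hU, hxU, hθ, hd, rfl⟩
  refine Submodule.subset_span ⟨f ⁻¹' U, pullForm J J' f θ, hU.preimage hf.continuous, hxU,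
    ⟨hθ.1.pullForm hU hf, fun y hy => hIK y ⟨_, hθ.2 _ hy, rfl⟩⟩, fun y hy v hv w hw => ?_, rfl⟩
  have hann : ∀ v ∈ ann K y, mfderiv J J' f y v ∈ ann I (f y) :=
    fun v hv α hα => hv _ (hIK y ⟨α, hα, rfl⟩)
  rw [dForm_pullForm (hf y) (hθ.contDiffAt_chartForm hU hy)]
  exact hd _ hy _ (hann v hv) _ (hann w hw)

/-- A system with smooth local frames is spanned by its local sections. -/
theorem exists_isSectionOn_of_span {r : ℕ} {U : Set M} (hU : IsOpen U) {θ : Fin r → OneForm J' M}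
    (hθ : ∀ i, SmoothFormOn J' (θ i) U)
    (hI : ∀ y ∈ U, I y = Submodule.span ℝ (range fun i => θ i y)) {x : M} (hx : x ∈ U)
    {α : TangentSpace J' x →L[ℝ] ℝ} (hα : α ∈ I x) :
    ∃ φ : OneForm J' M, IsSectionOn I φ U ∧ φ x = α := by
  rw [hI x hx] at hα
  refine Submodule.span_induction (p := fun α _ => ∃ φ : OneForm J' M, IsSectionOn I φ U ∧ φ x = α)
    ?_ ?_ ?_ ?_ hα
  · rintro _ ⟨i, rfl⟩
    refine ⟨θ i, ⟨hθ i, fun y hy => ?_⟩, rfl⟩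
    rw [hI y hy]
    exact Submodule.subset_span ⟨i, rfl⟩
  · exact ⟨_, isSectionOn_zero I hU, rfl⟩
  · rintro _ _ - - ⟨φ, hφ, rfl⟩ ⟨φ', hφ', rfl⟩
    have h1 := hφ.add hU hφ' hU
    rw [inter_self] at h1
    exact ⟨_, h1, rfl⟩
  · rintro c _ - ⟨φ, hφ, rfl⟩
    exact ⟨_, hφ.smul hU c, rfl⟩

end Pullback

/-! ### The sum system on a product -/

section Product

variable {E : Type*} [NormedAddCommGroup E] [NormedSpace ℝ E]
  {H : Type*} [TopologicalSpace H] {J : ModelWithCorners ℝ E H} [J.Boundaryless]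
  {M : Type*} [TopologicalSpace M] [ChartedSpace H M] [IsManifold J ∞ M]
  {E' : Type*} [NormedAddCommGroup E'] [NormedSpace ℝ E']
  {H' : Type*} [TopologicalSpace H'] {J' : ModelWithCorners ℝ E' H'} [J'.Boundaryless]
  {M' : Type*} [TopologicalSpace M'] [ChartedSpace H' M'] [IsManifold J' ∞ M']
  {K₁ : CovectorField J M} {K₂ : CovectorField J' M'}

/-- The inclusion reverses on annihilators, so transversality to `K₁' + K₂'` implies transversality
to `(K₁ + K₂)'`. -/
theorem sumSystem_derived_le (p : M × M') :
    sumSystem J' (derived K₁) (derived K₂) p ≤ derived (sumSystem J' K₁ K₂) p :=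
  sup_le (map_derived_le contMDiff_fst (fun _ => le_sup_left) p)
    (map_derived_le contMDiff_snd (fun _ => le_sup_right) p)

omit [J.Boundaryless] [J'.Boundaryless] [IsManifold J ∞ M] [IsManifold J' ∞ M'] in
theorem pullCov_fst_apply (p : M × M') (α : TangentSpace J p.1 →L[ℝ] ℝ) (v : E × E') :
    pullCov (J.prod J') J (Prod.fst : M × M' → M) p α v = α v.1 := by
  change α (mfderiv (J.prod J') J (Prod.fst : M × M' → M) p v) = _
  rw [mfderiv_fst]
  rfl

omit [J.Boundaryless] [J'.Boundaryless] [IsManifold J ∞ M] [IsManifold J' ∞ M'] in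
theorem pullCov_snd_apply (p : M × M') (α : TangentSpace J' p.2 →L[ℝ] ℝ) (v : E × E') :
    pullCov (J.prod J') J' (Prod.snd : M × M' → M') p α v = α v.2 := by
  change α (mfderiv (J.prod J') J' (Prod.snd : M × M' → M') p v) = _
  rw [mfderiv_snd]
  rfl

theorem IsPfaffian.sumSystem (h₁ : IsPfaffian K₁) (h₂ : IsPfaffian K₂) :
    IsPfaffian (sumSystem J' K₁ K₂) := by
  obtain ⟨r₁, h₁⟩ := h₁
  obtain ⟨r₂, h₂⟩ := h₂
  refine ⟨r₁ + r₂, fun p => ?_⟩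
  obtain ⟨U, hU, hxU, θ, hθ, hUK⟩ := h₁ p.1
  obtain ⟨V, hV, hxV, η, hη, hVK⟩ := h₂ p.2
  let ζ : Fin r₁ ⊕ Fin r₂ → OneForm (J.prod J') (M × M') := Sum.elim
    (fun i => pullForm (J.prod J') J Prod.fst (θ i))
    (fun i => pullForm (J.prod J') J' Prod.snd (η i))
  have hζs : ∀ i, SmoothFormOn (J.prod J') (ζ i) (U ×ˢ V) := by
    rintro (i | i)
    · have h1 : SmoothFormOn (J.prod J')
          (pullForm (J.prod J') J (Prod.fst : M × M' → M) (θ i)) (Prod.fst ⁻¹' U) :=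
        (hθ i).pullForm hU contMDiff_fst
      exact ContMDiffOn.mono h1 fun y hy => hy.1
    · have h1 : SmoothFormOn (J.prod J')
          (pullForm (J.prod J') J' (Prod.snd : M × M' → M') (η i)) (Prod.snd ⁻¹' V) :=
        (hη i).pullForm hV contMDiff_snd
      exact ContMDiffOn.mono h1 fun y hy => hy.2
  refine ⟨U ×ˢ V, hU.prod hV, ⟨hxU, hxV⟩, fun i => ζ (finSumFinEquiv.symm i), fun i => ?_,
    fun y hy => ?_⟩
  · exact hζs _
  · have hζ : (fun i => ζ i y) = Sum.elim
        (fun i => pullCov (J.prod J') J (Prod.fst : M × M' → M) y (θ i y.1))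
        (fun i => pullCov (J.prod J') J' (Prod.snd : M × M' → M') y (η i y.2)) := by
      funext i
      rcases i with i | i <;> rfl
    have hinj₁ : Function.Injective (pullCov (J.prod J') J (Prod.fst : M × M' → M) y) := by
      intro α β h
      ext v
      have h1 := DFunLike.congr_fun h ((v, 0) : E × E')
      exact (pullCov_fst_apply y α (v, 0)).symm.trans (h1.trans (pullCov_fst_apply y β (v, 0)))
    have hinj₂ : Function.Injective (pullCov (J.prod J') J' (Prod.snd : M × M' → M') y) := by
      intro α β h
      ext v
      have h1 := DFunLike.congr_fun h ((0, v) : E × E')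
      exact (pullCov_snd_apply y α (0, v)).symm.trans (h1.trans (pullCov_snd_apply y β (0, v)))
    -- A covector that comes from both factors vanishes on vectors tangent to either of them. Hence
    -- frames of the two systems remain independent together.
    have hdisj : Disjoint
        (LinearMap.range (pullCov (J.prod J') J (Prod.fst : M × M' → M) y))
        (LinearMap.range (pullCov (J.prod J') J' (Prod.snd : M × M' → M') y)) := by
      rw [Submodule.disjoint_def]
      rintro _ ⟨α, rfl⟩ ⟨β, hβ⟩
      have h1 : α = 0 := DFunLike.ext _ _ fun v => by
        have h2 := DFunLike.congr_fun hβ ((v, 0) : E × E')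
        exact (pullCov_fst_apply y α (v, 0)).symm.trans
          (h2.symm.trans ((pullCov_snd_apply (E := E) (J := J) y β (v, 0)).trans
            (ContinuousLinearMap.map_zero (show E' →L[ℝ] ℝ from β))))
      rw [h1, map_zero]
    constructor
    · have h1 : LinearIndependent ℝ fun i => ζ i y := by
        rw [hζ]
        refine LinearIndependent.sum_type
          ((hUK _ hy.1).1.map' _ (LinearMap.ker_eq_bot.2 hinj₁))
          ((hVK _ hy.2).1.map' _ (LinearMap.ker_eq_bot.2 hinj₂)) (hdisj.mono ?_ ?_)
        · rw [Submodule.span_le]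
          rintro _ ⟨i, rfl⟩
          exact ⟨_, rfl⟩
        · rw [Submodule.span_le]
          rintro _ ⟨i, rfl⟩
          exact ⟨_, rfl⟩
      exact h1.comp _ finSumFinEquiv.symm.injective
    · have h1 : (range fun i => ζ (finSumFinEquiv.symm i) y) = range fun i => ζ i y :=
        finSumFinEquiv.symm.surjective.range_comp fun i => ζ i y
      rw [h1, hζ, Sum.elim_range, Submodule.span_union, Pfaff.sumSystem, (hUK _ hy.1).2,
        (hVK _ hy.2).2, Submodule.map_span, Submodule.map_span, ← range_comp, ← range_comp]
      rfl

end Product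

end Pfaff

/-! ### The maximal integral manifold in a quotient representation -/

theorem lemma5p5
    {g m₁ m₂ m l₁ l₂ n₁ p₁ n₂ p₂ : ℕ}
    {G : Type*} [TopologicalSpace G] [ChartedSpace (EuclideanSpace ℝ (Fin g)) G] [Group G]
    [LieGroup (𝓡 g) ∞ G]
    {M₁ : Type u₁} [TopologicalSpace M₁] [ChartedSpace (EuclideanSpace ℝ (Fin m₁)) M₁]
    [IsManifold (𝓡 m₁) ∞ M₁] [T2Space M₁] [SecondCountableTopology M₁]
    {M₂ : Type u₂} [TopologicalSpace M₂] [ChartedSpace (EuclideanSpace ℝ (Fin m₂)) M₂]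
    [IsManifold (𝓡 m₂) ∞ M₂] [T2Space M₂] [SecondCountableTopology M₂]
    {M : Type*} [TopologicalSpace M] [ChartedSpace (EuclideanSpace ℝ (Fin m)) M]
    [IsManifold (𝓡 m) ∞ M] [T2Space M] [SecondCountableTopology M]
    {Q₁ : Type*} [TopologicalSpace Q₁] [ChartedSpace (EuclideanSpace ℝ (Fin l₁)) Q₁]
    [IsManifold (𝓡 l₁) ∞ Q₁] [T2Space Q₁]
    {Q₂ : Type*} [TopologicalSpace Q₂] [ChartedSpace (EuclideanSpace ℝ (Fin l₂)) Q₂]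
    [IsManifold (𝓡 l₂) ∞ Q₂] [T2Space Q₂]
    -- the decomposable Darboux integrable system `I` with its singular systems `V` and `W`
    (I V W : Pfaff.CovectorField (𝓡 m) M)
    (hI : Pfaff.IsDecomposable I V W n₁ p₁ n₂ p₂) (hDI : Pfaff.IsDarbouxIntegrable I V W)
    -- its canonical quotient representation
    (a₁ : Pfaff.LocalAction (𝓡 g) G (𝓡 m₁) M₁) (a₂ : Pfaff.LocalAction (𝓡 g) G (𝓡 m₂) M₂)
    (q₁ : M₁ → Q₁) (q₂ : M₂ → Q₂) (q : M₁ × M₂ → M)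
    (K₁ : Pfaff.CovectorField (𝓡 m₁) M₁) (K₂ : Pfaff.CovectorField (𝓡 m₂) M₂)
    (hrep : Pfaff.IsQuotientRepresentation (l₁ := l₁) (l₂ := l₂) a₁ a₂ q₁ q₂ q K₁ K₂ I)
    -- the embedded non-characteristic integral manifold `S` of `I`
    {S : Type*} [TopologicalSpace S]
    [ChartedSpace (EuclideanSpace ℝ (Fin (n₁ + n₂ - 1))) S]
    [IsManifold (𝓡 (n₁ + n₂ - 1)) ∞ S]
    (s : S → M) (hs : Pfaff.IsIntegralManifold (𝓡 (n₁ + n₂ - 1)) I s) (hemb : IsEmbedding s)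
    (hnc : Pfaff.IsNonCharacteristic (𝓡 (n₁ + n₂ - 1)) I s)
    -- the chosen points
    (x₀ : M) (hx₀ : x₀ ∈ range s) (x₁ : M₁) (x₂ : M₂) (hx : q (x₁, x₂) = x₀) :
    (∃ (k : ℕ) (L : Type (max u₁ u₂)) (_ : TopologicalSpace L)
      (_ : ChartedSpace (EuclideanSpace ℝ (Fin k)) L) (j : L → M₁ × M₂),
      Pfaff.IsMaximalIntegralManifold k (Pfaff.sumSystem (𝓡 m₂) K₁ K₂) (q ⁻¹' range s) (x₁, x₂) j) ∧
    ∀ (k : ℕ) (L : Type (max u₁ u₂)) [TopologicalSpace L]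
      [ChartedSpace (EuclideanSpace ℝ (Fin k)) L] (j : L → M₁ × M₂),
      Pfaff.IsMaximalIntegralManifold k (Pfaff.sumSystem (𝓡 m₂) K₁ K₂) (q ⁻¹' range s) (x₁, x₂) j →
      k = n₁ + n₂ - 1 ∧
      Pfaff.IsIntegralManifold (𝓡 k) (Pfaff.sumSystem (𝓡 m₂) K₁ K₂) j ∧
      Pfaff.IsNonCharacteristic (𝓡 k) (Pfaff.sumSystem (𝓡 m₂) K₁ K₂) j := by
  have hp : q (x₁, x₂) ∈ range s := hx ▸ hx₀
  have : SecondCountableTopology S := hemb.secondCountableTopology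
  have h : Pfaff.IsTransversalReduction (Pfaff.sumSystem (𝓡 m₂) K₁ K₂) I q :=
    { pfaffian := hrep.pfaffian₁.sumSystem hrep.pfaffian₂
      smooth := hrep.quotient.smooth
      submersion := hrep.quotient.submersion
      transversal := fun x => eq_bot_iff.2 fun v hv =>
        hrep.transversal x ▸ ⟨hv.1, fun α hα => hv.2 α (Pfaff.sumSystem_derived_le x hα)⟩
      reduction := hrep.reduction
      -- The coframes of a decomposable system contain smooth local frames of `I`, whose constant
      -- combinations extend any covector of `I`.
      exists_section := fun x α hα => by
        obtain ⟨U, hU, hxU, r, _, _, _, _, θ, _, _, _, _, _, _, hθ, -, -, -, -, h⟩ :=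
          hI.2.2.2.2 x
        obtain ⟨φ, hφ, hφx⟩ := Pfaff.exists_isSectionOn_of_span hU hθ (fun y hy => (h y hy).2.2.1)
          hxU hα
        exact ⟨U, φ, hU, hxU, hφ, hφx⟩ }
  constructor
  · obtain ⟨L, _, _, j, hj, -⟩ := h.exists_isMaximalIntegralManifold hs hemb hp
    exact ⟨_, L, _, _, j, hj⟩
  · intro k L _ _ j hj
    obtain rfl := h.dim_eq hs hemb hj
    exact ⟨rfl, hj.integral, h.isNonCharacteristic hs hemb hnc hj.integral hj.subset⟩

end
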